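/- All homology is singular homology with real coefficients. For a singular chain $c=\sum_i r_i\sigma_i$ (distinct singular simplices $\sigma_i$, coefficients $r_i\neq 0$) put $\|c\|_\Delta=\sum_i|r_i|$; the simplicial norm $\|h\|_\Delta$ of a homology class $h$ is the infimum of $\|c\|_\Delta$ over all cycles $c$ representing $h$. A generalized stratification $\mathcal S$ of a space $X$ is a partition of $X$ into non-empty strata such that the directed graph on the strata with an arrow $S'\to S$ whenever $S\ne S'$ and $S\cap\overline{S'}\neq\emptyset$ has no directed cycles. Write $S\preceq S'$ if there is a directed path (possibly of length $0$) from $S'$ to $S$; two strata are incomparable if neither $S\preceq S'$ nor $S'\preceq S$. Given a (relative) cycle $c=\sum_i r_i\sigma_i$ of dimension $j$, let $\Sigma$ be the $\Delta$-complex obtained from one copy of the $j$-simplex for each $\sigma_i$ by identifying (order-preservingly) any two $(j-1)$-dimensional faces on which the restricted singular simplices coincide. Consider the following conditions on $c$. - Cellular: for each $\sigma_i$, the image of the interior of each face (of any dimension) lies in one stratum. - Order: no $\sigma_i$ meets two incomparable strata. - Internality: for each $\sigma_i$ and each face of positive dimension, if the boundary of the face maps into a stratum $S$, then the whole face maps into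 $S$. - Loop: every edge of $\Sigma$ whose two endpoints are the same vertex of $\Sigma$ is mapped to a single point of $X$. A singular simplex is essential if its vertices lie in pairwise different strata. For $A\subseteq X$ and $h'\in H_j(X,A)$, the essential stratified simplicial norm $\|h'\|^{\mathcal S}_{\Delta,\mathrm{ess}}\in[0,\infty]$ is the infimum of $\sum_{\sigma_i\text{ essential}}|r_i|$ over all relative cycles $c=\sum_i r_i\sigma_i$ of $(X,A)$ that represent $h'$ and satisfy the four conditions (it is $\infty$ if there are none). **Lemma.** Let $X$ be a finite CW-complex, let $j\ge 0$, let $h\in H_j(X)$, and let $h_{\mathrm{rel}}$ be the image of $h$ in $H_j(X,X^{j-1})$, where $X^{j-1}$ is the $(j-1)$-skeleton ($X^{-1}=\emptyset$). Let $\mathcal S$ be the generalized stratification of $X$ by the open cells. Let $Z$ be a topological space with contractible universal cover (that is, $Z$ has a contractible covering space), and let $\alpha:X\to Z$ be continuous. Then $$\|\alpha_*h\|_\Delta\le\|h_{\mathrm{rel}}\|^{\mathcal S}_{\Delta,\mathrm{ess}}.$$ -/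

import Mathlib

open Topology Set
open scoped ENNReal

noncomputable section

namespace SimplicialNorm

universe u v

/-! ## Singular chains and (relative) singular homology with real coefficients

The chains are finitely supported functions on the singular simplices, so that the coefficients of
a chain, which the norms are made of, can be read off directly. -/

section Homology

/-- The quotient of the subspace `Z` by the subspace `Z ∩ B` (which is `B` if `B ≤ Z`). -/
abbrev Subquotient {M : Type u} [AddCommGroup M] [Module ℝ M] (Z B : Submodule ℝ M) : Type u :=
  Z ⧸ B.submoduleOf Z

variable (X : Type u) [TopologicalSpace X]

/-- Singular `n`-simplices of `X`: continuous maps from the standard simplex with vertices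
`0, …, n` (in barycentric coordinates) to `X`. -/
abbrev SingularSimplex (n : ℕ) : Type u := C(stdSimplex ℝ (Fin (n + 1)), X)

/-- Real singular `n`-chains of `X`: finite formal linear combinations of singular simplices. -/
abbrev Chain (n : ℕ) : Type u := SingularSimplex X n →₀ ℝ

variable {X}

/-- The `i`-th face of a singular simplex, that is, its restriction to the face opposite to the
`i`-th vertex; the `k`-th vertex of this face is the vertex `i.succAbove k` of the simplex. -/
def SingularSimplex.face {n : ℕ} (σ : SingularSimplex X (n + 1)) (i : Fin (n + 2)) :
    SingularSimplex X n :=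
  σ.comp ⟨stdSimplex.map i.succAbove, stdSimplex.continuous_map i.succAbove⟩

variable (X)

/-- The singular boundary operator `∂ σ = ∑ i, (-1) ^ i • (i-th face of σ)`. -/
def boundary (n : ℕ) : Chain X (n + 1) →ₗ[ℝ] Chain X n :=
  Finsupp.linearCombination ℝ fun σ : SingularSimplex X (n + 1) =>
    ∑ i : Fin (n + 2), Finsupp.single (σ.face i) ((-1 : ℝ) ^ (i : ℕ))

variable {X} in
/-- The chains of `X` that are chains in the subspace `A`. -/
def chainsIn (A : Set X) (n : ℕ) : Submodule ℝ (Chain X n) :=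
  Finsupp.supported ℝ ℝ {σ : SingularSimplex X n | range σ ⊆ A}

/-- The singular cycles; every `0`-chain is a cycle. -/
def cycles : (n : ℕ) → Submodule ℝ (Chain X n)
  | 0 => ⊤
  | n + 1 => LinearMap.ker (boundary X n)

/-- The singular boundaries. -/
def boundaries (n : ℕ) : Submodule ℝ (Chain X n) := LinearMap.range (boundary X n)

/-- Singular homology `H_n(X) = H_n(X; ℝ)`. -/
abbrev Homology (n : ℕ) : Type u := Subquotient (cycles X n) (boundaries X n)

variable {X}

/-- The relative cycles of `(X, A)`: chains of `X` whose boundary is a chain in `A`. -/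
def relCycles (A : Set X) : (n : ℕ) → Submodule ℝ (Chain X n)
  | 0 => ⊤
  | n + 1 => (chainsIn A n).comap (boundary X n)

/-- The relative boundaries of `(X, A)`: sums of a boundary in `X` and a chain in `A`. -/
def relBoundaries (A : Set X) (n : ℕ) : Submodule ℝ (Chain X n) := boundaries X n ⊔ chainsIn A n

/-- Relative singular homology `H_n(X, A) = H_n(X, A; ℝ)`. -/
abbrev RelHomology (A : Set X) (n : ℕ) : Type u :=
  Subquotient (relCycles A n) (relBoundaries A n)

lemma cycles_le_relCycles (A : Set X) : ∀ n : ℕ, cycles X n ≤ relCycles A n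
  | 0 => le_top
  | n + 1 => fun c hc => by
      have h0 : boundary X n c = 0 := hc
      change boundary X n c ∈ chainsIn A n
      rw [h0]
      exact Submodule.zero_mem _

/-- The map `H_n(X) → H_n(X, A)`, `[c] ↦ [c]`. -/
def toRel (A : Set X) (n : ℕ) : Homology X n →ₗ[ℝ] RelHomology A n :=
  Submodule.mapQ _ _ (Submodule.inclusion (cycles_le_relCycles A n)) fun _ hc =>
    (le_sup_left : boundaries X n ≤ relBoundaries A n) hc

variable {Y : Type v} [TopologicalSpace Y]

/-- The map on singular chains induced by a continuous map, `σ ↦ α ∘ σ`. -/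
def chainMap (α : C(X, Y)) (n : ℕ) : Chain X n →ₗ[ℝ] Chain Y n :=
  Finsupp.lmapDomain ℝ ℝ fun σ : SingularSimplex X n => α.comp σ

lemma boundary_chainMap (α : C(X, Y)) (n : ℕ) (c : Chain X (n + 1)) :
    boundary Y n (chainMap α (n + 1) c) = chainMap α n (boundary X n c) := by
  suffices h : boundary Y n ∘ₗ chainMap α (n + 1) = chainMap α n ∘ₗ boundary X n from
    LinearMap.congr_fun h c
  refine Finsupp.lhom_ext fun σ r => ?_
  simp only [boundary, chainMap, LinearMap.comp_apply, Finsupp.lmapDomain_apply,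
    Finsupp.mapDomain_single, Finsupp.linearCombination_single, map_smul]
  rw [← Finsupp.lmapDomain_apply ℝ ℝ, map_sum]
  simp only [Finsupp.lmapDomain_apply, Finsupp.mapDomain_single]
  rfl

lemma chainMap_mem_cycles (α : C(X, Y)) :
    ∀ (n : ℕ) (c : Chain X n), c ∈ cycles X n → chainMap α n c ∈ cycles Y n
  | 0, _, _ => Submodule.mem_top
  | n + 1, c, hc => by
      have h0 : boundary X n c = 0 := hc
      change boundary Y n (chainMap α (n + 1) c) = 0
      rw [boundary_chainMap, h0, map_zero]

/-- The map `α_* : H_n(X) → H_n(Y)`, `[∑ r_i σ_i] ↦ [∑ r_i (α ∘ σ_i)]`, induced by a continuous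
map `α`. -/
def homologyMap (α : C(X, Y)) (n : ℕ) : Homology X n →ₗ[ℝ] Homology Y n :=
  Submodule.mapQ _ _ ((chainMap α n).restrict (chainMap_mem_cycles α n)) fun c hc => by
    obtain ⟨b, hb⟩ : ∃ b, boundary X n b = c := hc
    exact ⟨chainMap α (n + 1) b, by rw [boundary_chainMap, hb]; rfl⟩

/-- The sum of the absolute values of the coefficients of a chain. -/
def chainNorm {n : ℕ} (c : Chain X n) : ℝ := ∑ σ ∈ c.support, |c σ|

/-- The simplicial norm `‖h‖_Δ` of a homology class `h`. -/
def simplicialNorm {n : ℕ} (h : Homology X n) : ℝ≥0∞ :=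
  ⨅ (c : cycles X n) (_ : Submodule.Quotient.mk c = h), ENNReal.ofReal (chainNorm (c : Chain X n))

end Homology

/-! ## Generalized stratifications -/

/-- A generalized stratification of a space `X`: a partition of `X` into non-empty sets (strata)
such that the directed graph with an arrow `S → S'` whenever `S` and `S'` are different strata and
`S'` meets the closure of `S` has no directed cycles. -/
structure GeneralizedStratification (X : Type u) [TopologicalSpace X] where
  /-- The set indexing the strata. -/
  Index : Type u
  /-- The strata. -/
  stratum : Index → Set X
  nonempty : ∀ s, (stratum s).Nonempty
  disjoint : ∀ s t, s ≠ t → Disjoint (stratum s) (stratum t)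
  cover : ⋃ s, stratum s = univ
  acyclic : ∀ s, ¬ Relation.TransGen
    (fun a b => a ≠ b ∧ (stratum b ∩ closure (stratum a)).Nonempty) s s

namespace GeneralizedStratification

variable {X : Type u} [TopologicalSpace X] (S : GeneralizedStratification X)

/-- The stratum `a` limits to the stratum `b`. -/
def LimitsTo (a b : S.Index) : Prop :=
  a ≠ b ∧ (S.stratum b ∩ closure (S.stratum a)).Nonempty

/-- The partial order on strata: `b ≼ a` if there is a directed path (possibly of length zero)
from `a` to `b`. -/
def Below (b a : S.Index) : Prop := Relation.ReflTransGen S.LimitsTo a b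

end GeneralizedStratification

/-! ## Chains that are consistent with a generalized stratification -/

/-- The closed face of the standard simplex spanned by a set `t` of vertices. -/
def closedFace {n : ℕ} (t : Finset (Fin (n + 1))) : Set (stdSimplex ℝ (Fin (n + 1))) :=
  {x | ∀ i, i ∉ t → x i = 0}

/-- The interior of the face spanned by `t`; it is the whole face if `t` is a single vertex. -/
def openFace {n : ℕ} (t : Finset (Fin (n + 1))) : Set (stdSimplex ℝ (Fin (n + 1))) :=
  {x | x ∈ closedFace t ∧ ∀ i ∈ t, 0 < x i}

/-- The boundary of the face spanned by `t`. -/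
def faceBoundary {n : ℕ} (t : Finset (Fin (n + 1))) : Set (stdSimplex ℝ (Fin (n + 1))) :=
  closedFace t \ openFace t

section Conditions

variable {X : Type u} [TopologicalSpace X] (S : GeneralizedStratification X)

/-- The cellular condition: for each simplex of `c`, the image of the interior of each face (of any
dimension) is contained in one stratum. -/
def Cellular {n : ℕ} (c : Chain X n) : Prop :=
  ∀ σ ∈ c.support, ∀ t : Finset (Fin (n + 1)), t.Nonempty →
    ∃ s, ∀ x ∈ openFace t, σ x ∈ S.stratum s

/-- The order condition: no simplex of `c` meets two incomparable strata. -/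
def Ordered {n : ℕ} (c : Chain X n) : Prop :=
  ∀ σ ∈ c.support, ∀ a b : S.Index,
    (range σ ∩ S.stratum a).Nonempty → (range σ ∩ S.stratum b).Nonempty →
      S.Below a b ∨ S.Below b a

/-- The internality condition: for each simplex of `c`, if the boundary of a face (of positive
dimension) maps into a stratum, then the whole face maps into this stratum. -/
def Internal {n : ℕ} (c : Chain X n) : Prop :=
  ∀ σ ∈ c.support, ∀ t : Finset (Fin (n + 1)), 2 ≤ t.card → ∀ s : S.Index,
    (∀ x ∈ faceBoundary t, σ x ∈ S.stratum s) → ∀ x ∈ closedFace t, σ x ∈ S.stratum s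

/-- Let `Σ` be the Δ-complex obtained from one copy of the standard simplex for each simplex of `c`
by identifying two faces of codimension one whenever the restrictions of the singular simplices to
them coincide. `VertexGlue c (σ, p) (τ, q)` says that the `p`-th vertex of the copy of `σ` and
the `q`-th vertex of the copy of `τ` are corresponding vertices of two such faces. -/
def VertexGlue : {n : ℕ} → Chain X n →
    SingularSimplex X n × Fin (n + 1) → SingularSimplex X n × Fin (n + 1) → Prop
  | 0, _ => fun _ _ => False
  | _ + 1, c => fun v w => v.1 ∈ c.support ∧ w.1 ∈ c.support ∧
      ∃ a b k, v.1.face a = w.1.face b ∧ v.2 = a.succAbove k ∧ w.2 = b.succAbove k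

/-- Two vertices of copies of simplices of `c` are the same vertex of `Σ`. -/
def SameVertex {n : ℕ} (c : Chain X n) (v w : SingularSimplex X n × Fin (n + 1)) : Prop :=
  Relation.EqvGen (VertexGlue c) v w

/-- The loop condition: each edge of `Σ` that is a self-loop is mapped to a single point of `X`. -/
def LoopCondition {n : ℕ} (c : Chain X n) : Prop :=
  ∀ σ ∈ c.support, ∀ p q : Fin (n + 1), p ≠ q → SameVertex c (σ, p) (σ, q) →
    ∀ x ∈ closedFace {p, q}, ∀ y ∈ closedFace {p, q}, σ x = σ y

/-- A singular simplex is essential if no two of its vertices lie in the same stratum. -/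
def Essential {n : ℕ} (σ : SingularSimplex X n) : Prop :=
  ∀ p q : Fin (n + 1), p ≠ q → ∀ s : S.Index,
    ¬ (σ (stdSimplex.vertex p) ∈ S.stratum s ∧ σ (stdSimplex.vertex q) ∈ S.stratum s)

open Classical in
/-- The sum of the absolute values of the coefficients of the essential simplices of a chain. -/
def essentialChainNorm {n : ℕ} (c : Chain X n) : ℝ :=
  ∑ σ ∈ c.support with Essential S σ, |c σ|

/-- The essential stratified simplicial norm of a relative homology class `h` of `(X, A)`: the
infimum of `essentialChainNorm` over all relative cycles that represent `h` and satisfy the four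
conditions (infinity if there are none). -/
def essentialNorm {A : Set X} {n : ℕ} (h : RelHomology A n) : ℝ≥0∞ :=
  ⨅ (c : relCycles A n) (_ : Submodule.Quotient.mk c = h)
    (_ : Cellular S (c : Chain X n) ∧ Ordered S (c : Chain X n) ∧ Internal S (c : Chain X n) ∧
      LoopCondition (c : Chain X n)),
    ENNReal.ofReal (essentialChainNorm S (c : Chain X n))

end Conditions

/-! ## The stratification of a CW-complex by its open cells, and aspherical spaces -/

section CW

variable (X : Type u) [TopologicalSpace X] [T2Space X] [CWComplex (univ : Set X)]

lemma dim_lt_of_meets_closure {a b : Σ n, RelCWComplex.cell (univ : Set X) n} (hne : a ≠ b)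
    (h : (RelCWComplex.openCell b.1 b.2 ∩ closure (RelCWComplex.openCell a.1 a.2)).Nonempty) :
    b.1 < a.1 := by
  obtain ⟨x, hxb, hxa⟩ := h
  rw [RelCWComplex.closure_openCell_eq_closedCell,
    ← RelCWComplex.cellFrontier_union_openCell_eq_closedCell] at hxa
  rcases hxa with hxa | hxa
  · have h1 := RelCWComplex.cellFrontier_subset_skeletonLT a.1 a.2 hxa
    by_contra hlt
    have h2 := RelCWComplex.disjoint_skeletonLT_openCell (C := (univ : Set X)) (n := (a.1 : ℕ∞))
      (j := b.2) (by exact_mod_cast not_lt.1 hlt)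
    exact Set.disjoint_left.1 h2 h1 hxb
  · exact absurd hxa (Set.disjoint_left.1 (RelCWComplex.disjoint_openCell_of_ne hne.symm) hxb)

/-- The generalized stratification of a CW-complex `X` by its open cells. -/
def cellStratification : GeneralizedStratification X where
  Index := Σ n, RelCWComplex.cell (univ : Set X) n
  stratum e := RelCWComplex.openCell e.1 e.2
  nonempty e := RelCWComplex.openCell_nonempty e.1 e.2
  disjoint _ _ h := RelCWComplex.disjoint_openCell_of_ne h
  cover := by
    rw [Set.iUnion_sigma]
    exact CWComplex.iUnion_openCell_eq_complex
  acyclic := by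
    have key : ∀ a b, Relation.TransGen (fun a b : Σ n, RelCWComplex.cell (univ : Set X) n =>
        a ≠ b ∧ (RelCWComplex.openCell b.1 b.2 ∩
          closure (RelCWComplex.openCell a.1 a.2)).Nonempty) a b → b.1 < a.1 := by
      intro a b h
      induction h with
      | single h => exact dim_lt_of_meets_closure X h.1 h.2
      | tail _ h ih => exact (dim_lt_of_meets_closure X h.1 h.2).trans ih
    exact fun e h => lt_irrefl _ (key e e h)

end CW

/-- The universal cover of `Z` is contractible: `Z` has a contractible (hence simply connected)
covering space. -/
def HasContractibleUniversalCover (Z : Type v) [TopologicalSpace Z] : Prop :=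
  ∃ (E : Type v) (_ : TopologicalSpace E) (p : E → Z),
    ContractibleSpace E ∧ IsCoveringMap p ∧ Function.Surjective p

end SimplicialNorm

end

noncomputable section

namespace SimplicialNorm

universe u v

/-! ## Chains of tuples -/

section Tuples

variable {V W : Type*}

/-! Let `p : E → Z` be a covering with contractible total space, and let P be the pullback of `p`
along `α` (`LiftSpace`); deck transformations act on P and on `E`. For each d choose a weight on `X`
that vanishes on the cells of dimension less than d and is positive on the open d-cells, together
with a lift of `α` to `E` where it is positive (`exists_cellNeighborhood`). A point of P over an
open d-cell gets the label (d, g), where g is the deck transformation carrying the chosen lift to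
the given one. Straightening sends a simplex of P to the antisymmetrized straight simplex of `E` on
the labels of its vertices. It is an equivariant chain map, equivariantly homotopic to the
projection, so on cycles of `X` it computes the map induced by `α`
(`sub_straighten_mem_boundaries`). It does not increase the ℓ¹-norm and kills simplices with a
repeated label. Under the conditions on c, two vertices in one stratum are joined by an edge inside
that stratum, hence have equal labels; so only essential simplices contribute
(`chainNorm_straighten_le`).

The relative cycle c is not a cycle, but c - a is one representing h up to a boundary, for some
chain a in the (j-1)-skeleton. Nothing is known about the simplices of a, and the crux is that a
straightens to a boundary (`straighten_liftChain_mem_boundaries`). Relabel points by (d, g) with d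
now the dimension whose weight is maximal at the point. After fine barycentric subdivision of the
simplices of a, vertices of a small simplex with equal d have equal labels. Over the skeleton only j
values of d are available to the j + 1 vertices, so antisymmetrization kills the relabelled a. The
cone homotopy between the two labellings contributes its value on ∂a = ∂c; the simplices of ∂c are
well behaved, so the homotopy keeps the property that equal d forces equal labels
(`labelHomotopy_mem`), and the same pigeonhole argument kills this term. -/

/-- Formal real linear combinations of `(n + 1)`-tuples of elements of `W`. -/
abbrev TupleChain (W : Type*) (n : ℕ) : Type _ := (Fin (n + 1) → W) →₀ ℝ

/-- The simplicial boundary operator on tuples. -/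
def tupleBoundary (W : Type*) (n : ℕ) : TupleChain W (n + 1) →ₗ[ℝ] TupleChain W n :=
  Finsupp.linearCombination ℝ fun w : Fin (n + 2) → W =>
    ∑ i : Fin (n + 2), Finsupp.single (w ∘ i.succAbove) ((-1 : ℝ) ^ (i : ℕ))

/-- The map on chains of tuples induced by a function. -/
def tupleMap (f : V → W) (n : ℕ) : TupleChain V n →ₗ[ℝ] TupleChain W n :=
  Finsupp.lmapDomain ℝ ℝ fun w : Fin (n + 1) → V => f ∘ w

/-- The cone over a chain of tuples with a given apex. -/
def tupleCone (a : W) (n : ℕ) : TupleChain W n →ₗ[ℝ] TupleChain W (n + 1) :=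
  Finsupp.lmapDomain ℝ ℝ fun w : Fin (n + 1) → W => (Fin.cons a w : Fin (n + 2) → W)

/-- The sum of the coefficients. -/
def augmentation (S : Type*) : (S →₀ ℝ) →ₗ[ℝ] ℝ := Finsupp.linearCombination ℝ fun _ => (1 : ℝ)

@[simp] lemma augmentation_single {S : Type*} (s : S) (r : ℝ) :
    augmentation S (Finsupp.single s r) = r := by
  simp [augmentation]

lemma tupleBoundary_single (n : ℕ) (w : Fin (n + 2) → W) (r : ℝ) :
    tupleBoundary W n (Finsupp.single w r) =
      r • ∑ i : Fin (n + 2), Finsupp.single (w ∘ i.succAbove) ((-1 : ℝ) ^ (i : ℕ)) := by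
  simp [tupleBoundary]

@[simp] lemma tupleMap_single (f : V → W) (n : ℕ) (w : Fin (n + 1) → V) (r : ℝ) :
    tupleMap f n (Finsupp.single w r) = Finsupp.single (f ∘ w) r := by
  simp [tupleMap]

@[simp] lemma tupleCone_single (a : W) (n : ℕ) (w : Fin (n + 1) → W) (r : ℝ) :
    tupleCone a n (Finsupp.single w r) = Finsupp.single (Fin.cons a w : Fin (n + 2) → W) r := by
  simp [tupleCone]

lemma tupleMap_comp {U : Type*} (f : V → W) (g : U → V) (n : ℕ) (x : TupleChain U n) :
    tupleMap (f ∘ g) n x = tupleMap f n (tupleMap g n x) := by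
  suffices h : tupleMap (f ∘ g) n = tupleMap f n ∘ₗ tupleMap g n from LinearMap.congr_fun h x
  refine Finsupp.lhom_ext fun w r => ?_
  simp [Function.comp_assoc]

lemma tupleBoundary_tupleMap (f : V → W) (n : ℕ) (x : TupleChain V (n + 1)) :
    tupleBoundary W n (tupleMap f (n + 1) x) = tupleMap f n (tupleBoundary V n x) := by
  suffices h : tupleBoundary W n ∘ₗ tupleMap f (n + 1) = tupleMap f n ∘ₗ tupleBoundary V n from
    LinearMap.congr_fun h x
  refine Finsupp.lhom_ext fun w r => ?_
  simp [tupleBoundary_single, Function.comp_assoc]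

lemma tupleMap_tupleCone (f : V → W) (a : V) (n : ℕ) (x : TupleChain V n) :
    tupleMap f (n + 1) (tupleCone a n x) = tupleCone (f a) n (tupleMap f n x) := by
  suffices h : tupleMap f (n + 1) ∘ₗ tupleCone a n = tupleCone (f a) n ∘ₗ tupleMap f n from
    LinearMap.congr_fun h x
  refine Finsupp.lhom_ext fun w r => ?_
  simp only [LinearMap.comp_apply, tupleCone_single, tupleMap_single]
  congr 1
  exact Fin.comp_cons f a w

lemma augmentation_tupleMap (f : V → W) (n : ℕ) (x : TupleChain V n) :
    augmentation _ (tupleMap f n x) = augmentation _ x := by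
  suffices h : augmentation _ ∘ₗ tupleMap f n = augmentation _ from LinearMap.congr_fun h x
  refine Finsupp.lhom_ext fun w r => ?_
  simp

lemma augmentation_tupleBoundary (x : TupleChain W 1) :
    augmentation _ (tupleBoundary W 0 x) = 0 := by
  suffices h : augmentation _ ∘ₗ tupleBoundary W 0 = 0 from LinearMap.congr_fun h x
  refine Finsupp.lhom_ext fun w r => ?_
  simp [tupleBoundary_single, Fin.sum_univ_two]

lemma tupleBoundary_tupleCone_zero (a : W) (x : TupleChain W 0) :
    tupleBoundary W 0 (tupleCone a 0 x) = x - augmentation _ x • Finsupp.single (fun _ => a) 1 := by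
  suffices h : tupleBoundary W 0 ∘ₗ tupleCone a 0 =
      LinearMap.id - (augmentation _).smulRight (Finsupp.single (fun _ => a) 1) from
    LinearMap.congr_fun h x
  refine Finsupp.lhom_ext fun w r => ?_
  have h0 : (Fin.cons a w : Fin 2 → W) ∘ (0 : Fin 2).succAbove = w := by
    funext i
    simp
  have h1 : (Fin.cons a w : Fin 2 → W) ∘ (1 : Fin 2).succAbove = fun _ => a := by
    funext i
    fin_cases i
    rfl
  simp only [LinearMap.comp_apply, tupleCone_single, tupleBoundary_single]
  rw [Fin.sum_univ_succ (n := 1), Fin.sum_univ_one, h0]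
  change r • (_ + Finsupp.single ((Fin.cons a w : Fin 2 → W) ∘ (1 : Fin 2).succAbove) _) = _
  rw [h1]
  simp [sub_eq_add_neg]

lemma tupleBoundary_tupleCone_succ (a : W) (n : ℕ) (x : TupleChain W (n + 1)) :
    tupleBoundary W (n + 1) (tupleCone a (n + 1) x) =
      x - tupleCone a n (tupleBoundary W n x) := by
  suffices h : tupleBoundary W (n + 1) ∘ₗ tupleCone a (n + 1) =
      LinearMap.id - tupleCone a n ∘ₗ tupleBoundary W n from LinearMap.congr_fun h x
  refine Finsupp.lhom_ext fun w r => ?_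
  have h0 : (Fin.cons a w : Fin (n + 3) → W) ∘ (0 : Fin (n + 3)).succAbove = w := by
    funext i
    simp
  have h1 : ∀ i : Fin (n + 2), (Fin.cons a w : Fin (n + 3) → W) ∘ i.succ.succAbove =
      Fin.cons a (w ∘ i.succAbove) := by
    intro i
    funext k
    refine Fin.cases ?_ (fun k => ?_) k <;> simp
  simp only [LinearMap.comp_apply, tupleCone_single, tupleBoundary_single,
    Fin.sum_univ_succ (n := n + 2), h0, h1, LinearMap.sub_apply, LinearMap.id_apply, map_smul,
    map_sum]
  simp [pow_succ, sub_eq_add_neg, Finset.sum_neg_distrib]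

/-- Every tuple is the cone over its tail with apex its zeroth entry. With the cone formula this
turns `∂∂ = 0` into an induction on the dimension. -/
lemma linearMap_ext_tupleCone {M : Type*} [AddCommGroup M] [Module ℝ M] {n : ℕ}
    {f g : TupleChain W (n + 1) →ₗ[ℝ] M}
    (h : ∀ (a : W) (x : TupleChain W n), f (tupleCone a n x) = g (tupleCone a n x)) : f = g := by
  refine Finsupp.lhom_ext fun w r => ?_
  have := h (w 0) (Finsupp.single (Fin.tail w) r)
  rwa [tupleCone_single, Fin.cons_self_tail] at this

lemma tupleBoundary_tupleBoundary (n : ℕ) (x : TupleChain W (n + 2)) :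
    tupleBoundary W n (tupleBoundary W (n + 1) x) = 0 := by
  suffices h : ∀ n, tupleBoundary W n ∘ₗ tupleBoundary W (n + 1) = 0 from
    LinearMap.congr_fun (h n) x
  intro n
  induction n with
  | zero =>
    refine linearMap_ext_tupleCone fun a x => ?_
    simp [tupleBoundary_tupleCone_succ, tupleBoundary_tupleCone_zero, augmentation_tupleBoundary]
  | succ n ih =>
    refine linearMap_ext_tupleCone fun a x => ?_
    have := LinearMap.congr_fun ih x
    simp only [LinearMap.comp_apply, LinearMap.zero_apply] at this
    simp [tupleBoundary_tupleCone_succ, this]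

end Tuples

/-! ## The singular chain complex -/

section Singular

variable {X : Type u} [TopologicalSpace X]

/-- The restriction of a singular simplex along a map of vertices. -/
def SingularSimplex.restrict {N n : ℕ} (σ : SingularSimplex X N) (f : Fin (n + 1) → Fin (N + 1)) :
    SingularSimplex X n :=
  σ.comp ⟨stdSimplex.map f, stdSimplex.continuous_map f⟩

lemma SingularSimplex.restrict_id {N : ℕ} (σ : SingularSimplex X N) : σ.restrict id = σ := by
  ext x
  simp [SingularSimplex.restrict]

lemma SingularSimplex.restrict_restrict {N n m : ℕ} (σ : SingularSimplex X N)
    (f : Fin (n + 1) → Fin (N + 1)) (g : Fin (m + 1) → Fin (n + 1)) :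
    (σ.restrict f).restrict g = σ.restrict (f ∘ g) := by
  ext x
  simp [SingularSimplex.restrict, stdSimplex.map_comp_apply]

lemma SingularSimplex.restrict_apply {N n : ℕ} (σ : SingularSimplex X N)
    (f : Fin (n + 1) → Fin (N + 1)) (x : stdSimplex ℝ (Fin (n + 1))) :
    σ.restrict f x = σ (stdSimplex.map f x) := rfl

lemma SingularSimplex.face_eq_restrict {n : ℕ} (σ : SingularSimplex X (n + 1)) (i : Fin (n + 2)) :
    σ.face i = σ.restrict i.succAbove := rfl

lemma boundary_single (n : ℕ) (σ : SingularSimplex X (n + 1)) (r : ℝ) :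
    boundary X n (Finsupp.single σ r) =
      r • ∑ i : Fin (n + 2), Finsupp.single (σ.face i) ((-1 : ℝ) ^ (i : ℕ)) := by
  simp [boundary]

@[simp] lemma chainMap_single {Y : Type v} [TopologicalSpace Y] (α : C(X, Y)) (n : ℕ)
    (σ : SingularSimplex X n) (r : ℝ) :
    chainMap α n (Finsupp.single σ r) = Finsupp.single (α.comp σ) r := by
  simp [chainMap]

/-- The chain map from tuples of vertices of the simplex to singular chains given by a singular
simplex. -/
def SingularSimplex.ofTuples {N : ℕ} (σ : SingularSimplex X N) (n : ℕ) :
    TupleChain (Fin (N + 1)) n →ₗ[ℝ] Chain X n :=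
  Finsupp.lmapDomain ℝ ℝ fun f => σ.restrict f

lemma SingularSimplex.boundary_ofTuples {N : ℕ} (σ : SingularSimplex X N) (n : ℕ)
    (x : TupleChain (Fin (N + 1)) (n + 1)) :
    boundary X n (σ.ofTuples (n + 1) x) = σ.ofTuples n (tupleBoundary _ n x) := by
  suffices h : boundary X n ∘ₗ σ.ofTuples (n + 1) = σ.ofTuples n ∘ₗ tupleBoundary _ n from
    LinearMap.congr_fun h x
  refine Finsupp.lhom_ext fun w r => ?_
  simp [SingularSimplex.ofTuples, tupleBoundary_single, boundary_single,
    SingularSimplex.face_eq_restrict, SingularSimplex.restrict_restrict]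

/-- A singular simplex is the image of the tuple of all its vertices under the chain map `ofTuples`,
so the identity is inherited from tuples. -/
lemma boundary_boundary (n : ℕ) (x : Chain X (n + 2)) :
    boundary X n (boundary X (n + 1) x) = 0 := by
  suffices h : boundary X n ∘ₗ boundary X (n + 1) = 0 from LinearMap.congr_fun h x
  refine Finsupp.lhom_ext fun σ r => ?_
  have h : Finsupp.single σ r = σ.ofTuples (n + 2) (Finsupp.single id r) := by
    simp [SingularSimplex.ofTuples, SingularSimplex.restrict_id]
  simp only [LinearMap.comp_apply, h, SingularSimplex.boundary_ofTuples,
    tupleBoundary_tupleBoundary, map_zero, LinearMap.zero_apply]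

lemma chainMap_comp {Y : Type*} {Z : Type*} [TopologicalSpace Y] [TopologicalSpace Z]
    (g : C(Y, Z)) (f : C(X, Y)) (n : ℕ) (x : Chain X n) :
    chainMap (g.comp f) n x = chainMap g n (chainMap f n x) := by
  suffices h : chainMap (g.comp f) n = chainMap g n ∘ₗ chainMap f n from LinearMap.congr_fun h x
  refine Finsupp.lhom_ext fun w r => ?_
  simp [ContinuousMap.comp_assoc]

end Singular

/-! ## Chain homotopies constructed from cones -/

section ConeHomotopy

variable {Y : Type u} [TopologicalSpace Y] {D : ℕ → Type*} [∀ n, AddCommGroup (D n)]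
  [∀ n, Module ℝ (D n)]

/-- The chain homotopy between a chain map `F` and zero that is constructed inductively from a
choice of a cone operator for each singular simplex. -/
def coneHomotopy (cone : ∀ n, SingularSimplex Y n → D n →ₗ[ℝ] D (n + 1))
    (F : ∀ n, Chain Y n →ₗ[ℝ] D n) : ∀ n, Chain Y n →ₗ[ℝ] D (n + 1)
  | 0 => Finsupp.linearCombination ℝ fun σ => cone 0 σ (F 0 (Finsupp.single σ 1))
  | n + 1 => Finsupp.linearCombination ℝ fun σ => cone (n + 1) σ
      (F (n + 1) (Finsupp.single σ 1) - coneHomotopy cone F n (boundary Y n (Finsupp.single σ 1)))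

lemma coneHomotopy_zero_single (cone : ∀ n, SingularSimplex Y n → D n →ₗ[ℝ] D (n + 1))
    (F : ∀ n, Chain Y n →ₗ[ℝ] D n) (σ : SingularSimplex Y 0) :
    coneHomotopy cone F 0 (Finsupp.single σ 1) = cone 0 σ (F 0 (Finsupp.single σ 1)) := by
  simp [coneHomotopy]

lemma coneHomotopy_succ_single (cone : ∀ n, SingularSimplex Y n → D n →ₗ[ℝ] D (n + 1))
    (F : ∀ n, Chain Y n →ₗ[ℝ] D n) (n : ℕ) (σ : SingularSimplex Y (n + 1)) :
    coneHomotopy cone F (n + 1) (Finsupp.single σ 1) = cone (n + 1) σ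
      (F (n + 1) (Finsupp.single σ 1) -
        coneHomotopy cone F n (boundary Y n (Finsupp.single σ 1))) := by
  simp [coneHomotopy]

variable (d : ∀ n, D (n + 1) →ₗ[ℝ] D n) (cone : ∀ n, SingularSimplex Y n → D n →ₗ[ℝ] D (n + 1))
    (F : ∀ n, Chain Y n →ₗ[ℝ] D n)

/-- By the formula one degree lower, `F - h ∂` is a cycle on each simplex, and the cone operator
fills it. In degree zero cones fill only chains of augmentation zero, so filling is required just
for the values of `F`. -/
lemma coneHomotopy_spec (hF : ∀ n x, d n (F (n + 1) x) = F n (boundary Y n x))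
    (hcone : ∀ n σ x, d n x = 0 → d (n + 1) (cone (n + 1) σ x) = x)
    (hcone₀ : ∀ σ, d 0 (cone 0 σ (F 0 (Finsupp.single σ 1))) = F 0 (Finsupp.single σ 1)) :
    (∀ x, d 0 (coneHomotopy cone F 0 x) = F 0 x) ∧
    ∀ n x, d (n + 1) (coneHomotopy cone F (n + 1) x) + coneHomotopy cone F n (boundary Y n x) =
      F (n + 1) x := by
  have h0 : ∀ x, d 0 (coneHomotopy cone F 0 x) = F 0 x := by
    intro x
    suffices h : d 0 ∘ₗ coneHomotopy cone F 0 = F 0 from LinearMap.congr_fun h x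
    refine Finsupp.lhom_ext' fun σ => LinearMap.ext_ring ?_
    simp [coneHomotopy_zero_single, hcone₀]
  -- The previous degree enters only through boundaries, where its own correction term vanishes
  -- because `∂∂ = 0`.
  have key : ∀ n, (∀ x, d n (coneHomotopy cone F n (boundary Y n x)) = F n (boundary Y n x)) →
      ∀ x, d (n + 1) (coneHomotopy cone F (n + 1) x) + coneHomotopy cone F n (boundary Y n x) =
      F (n + 1) x := by
    intro n hn x
    suffices h : d (n + 1) ∘ₗ coneHomotopy cone F (n + 1) + coneHomotopy cone F n ∘ₗ boundary Y n =
        F (n + 1) from LinearMap.congr_fun h x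
    refine Finsupp.lhom_ext' fun σ => LinearMap.ext_ring ?_
    simp only [LinearMap.comp_apply, Finsupp.lsingle_apply, LinearMap.add_apply,
      coneHomotopy_succ_single]
    rw [hcone _ _ _ (by rw [map_sub, hF, hn, sub_self]), sub_add_cancel]
  refine ⟨h0, fun n => ?_⟩
  induction n with
  | zero => exact key 0 fun x => h0 _
  | succ n ih =>
    refine key (n + 1) fun x => ?_
    have := ih (boundary Y (n + 1) x)
    rwa [boundary_boundary, map_zero, add_zero] at this

/-- The cones are the only choices in the construction, so their equivariance propagates by
induction. -/
lemma coneHomotopy_equivariant (g : C(Y, Y)) (gD : ∀ n, D n →ₗ[ℝ] D n)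
    (hF : ∀ n x, F n (chainMap g n x) = gD n (F n x))
    (hcone : ∀ n σ x, cone n (g.comp σ) (gD n x) = gD (n + 1) (cone n σ x)) (n : ℕ) (x : Chain Y n) :
    coneHomotopy cone F n (chainMap g n x) = gD (n + 1) (coneHomotopy cone F n x) := by
  suffices h : ∀ n, coneHomotopy cone F n ∘ₗ chainMap g n = gD (n + 1) ∘ₗ coneHomotopy cone F n from
    LinearMap.congr_fun (h n) x
  intro n
  induction n with
  | zero =>
    refine Finsupp.lhom_ext' fun σ => LinearMap.ext_ring ?_
    have := hF 0 (Finsupp.single σ 1)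
    rw [chainMap_single] at this
    simp [coneHomotopy_zero_single, this, hcone]
  | succ n ih =>
    refine Finsupp.lhom_ext' fun σ => LinearMap.ext_ring ?_
    have h1 := hF (n + 1) (Finsupp.single σ 1)
    have h2 := LinearMap.congr_fun ih (boundary Y n (Finsupp.single σ 1))
    simp only [LinearMap.comp_apply] at h2
    rw [← boundary_chainMap, chainMap_single] at h2
    rw [chainMap_single] at h1
    simp [coneHomotopy_succ_single, h1, h2, ← map_sub, hcone]

end ConeHomotopy

/-! ## Supports and the `ℓ¹`-norm -/

section Supports

variable {S T : Type*}

/-- Reduces statements on chains to generators: `P = ⊥` gives vanishing, and `P` a supported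
submodule gives control of supports. -/
lemma map_mem_of_mem_supported {M : Type*} [AddCommGroup M] [Module ℝ M] {A : Set S}
    {x : S →₀ ℝ} (hx : x ∈ Finsupp.supported ℝ ℝ A) (f : (S →₀ ℝ) →ₗ[ℝ] M) (P : Submodule ℝ M)
    (hf : ∀ s ∈ A, f (Finsupp.single s 1) ∈ P) : f x ∈ P := by
  rw [Finsupp.supported_eq_span_single] at hx
  have : Submodule.span ℝ ((fun i => Finsupp.single i (1 : ℝ)) '' A) ≤ P.comap f := by
    rw [Submodule.span_le]
    rintro _ ⟨s, hs, rfl⟩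
    exact hf s hs
  exact this hx

/-- The sum of the absolute values of the coefficients. -/
def lOneNorm (x : S →₀ ℝ) : ℝ := ∑ s ∈ x.support, |x s|

lemma lOneNorm_eq_sum {x : S →₀ ℝ} {A : Finset S} (h : x.support ⊆ A) :
    lOneNorm x = ∑ s ∈ A, |x s| :=
  Finset.sum_subset h fun s _ hs => by simpa using hs

lemma lOneNorm_single (s : S) (r : ℝ) : lOneNorm (Finsupp.single s r) = |r| := by
  rw [lOneNorm_eq_sum (A := {s}) Finsupp.support_single_subset]
  simp

lemma lOneNorm_add_le (x y : S →₀ ℝ) : lOneNorm (x + y) ≤ lOneNorm x + lOneNorm y := by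
  classical
  rw [lOneNorm_eq_sum (A := x.support ∪ y.support) Finsupp.support_add,
    lOneNorm_eq_sum (x := x) Finset.subset_union_left,
    lOneNorm_eq_sum (x := y) Finset.subset_union_right, ← Finset.sum_add_distrib]
  exact Finset.sum_le_sum fun s _ => abs_add_le _ _

lemma lOneNorm_smul (r : ℝ) (x : S →₀ ℝ) : lOneNorm (r • x) = |r| * lOneNorm x := by
  rw [lOneNorm_eq_sum (A := x.support) Finsupp.support_smul, lOneNorm, Finset.mul_sum]
  simp [abs_mul]

lemma lOneNorm_sum_le {ι : Type*} (A : Finset ι) (f : ι → S →₀ ℝ) :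
    lOneNorm (∑ i ∈ A, f i) ≤ ∑ i ∈ A, lOneNorm (f i) := by
  classical
  induction A using Finset.induction_on with
  | empty => simp [lOneNorm]
  | insert a A ha ih =>
    rw [Finset.sum_insert ha, Finset.sum_insert ha]
    exact (lOneNorm_add_le _ _).trans (by gcongr)

/-- Keeping the norm of each image as a weight lets generators killed by `f` drop out; this is how
inessential simplices disappear from the final estimate. -/
lemma lOneNorm_map_le (f : (S →₀ ℝ) →ₗ[ℝ] (T →₀ ℝ)) (x : S →₀ ℝ) :
    lOneNorm (f x) ≤ ∑ s ∈ x.support, |x s| * lOneNorm (f (Finsupp.single s 1)) := by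
  have h : f x = ∑ s ∈ x.support, x s • f (Finsupp.single s 1) := by
    conv_lhs => rw [← Finsupp.sum_single x, Finsupp.sum, map_sum]
    refine Finset.sum_congr rfl fun s _ => ?_
    rw [← map_smul, Finsupp.smul_single, smul_eq_mul, mul_one]
  rw [h]
  refine (lOneNorm_sum_le _ _).trans (le_of_eq (Finset.sum_congr rfl fun s _ => ?_))
  rw [lOneNorm_smul]

lemma lOneNorm_map_le_of_single_le_one (f : (S →₀ ℝ) →ₗ[ℝ] (T →₀ ℝ))
    (hf : ∀ s, lOneNorm (f (Finsupp.single s 1)) ≤ 1) (x : S →₀ ℝ) :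
    lOneNorm (f x) ≤ lOneNorm x :=
  (lOneNorm_map_le f x).trans (Finset.sum_le_sum fun s _ =>
    mul_le_of_le_one_right (abs_nonneg _) (hf s))

end Supports

/-! ## Antisymmetrization of tuples -/

section Alternate

open Equiv

variable {V W : Type*}

/-- The antisymmetrization of a chain of tuples. -/
def alternate (W : Type*) (n : ℕ) : TupleChain W n →ₗ[ℝ] TupleChain W n :=
  Finsupp.linearCombination ℝ fun w : Fin (n + 1) → W =>
    ((n + 1).factorial : ℝ)⁻¹ • ∑ π : Perm (Fin (n + 1)),
      Finsupp.single (w ∘ π) ((Perm.sign π : ℤ) : ℝ)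

lemma alternate_single (n : ℕ) (w : Fin (n + 1) → W) :
    alternate W n (Finsupp.single w 1) = ((n + 1).factorial : ℝ)⁻¹ •
      ∑ π : Perm (Fin (n + 1)), Finsupp.single (w ∘ π) ((Perm.sign π : ℤ) : ℝ) := by
  simp [alternate]

lemma alternate_tupleMap (f : V → W) (n : ℕ) (x : TupleChain V n) :
    alternate W n (tupleMap f n x) = tupleMap f n (alternate V n x) := by
  suffices h : alternate W n ∘ₗ tupleMap f n = tupleMap f n ∘ₗ alternate V n from
    LinearMap.congr_fun h x
  refine Finsupp.lhom_ext' fun w => LinearMap.ext_ring ?_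
  simp [alternate_single, Function.comp_assoc]

/-- Precomposing with the transposition of the two equal entries fixes the tuple and reverses all
signs, so the signed sum equals its own negative. -/
lemma alternate_single_eq_zero {n : ℕ} {w : Fin (n + 1) → W} {p q : Fin (n + 1)} (hpq : p ≠ q)
    (h : w p = w q) : alternate W n (Finsupp.single w 1) = 0 := by
  rw [alternate_single]
  have hw : w ∘ swap p q = w := by
    funext i
    simp only [Function.comp_apply, swap_apply_def]
    split_ifs with h1 h2
    · rw [h1, h]
    · rw [h2, h]
    · rfl
  have key : ∑ π : Perm (Fin (n + 1)), Finsupp.single (w ∘ π) ((Perm.sign π : ℤ) : ℝ) =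
      - ∑ π : Perm (Fin (n + 1)), Finsupp.single (w ∘ π) ((Perm.sign π : ℤ) : ℝ) := by
    conv_lhs => rw [← Equiv.sum_comp (Equiv.mulLeft (swap p q))]
    rw [← Finset.sum_neg_distrib]
    refine Finset.sum_congr rfl fun π _ => ?_
    have : w ∘ ⇑(swap p q * π) = w ∘ π := by
      rw [Perm.coe_mul, ← Function.comp_assoc, hw]
    rw [Equiv.coe_mulLeft, this, Perm.sign_mul, Perm.sign_swap hpq, ← Finsupp.single_neg]
    simp
  rw [self_eq_neg] at key
  rw [key, smul_zero]

lemma lOneNorm_alternate_single_le (n : ℕ) (w : Fin (n + 1) → W) :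
    lOneNorm (alternate W n (Finsupp.single w 1)) ≤ 1 := by
  rw [alternate_single, lOneNorm_smul]
  have h : lOneNorm (∑ π : Perm (Fin (n + 1)), Finsupp.single (w ∘ π) ((Perm.sign π : ℤ) : ℝ)) ≤
      (n + 1).factorial := by
    refine (lOneNorm_sum_le _ _).trans (le_of_eq ?_)
    have : ∀ π : Perm (Fin (n + 1)), |((Perm.sign π : ℤ) : ℝ)| = 1 := by
      intro π
      rcases Int.units_eq_one_or (Perm.sign π) with h | h <;> simp [h]
    simp [lOneNorm_single, this, Fintype.card_perm]
  have h0 : (0 : ℝ) < (n + 1).factorial := by exact_mod_cast Nat.factorial_pos _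
  rw [abs_of_pos (inv_pos.2 h0), inv_mul_le_iff₀ h0, mul_one]
  exact h

/-- The value at 0 recovers the first component, and cancelling the cycle recovers the second. This
matches pairs of a face and a permutation of its vertices with permutations of all vertices. -/
lemma bijective_cycleRange_symm_mul_decomposeFin (n : ℕ) : Function.Bijective
    fun x : Fin (n + 2) × Perm (Fin (n + 1)) =>
      (x.1.cycleRange.symm * Perm.decomposeFin.symm (0, x.2) : Perm (Fin (n + 2))) := by
  rw [Fintype.bijective_iff_injective_and_card]
  constructor
  · rintro ⟨k, ρ⟩ ⟨l, τ⟩ h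
    simp only at h
    have h0 := DFunLike.congr_fun h 0
    simp only [Perm.coe_mul, Function.comp_apply, Perm.decomposeFin_symm_apply_zero,
      Fin.cycleRange_symm_zero] at h0
    subst h0
    have h1 := Perm.decomposeFin.symm.injective (mul_left_cancel h)
    rw [Prod.mk.injEq] at h1
    rw [h1.2]
  · simp [Fintype.card_perm, Nat.factorial_succ]

/-- Both sides are multiples of one signed sum `R`: each of the `n + 2` face positions of the
permuted tuples contributes `R`, and `(n + 2) / (n + 2)! = 1 / (n + 1)!`. -/
lemma tupleBoundary_alternate (n : ℕ) (x : TupleChain W (n + 1)) :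
    tupleBoundary W n (alternate W (n + 1) x) = alternate W n (tupleBoundary W n x) := by
  suffices h : tupleBoundary W n ∘ₗ alternate W (n + 1) = alternate W n ∘ₗ tupleBoundary W n from
    LinearMap.congr_fun h x
  refine Finsupp.lhom_ext' fun w => LinearMap.ext_ring ?_
  have hsucc : ∀ i : Fin (n + 2), i.succAbove = i.cycleRange.symm ∘ Fin.succ := by
    intro i
    funext k
    simp
  set R : TupleChain W n := ∑ π : Perm (Fin (n + 2)),
    Finsupp.single (w ∘ π ∘ Fin.succ) ((Perm.sign π : ℤ) : ℝ) with hR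
  have h1 : ∑ π : Perm (Fin (n + 2)), tupleBoundary W n
      (Finsupp.single (w ∘ π) ((Perm.sign π : ℤ) : ℝ)) = ((n + 2 : ℕ) : ℝ) • R := by
    simp only [tupleBoundary_single, Finset.smul_sum]
    rw [Finset.sum_comm]
    have : ∀ i : Fin (n + 2), ∑ π : Perm (Fin (n + 2)), ((Perm.sign π : ℤ) : ℝ) •
        Finsupp.single ((w ∘ π) ∘ i.succAbove) ((-1 : ℝ) ^ (i : ℕ)) = R := by
      intro i
      -- The cycle moving position `i` to the front has sign `(-1) ^ i`, which cancels the sign of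
      -- the face.
      rw [hR, ← Equiv.sum_comp (Equiv.mulRight i.cycleRange)]
      refine Finset.sum_congr rfl fun π _ => ?_
      have hw : (w ∘ ⇑(π * i.cycleRange)) ∘ i.succAbove = w ∘ π ∘ Fin.succ := by
        funext k
        rw [hsucc]
        simp
      rw [Equiv.coe_mulRight, hw, Perm.sign_mul, Fin.sign_cycleRange, Finsupp.smul_single]
      congr 1
      push_cast
      rw [smul_eq_mul, mul_assoc, ← mul_pow]
      simp
    rw [Finset.sum_congr rfl fun i _ => this i, Finset.sum_const, Finset.card_univ,
      Fintype.card_fin, Nat.cast_smul_eq_nsmul]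
  have h2 : ∑ i : Fin (n + 2), ((-1 : ℝ) ^ (i : ℕ)) • ∑ ρ : Perm (Fin (n + 1)),
      Finsupp.single ((w ∘ i.succAbove) ∘ ρ) ((Perm.sign ρ : ℤ) : ℝ) = R := by
    rw [hR, ← (bijective_cycleRange_symm_mul_decomposeFin n).sum_comp, Fintype.sum_prod_type]
    refine Finset.sum_congr rfl fun i _ => ?_
    rw [Finset.smul_sum]
    refine Finset.sum_congr rfl fun ρ _ => ?_
    have hw : (w ∘ i.succAbove) ∘ ρ =
        w ∘ ⇑(i.cycleRange.symm * Perm.decomposeFin.symm (0, ρ)) ∘ Fin.succ := by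
      funext k
      rw [hsucc]
      simp [Perm.decomposeFin_symm_apply_succ]
    rw [hw, Finsupp.smul_single]
    congr 1
    rw [Perm.sign_mul, Perm.sign_symm, Fin.sign_cycleRange, Perm.decomposeFin.symm_sign]
    simp
  have h3 : alternate W n (tupleBoundary W n (Finsupp.single w 1)) =
      ((n + 1).factorial : ℝ)⁻¹ • R := by
    rw [tupleBoundary_single, one_smul, map_sum, ← h2, Finset.smul_sum]
    refine Finset.sum_congr rfl fun i _ => ?_
    rw [smul_comm, ← alternate_single, ← map_smul, Finsupp.smul_single, smul_eq_mul, mul_one]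
  simp only [LinearMap.comp_apply, Finsupp.lsingle_apply]
  rw [h3, alternate_single, map_smul, map_sum, h1, smul_smul]
  congr 1
  rw [Nat.factorial_succ (n + 1)]
  push_cast
  field_simp
  ring

lemma alternate_zero_apply (x : TupleChain W 0) : alternate W 0 x = x := by
  suffices h : alternate W 0 = LinearMap.id from LinearMap.congr_fun h x
  refine Finsupp.lhom_ext' fun w => LinearMap.ext_ring ?_
  simp only [LinearMap.comp_apply, Finsupp.lsingle_apply, alternate_single]
  simp

end Alternate

/-! ## Barycentric subdivision -/

section Subdivision

variable {V W : Type*}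

/-- The barycentric subdivision of chains of tuples, with respect to a choice of a barycenter of
each tuple. -/
def subdivide (bar : ∀ k, (Fin (k + 1) → V) → V) : ∀ n, TupleChain V n →ₗ[ℝ] TupleChain V n
  | 0 => LinearMap.id
  | n + 1 => Finsupp.linearCombination ℝ fun w : Fin (n + 2) → V =>
      tupleCone (bar _ w) n (subdivide bar n (tupleBoundary V n (Finsupp.single w 1)))

lemma subdivide_succ_single (bar : ∀ k, (Fin (k + 1) → V) → V) (n : ℕ) (w : Fin (n + 2) → V) :
    subdivide bar (n + 1) (Finsupp.single w 1) =
      tupleCone (bar _ w) n (subdivide bar n (tupleBoundary V n (Finsupp.single w 1))) := by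
  simp [subdivide]

lemma tupleBoundary_subdivide (bar : ∀ k, (Fin (k + 1) → V) → V) (n : ℕ)
    (x : TupleChain V (n + 1)) :
    tupleBoundary V n (subdivide bar (n + 1) x) = subdivide bar n (tupleBoundary V n x) := by
  suffices h : ∀ n, tupleBoundary V n ∘ₗ subdivide bar (n + 1) =
      subdivide bar n ∘ₗ tupleBoundary V n from LinearMap.congr_fun (h n) x
  intro n
  induction n with
  | zero =>
    refine Finsupp.lhom_ext' fun w => LinearMap.ext_ring ?_
    simp only [LinearMap.comp_apply, Finsupp.lsingle_apply, subdivide_succ_single,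
      tupleBoundary_tupleCone_zero]
    simp [subdivide, augmentation_tupleBoundary]
  | succ n ih =>
    refine Finsupp.lhom_ext' fun w => LinearMap.ext_ring ?_
    have := LinearMap.congr_fun ih (tupleBoundary V (n + 1) (Finsupp.single w 1))
    simp only [LinearMap.comp_apply, tupleBoundary_tupleBoundary, map_zero] at this
    simp only [LinearMap.comp_apply, Finsupp.lsingle_apply, subdivide_succ_single,
      tupleBoundary_tupleCone_succ, this, map_zero, sub_zero]

/-- Applied to face inclusions, which preserve barycenters, this makes subdivision compatible with
faces. -/
lemma subdivide_tupleMap {bar : ∀ k, (Fin (k + 1) → V) → V} {bar' : ∀ k, (Fin (k + 1) → W) → W}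
    {f : V → W} (hf : ∀ k w, f (bar k w) = bar' k (f ∘ w)) (n : ℕ) (x : TupleChain V n) :
    subdivide bar' n (tupleMap f n x) = tupleMap f n (subdivide bar n x) := by
  suffices h : ∀ n, subdivide bar' n ∘ₗ tupleMap f n = tupleMap f n ∘ₗ subdivide bar n from
    LinearMap.congr_fun (h n) x
  intro n
  induction n with
  | zero => rfl
  | succ n ih =>
    refine Finsupp.lhom_ext' fun w => LinearMap.ext_ring ?_
    have := LinearMap.congr_fun ih (tupleBoundary V n (Finsupp.single w 1))
    simp only [LinearMap.comp_apply] at this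
    simp only [LinearMap.comp_apply, Finsupp.lsingle_apply, tupleMap_single,
      subdivide_succ_single, tupleMap_tupleCone, ← this, ← tupleBoundary_tupleMap, hf]

/-- The barycenter of a tuple of points of a simplex. -/
def tupleBarycenter {ι : Type*} [Fintype ι] (k : ℕ) (w : Fin (k + 1) → stdSimplex ℝ ι) :
    stdSimplex ℝ ι :=
  ⟨((k : ℝ) + 1)⁻¹ • ∑ i, (w i).1, by
    have hk : (0 : ℝ) < (k : ℝ) + 1 := by positivity
    constructor
    · intro x
      simp only [Pi.smul_apply, Finset.sum_apply, smul_eq_mul]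
      exact mul_nonneg (inv_pos.2 hk).le (Finset.sum_nonneg fun i _ => (w i).2.1 x)
    · simp only [Pi.smul_apply, Finset.sum_apply, smul_eq_mul]
      rw [← Finset.mul_sum, Finset.sum_comm]
      have : ∀ i, ∑ x, (w i).1 x = 1 := fun i => (w i).2.2
      simp only [this]
      simp
      field_simp⟩

lemma map_tupleBarycenter {ι κ : Type*} [Fintype ι] [Fintype κ] (f : ι → κ) (k : ℕ)
    (w : Fin (k + 1) → stdSimplex ℝ ι) :
    stdSimplex.map f (tupleBarycenter k w) = tupleBarycenter k (stdSimplex.map f ∘ w) := by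
  apply Subtype.ext
  change FunOnFinite.linearMap ℝ ℝ f (((k : ℝ) + 1)⁻¹ • ∑ i, (w i).1) =
    ((k : ℝ) + 1)⁻¹ • ∑ i, FunOnFinite.linearMap ℝ ℝ f (w i).1
  rw [map_smul, map_sum]

lemma dist_tupleBarycenter_le {ι : Type*} [Fintype ι] (k : ℕ) (w : Fin (k + 1) → stdSimplex ℝ ι)
    (y : stdSimplex ℝ ι) (a : Fin (k + 1) → ℝ) (h : ∀ i, dist (w i) y ≤ a i) :
    dist (tupleBarycenter k w) y ≤ ((k : ℝ) + 1)⁻¹ * ∑ i, a i := by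
  have hk : (0 : ℝ) < (k : ℝ) + 1 := by positivity
  have h1 : (tupleBarycenter k w).1 - y.1 = ((k : ℝ) + 1)⁻¹ • ∑ i, ((w i).1 - y.1) := by
    rw [Finset.sum_sub_distrib, smul_sub]
    simp only [Finset.sum_const, Finset.card_univ, Fintype.card_fin, ← Nat.cast_smul_eq_nsmul ℝ,
      smul_smul]
    push_cast
    rw [inv_mul_cancel₀ hk.ne', one_smul]
    rfl
  rw [Subtype.dist_eq, dist_eq_norm, h1, norm_smul, norm_inv, Real.norm_of_nonneg hk.le]
  gcongr
  refine (norm_sum_le _ _).trans (Finset.sum_le_sum fun i _ => ?_)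
  rw [← dist_eq_norm, ← Subtype.dist_eq]
  exact h i

/-- One of the `k + 1` distances being averaged is zero, whence the factor `k / (k + 1)`. -/
lemma dist_tupleBarycenter_self_le {ι : Type*} [Fintype ι] (k : ℕ)
    (w : Fin (k + 1) → stdSimplex ℝ ι) (δ : ℝ) (h : ∀ i j, dist (w i) (w j) ≤ δ)
    (j : Fin (k + 1)) :
    dist (w j) (tupleBarycenter k w) ≤ (k : ℝ) / (k + 1) * δ := by
  rw [dist_comm]
  refine (dist_tupleBarycenter_le k w (w j) (fun i => if i = j then 0 else δ) fun i => ?_).trans ?_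
  · split_ifs with hij
    · simp [hij]
    · exact h i j
  · have : ∑ i, (if i = j then (0 : ℝ) else δ) = k * δ := by
      rw [← Finset.sum_erase_add _ _ (Finset.mem_univ j), if_pos rfl, add_zero,
        Finset.sum_congr rfl fun i hi => if_neg (Finset.ne_of_mem_erase hi)]
      simp [Finset.card_erase_of_mem]
    rw [this]
    apply le_of_eq
    ring

/-- The two properties support one induction: the ball property, taken around the barycenter, bounds
the distances from the new apex to the vertices of the subdivided faces, which the diameter bound
alone does not control. -/
lemma subdivide_single_mem_supported {ι : Type*} [Fintype ι] (n : ℕ)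
    (w : Fin (n + 1) → stdSimplex ℝ ι) :
    subdivide tupleBarycenter n (Finsupp.single w 1) ∈ Finsupp.supported ℝ ℝ
      {u : Fin (n + 1) → stdSimplex ℝ ι |
        (∀ y r, (∀ i, dist (w i) y ≤ r) → ∀ k, dist (u k) y ≤ r) ∧
        ∀ δ, 0 ≤ δ → (∀ i j, dist (w i) (w j) ≤ δ) →
          ∀ k l, dist (u k) (u l) ≤ (n : ℝ) / (n + 1) * δ} := by
  induction n with
  | zero =>
    refine Finsupp.single_mem_supported ℝ 1 (And.intro (fun y r h k => h k) fun δ hδ h k l => ?_)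
    rw [Subsingleton.elim (α := Fin 1) k l]
    simp
  | succ n ih =>
    rw [subdivide_succ_single, tupleBoundary_single, one_smul, map_sum, map_sum]
    refine Submodule.sum_mem _ fun i _ => ?_
    have h1 : Finsupp.single (w ∘ i.succAbove) ((-1 : ℝ) ^ (i : ℕ)) =
        ((-1 : ℝ) ^ (i : ℕ)) • Finsupp.single (w ∘ i.succAbove) 1 := by simp
    rw [h1, map_smul, map_smul]
    refine Submodule.smul_mem _ _ ?_
    refine map_mem_of_mem_supported (ih (w ∘ i.succAbove)) _ _ fun u hu => ?_
    obtain ⟨hu1, hu2⟩ := hu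
    rw [tupleCone_single]
    refine Finsupp.single_mem_supported ℝ 1 (And.intro (fun y r h => ?_) fun δ hδ h => ?_)
    · refine Fin.cases ?_ fun k => ?_
      · rw [Fin.cons_zero]
        refine (dist_tupleBarycenter_le (n + 1) w y (fun _ => r) h).trans (le_of_eq ?_)
        simp
        field_simp
      · rw [Fin.cons_succ]
        exact hu1 y r (fun i => h _) k
    · have hb : ∀ k, dist (u k) (tupleBarycenter (n + 1) w) ≤
          ((n + 1 : ℕ) : ℝ) / ((n + 1 : ℕ) + 1) * δ := fun k =>
        hu1 _ _ (fun i => dist_tupleBarycenter_self_le _ w δ h _) k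
      -- Faces contract by a smaller ratio, since `n / (n + 1)` increases with `n`.
      have hle : (n : ℝ) / (n + 1) * δ ≤ ((n + 1 : ℕ) : ℝ) / ((n + 1 : ℕ) + 1) * δ := by
        refine mul_le_mul_of_nonneg_right ?_ hδ
        rw [div_le_div_iff₀ (by positivity) (by positivity)]
        push_cast
        nlinarith
      refine Fin.cases (Fin.cases ?_ fun l => ?_) fun k => Fin.cases ?_ fun l => ?_
      · simp only [Fin.cons_zero, dist_self]
        positivity
      · simp only [Fin.cons_zero, Fin.cons_succ]
        rw [dist_comm]
        exact hb l
      · simpa only [Fin.cons_zero, Fin.cons_succ] using hb k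
      · simp only [Fin.cons_succ]
        exact (hu2 δ hδ (fun i j => h _ _) k l).trans hle

/-- The chain of the vertices of the standard simplex, subdivided `N` times. -/
def simplexChain (N n : ℕ) : TupleChain (stdSimplex ℝ (Fin (n + 1))) n :=
  (subdivide tupleBarycenter n)^[N] (Finsupp.single (fun i => stdSimplex.vertex i) 1)

lemma simplexChain_succ (N n : ℕ) :
    simplexChain (N + 1) n = subdivide tupleBarycenter n (simplexChain N n) := by
  simp only [simplexChain, Function.iterate_succ_apply']

lemma simplexChain_zero_right (N : ℕ) :
    simplexChain N 0 = Finsupp.single (fun i => stdSimplex.vertex i) 1 := by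
  induction N with
  | zero => rfl
  | succ N ih => rw [simplexChain_succ, ih]; rfl

/-- This identity is what makes `evalChain` a chain map for every number of subdivisions. -/
lemma tupleBoundary_simplexChain (N n : ℕ) :
    tupleBoundary _ n (simplexChain N (n + 1)) =
      ∑ i : Fin (n + 2), ((-1 : ℝ) ^ (i : ℕ)) •
        tupleMap (stdSimplex.map i.succAbove) n (simplexChain N n) := by
  induction N with
  | zero =>
    rw [simplexChain, simplexChain, Function.iterate_zero_apply, Function.iterate_zero_apply,
      tupleBoundary_single, one_smul]
    refine Finset.sum_congr rfl fun i _ => ?_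
    rw [tupleMap_single, Finsupp.smul_single, smul_eq_mul, mul_one]
    congr 1
    funext k
    exact (stdSimplex.map_vertex _ _).symm
  | succ N ih =>
    rw [simplexChain_succ, tupleBoundary_subdivide, ih, map_sum]
    refine Finset.sum_congr rfl fun i _ => ?_
    rw [map_smul, simplexChain_succ, subdivide_tupleMap fun k w => map_tupleBarycenter _ k w]

/-- The standard simplex has diameter at most 1, and each subdivision contracts distances by `n / (n
+ 1)`. -/
lemma simplexChain_mem_supported (N n : ℕ) : simplexChain N n ∈ Finsupp.supported ℝ ℝ
    {u | ∀ k l, dist (u k) (u l) ≤ ((n : ℝ) / (n + 1)) ^ N} := by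
  induction N with
  | zero =>
    refine Finsupp.single_mem_supported ℝ 1 fun k l => ?_
    rw [pow_zero]
    exact (Metric.dist_le_diam_of_mem (bounded_stdSimplex (Fin (n + 1))) (Subtype.coe_prop _)
      (Subtype.coe_prop _)).trans diam_stdSimplex_le
  | succ N ih =>
    rw [simplexChain_succ]
    refine map_mem_of_mem_supported ih _ _ fun w hw => ?_
    refine Finsupp.supported_mono ?_ (subdivide_single_mem_supported n w)
    intro u hu k l
    rw [pow_succ']
    exact hu.2 _ (by positivity) hw k l

end Subdivision

/-! ## Chains of tuples obtained by evaluating a function on singular simplices -/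

section Evaluation

variable {Y : Type u} [TopologicalSpace Y] {W : Type*}

/-- The chain map that evaluates a function on the vertices of the `N`-th subdivision of singular
simplices. -/
def evalChain (f : Y → W) (N n : ℕ) : Chain Y n →ₗ[ℝ] TupleChain W n :=
  Finsupp.linearCombination ℝ fun σ : SingularSimplex Y n => tupleMap (f ∘ σ) n (simplexChain N n)

lemma evalChain_single (f : Y → W) (N n : ℕ) (σ : SingularSimplex Y n) :
    evalChain f N n (Finsupp.single σ 1) = tupleMap (f ∘ σ) n (simplexChain N n) := by
  simp [evalChain]

lemma evalChain_zero_single (f : Y → W) (n : ℕ) (σ : SingularSimplex Y n) :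
    evalChain f 0 n (Finsupp.single σ 1) =
      Finsupp.single (fun i => f (σ (stdSimplex.vertex i))) 1 := by
  rw [evalChain_single, simplexChain, Function.iterate_zero_apply, tupleMap_single]
  rfl

lemma augmentation_evalChain_single (f : Y → W) (N : ℕ) (σ : SingularSimplex Y 0) :
    augmentation _ (evalChain f N 0 (Finsupp.single σ 1)) = 1 := by
  rw [evalChain_single, simplexChain_zero_right, tupleMap_single, augmentation_single]

lemma tupleBoundary_evalChain (f : Y → W) (N n : ℕ) (x : Chain Y (n + 1)) :
    tupleBoundary W n (evalChain f N (n + 1) x) = evalChain f N n (boundary Y n x) := by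
  suffices h : tupleBoundary W n ∘ₗ evalChain f N (n + 1) = evalChain f N n ∘ₗ boundary Y n from
    LinearMap.congr_fun h x
  refine Finsupp.lhom_ext' fun σ => LinearMap.ext_ring ?_
  simp only [LinearMap.comp_apply, Finsupp.lsingle_apply, evalChain_single, boundary_single,
    tupleBoundary_tupleMap, tupleBoundary_simplexChain, one_smul, map_sum]
  refine Finset.sum_congr rfl fun i _ => ?_
  rw [← mul_one ((-1 : ℝ) ^ (i : ℕ)), ← smul_eq_mul, ← Finsupp.smul_single, map_smul, map_smul,
    evalChain_single, ← tupleMap_comp, smul_eq_mul, mul_one]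
  rfl

lemma evalChain_chainMap {f : Y → W} {g : C(Y, Y)} {φ : W → W} (h : ∀ y, f (g y) = φ (f y))
    (N n : ℕ) (x : Chain Y n) :
    evalChain f N n (chainMap g n x) = tupleMap φ n (evalChain f N n x) := by
  suffices h : evalChain f N n ∘ₗ chainMap g n = tupleMap φ n ∘ₗ evalChain f N n from
    LinearMap.congr_fun h x
  refine Finsupp.lhom_ext' fun σ => LinearMap.ext_ring ?_
  simp only [LinearMap.comp_apply, Finsupp.lsingle_apply, evalChain_single, chainMap_single,
    ← tupleMap_comp]
  have : f ∘ ⇑(g.comp σ) = φ ∘ f ∘ ⇑σ := funext fun x => h (σ x)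
  rw [this]

end Evaluation

/-! ## Points of simplices -/

section SimplexPoints

lemma stdSimplex_map_apply {ι κ : Type*} [Fintype ι] [Fintype κ] {f : ι → κ}
    (hf : Function.Injective f) (s : stdSimplex ℝ ι) (i : ι) : stdSimplex.map f s (f i) = s i := by
  classical
  rw [stdSimplex.map_coe, FunOnFinite.linearMap_apply_apply]
  rw [Finset.sum_eq_single i]
  · intro b hb hbi
    exact absurd (hf (Finset.mem_filter.1 hb).2) hbi
  · simp

lemma stdSimplex_map_apply_of_notMem {ι κ : Type*} [Fintype ι] [Fintype κ] {f : ι → κ}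
    (s : stdSimplex ℝ ι) {k : κ} (hk : k ∉ range f) : stdSimplex.map f s k = 0 := by
  classical
  rw [stdSimplex.map_coe, FunOnFinite.linearMap_apply_apply]
  refine Finset.sum_eq_zero fun i hi => ?_
  exact absurd ⟨i, (Finset.mem_filter.1 hi).2⟩ hk

/-- The point that divides the segment between the zeroth vertex and a point of the opposite
face. -/
def simplexJoin (n : ℕ) (x : unitInterval × stdSimplex ℝ (Fin (n + 1))) :
    stdSimplex ℝ (Fin (n + 2)) :=
  ⟨Fin.cons (x.1 : ℝ) fun i => (1 - (x.1 : ℝ)) * x.2 i, by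
    constructor
    · refine Fin.cases ?_ fun i => ?_
      · simpa using x.1.2.1
      · rw [Fin.cons_succ]
        exact mul_nonneg (sub_nonneg.2 x.1.2.2) (x.2.2.1 i)
    · rw [Fin.sum_univ_succ]
      simp only [Fin.cons_zero, Fin.cons_succ, ← Finset.mul_sum, stdSimplex.sum_eq_one]
      ring⟩

@[simp] lemma simplexJoin_apply_zero (n : ℕ) (x : unitInterval × stdSimplex ℝ (Fin (n + 1))) :
    simplexJoin n x 0 = x.1 := rfl

@[simp] lemma simplexJoin_apply_succ (n : ℕ) (x : unitInterval × stdSimplex ℝ (Fin (n + 1)))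
    (i : Fin (n + 1)) : simplexJoin n x i.succ = (1 - (x.1 : ℝ)) * x.2 i := rfl

lemma stdSimplex_ext {ι : Type*} [Fintype ι] {s t : stdSimplex ℝ ι} (h : ∀ i, s i = t i) : s = t :=
  Subtype.ext (funext h)

lemma continuous_stdSimplex_apply {ι : Type*} [Fintype ι] (i : ι) :
    Continuous fun s : stdSimplex ℝ ι => s i :=
  (continuous_apply i).comp continuous_subtype_val

lemma continuous_simplexJoin (n : ℕ) : Continuous (simplexJoin n) := by
  refine Continuous.subtype_mk (continuous_pi ?_) _
  refine Fin.cases ?_ fun i => ?_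
  · simp only [Fin.cons_zero]
    fun_prop
  · simp only [Fin.cons_succ]
    exact (by fun_prop : Continuous fun x : unitInterval × stdSimplex ℝ (Fin (n + 1)) =>
      1 - (x.1 : ℝ)).mul ((continuous_stdSimplex_apply i).comp continuous_snd)

lemma surjective_simplexJoin (n : ℕ) : Function.Surjective (simplexJoin n) := by
  intro x
  have h0 : x 0 + ∑ i : Fin (n + 1), x i.succ = 1 := by
    rw [← Fin.sum_univ_succ (fun i => x i)]
    exact x.2.2
  have ht : x 0 ∈ unitInterval := ⟨x.2.1 0, stdSimplex.le_one x 0⟩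
  by_cases hx : x 0 = 1
  -- At the apex the point of the opposite face is irrelevant; any one would do.
  · refine ⟨(1, stdSimplex.vertex 0), stdSimplex_ext (Fin.cases ?_ fun i => ?_)⟩
    · simp [hx]
    · rw [hx, add_eq_left] at h0
      have := (Finset.sum_eq_zero_iff_of_nonneg fun i _ => x.2.1 (Fin.succ i)).1
        h0 i (Finset.mem_univ i)
      rw [simplexJoin_apply_succ]
      change (1 - (1 : ℝ)) * _ = x.1 i.succ
      rw [this, sub_self, zero_mul]
  · have h1 : 0 < 1 - x 0 := sub_pos.2 (lt_of_le_of_ne ht.2 hx)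
    refine ⟨(⟨x 0, ht⟩, ⟨fun i => (1 - x 0)⁻¹ * x i.succ, fun i =>
      mul_nonneg (inv_pos.2 h1).le (x.2.1 _), ?_⟩), stdSimplex_ext (Fin.cases rfl fun i => ?_)⟩
    · rw [← Finset.mul_sum]
      have : ∑ i : Fin (n + 1), x i.succ = 1 - x 0 := by linarith
      rw [this, inv_mul_cancel₀ h1.ne']
    · rw [simplexJoin_apply_succ]
      change (1 - x 0) * ((1 - x 0)⁻¹ * x i.succ) = x i.succ
      rw [mul_inv_cancel_left₀ h1.ne']

/-- A continuous surjection from a compact space to a Hausdorff space is a quotient map; hence cones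
can be defined on the product with the interval. -/
lemma isQuotientMap_simplexJoin (n : ℕ) :
    IsQuotientMap (⟨simplexJoin n, continuous_simplexJoin n⟩ :
      C(unitInterval × stdSimplex ℝ (Fin (n + 1)), stdSimplex ℝ (Fin (n + 2)))) :=
  IsQuotientMap.of_surjective_continuous (surjective_simplexJoin n) (continuous_simplexJoin n)

lemma map_succAbove_zero_eq_simplexJoin (n : ℕ) (s : stdSimplex ℝ (Fin (n + 1))) :
    stdSimplex.map (0 : Fin (n + 2)).succAbove s = simplexJoin n (0, s) := by
  refine stdSimplex_ext (Fin.cases ?_ fun i => ?_)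
  · rw [stdSimplex_map_apply_of_notMem s (by simp)]
    simp
  · rw [simplexJoin_apply_succ, ← Fin.zero_succAbove,
      stdSimplex_map_apply Fin.succAbove_right_injective]
    simp

lemma map_succAbove_succ_simplexJoin (n : ℕ) (k : Fin (n + 2))
    (x : unitInterval × stdSimplex ℝ (Fin (n + 1))) :
    stdSimplex.map k.succ.succAbove (simplexJoin n x) =
      simplexJoin (n + 1) (x.1, stdSimplex.map k.succAbove x.2) := by
  refine stdSimplex_ext (Fin.cases ?_ fun i => ?_)
  · have := stdSimplex_map_apply (Fin.succAbove_right_injective (p := k.succ)) (simplexJoin n x) 0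
    rw [Fin.succ_succAbove_zero] at this
    rw [this]
    simp
  · rw [simplexJoin_apply_succ]
    by_cases hi : i = k
    · subst hi
      rw [stdSimplex_map_apply_of_notMem _ (by simp), stdSimplex_map_apply_of_notMem _ (by simp)]
      simp
    · obtain ⟨l, rfl⟩ := Fin.exists_succAbove_eq hi
      rw [← Fin.succ_succAbove_succ, stdSimplex_map_apply Fin.succAbove_right_injective,
        stdSimplex_map_apply Fin.succAbove_right_injective, simplexJoin_apply_succ]

lemma map_succAbove_one_eq_simplexJoin (s t : stdSimplex ℝ (Fin 1)) :
    stdSimplex.map (1 : Fin 2).succAbove s = simplexJoin 0 (1, t) := by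
  refine stdSimplex_ext (Fin.cases ?_ fun i => ?_)
  · have := stdSimplex_map_apply (Fin.succAbove_right_injective (p := (1 : Fin 2))) s 0
    rw [simplexJoin_apply_zero]
    exact this.trans (by simp)
  · have hi : i = 0 := Subsingleton.elim (α := Fin 1) _ _
    subst hi
    rw [simplexJoin_apply_succ, stdSimplex_map_apply_of_notMem s (by simp)]
    simp

end SimplexPoints

/-! ## Cones in contractible spaces -/

section Cones

variable {E : Type v} [TopologicalSpace E]

/-- A contraction of a space to a point. -/
structure Contraction (E : Type v) [TopologicalSpace E] where
  toMap : C(unitInterval × E, E)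
  center : E
  map_zero : ∀ x, toMap (0, x) = x
  map_one : ∀ x, toMap (1, x) = center

lemma nonempty_contraction [ContractibleSpace E] : Nonempty (Contraction E) := by
  obtain ⟨e, ⟨F⟩⟩ := id_nullhomotopic E
  exact ⟨⟨F.toContinuousMap, e, fun x => F.map_zero_left x, fun x => F.map_one_left x⟩⟩

variable (H : Contraction E)

/-- The join identifies points only at time 1, where the contraction is constant. -/
lemma Contraction.factorsThrough_simplexJoin {n : ℕ} (τ : SingularSimplex E n) :
    Function.FactorsThrough (H.toMap.comp ((ContinuousMap.id unitInterval).prodMap τ))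
      (⟨simplexJoin n, continuous_simplexJoin n⟩ :
        C(unitInterval × stdSimplex ℝ (Fin (n + 1)), stdSimplex ℝ (Fin (n + 2)))) := by
  rintro ⟨t, s⟩ ⟨t', s'⟩ h
  have h0 : t = t' := Subtype.ext (congrArg (fun x : stdSimplex ℝ (Fin (n + 2)) => x 0) h)
  subst h0
  by_cases ht : t = 1
  · subst ht
    exact (H.map_one _).trans (H.map_one _).symm
  · have hs : s = s' := by
      refine stdSimplex_ext fun i => ?_
      have := congrArg (fun x : stdSimplex ℝ (Fin (n + 2)) => x i.succ) h
      have ht' : (1 - (t : ℝ)) ≠ 0 := fun h =>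
        ht (Subtype.ext (by simpa using (sub_eq_zero.1 h).symm))
      exact mul_left_cancel₀ ht' this
    rw [hs]

/-- The cone over a singular simplex with respect to a contraction of the space; its zeroth vertex
is the center of the contraction. -/
def Contraction.cone {n : ℕ} (τ : SingularSimplex E n) : SingularSimplex E (n + 1) :=
  (isQuotientMap_simplexJoin n).lift _ (H.factorsThrough_simplexJoin τ)

lemma Contraction.cone_simplexJoin {n : ℕ} (τ : SingularSimplex E n)
    (x : unitInterval × stdSimplex ℝ (Fin (n + 1))) :
    H.cone τ (simplexJoin n x) = H.toMap (x.1, τ x.2) :=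
  DFunLike.congr_fun ((isQuotientMap_simplexJoin n).lift_comp
    _ (H.factorsThrough_simplexJoin τ)) x

lemma Contraction.face_zero_cone {n : ℕ} (τ : SingularSimplex E n) : (H.cone τ).face 0 = τ := by
  ext s
  change H.cone τ (stdSimplex.map _ s) = _
  rw [map_succAbove_zero_eq_simplexJoin, H.cone_simplexJoin, H.map_zero]

lemma Contraction.face_succ_cone {n : ℕ} (τ : SingularSimplex E (n + 1)) (k : Fin (n + 2)) :
    (H.cone τ).face k.succ = H.cone (τ.face k) := by
  ext s
  obtain ⟨x, rfl⟩ := surjective_simplexJoin n s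
  change H.cone τ (stdSimplex.map _ _) = _
  rw [map_succAbove_succ_simplexJoin, H.cone_simplexJoin, H.cone_simplexJoin]
  rfl

lemma Contraction.face_one_cone (τ : SingularSimplex E 0) :
    (H.cone τ).face 1 = ContinuousMap.const _ H.center := by
  ext s
  change H.cone τ (stdSimplex.map _ s) = _
  rw [map_succAbove_one_eq_simplexJoin s s, H.cone_simplexJoin, H.map_one]
  rfl

/-- The cone operator on singular chains. -/
def Contraction.coneChain (n : ℕ) : Chain E n →ₗ[ℝ] Chain E (n + 1) :=
  Finsupp.lmapDomain ℝ ℝ H.cone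

@[simp] lemma Contraction.coneChain_single (n : ℕ) (τ : SingularSimplex E n) (r : ℝ) :
    H.coneChain n (Finsupp.single τ r) = Finsupp.single (H.cone τ) r := by
  simp [Contraction.coneChain]

lemma Contraction.boundary_coneChain_zero (x : Chain E 0) :
    boundary E 0 (H.coneChain 0 x) =
      x - augmentation _ x • Finsupp.single (ContinuousMap.const _ H.center) 1 := by
  suffices h : boundary E 0 ∘ₗ H.coneChain 0 = LinearMap.id - (augmentation _).smulRight
      (Finsupp.single (ContinuousMap.const _ H.center) 1) from LinearMap.congr_fun h x
  refine Finsupp.lhom_ext' fun τ => LinearMap.ext_ring ?_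
  simp [boundary_single, H.face_zero_cone, H.face_one_cone, sub_eq_add_neg]

lemma Contraction.boundary_coneChain_succ (n : ℕ) (x : Chain E (n + 1)) :
    boundary E (n + 1) (H.coneChain (n + 1) x) = x - H.coneChain n (boundary E n x) := by
  suffices h : boundary E (n + 1) ∘ₗ H.coneChain (n + 1) =
      LinearMap.id - H.coneChain n ∘ₗ boundary E n from LinearMap.congr_fun h x
  refine Finsupp.lhom_ext' fun τ => LinearMap.ext_ring ?_
  simp only [LinearMap.comp_apply, Finsupp.lsingle_apply, Contraction.coneChain_single,
    boundary_single, Fin.sum_univ_succ (n := n + 2), H.face_zero_cone, H.face_succ_cone,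
    LinearMap.sub_apply, LinearMap.id_apply, map_sum, one_smul]
  simp [pow_succ, sub_eq_add_neg, Finset.sum_neg_distrib]

end Cones

/-! ## Deck transformations -/

section Deck

variable {E : Type v} [TopologicalSpace E] {Z : Type v} {p : E → Z}

/-- The deck transformations as a subgroup of the group of homeomorphisms. -/
def deckSubgroup (p : E → Z) : Subgroup (E ≃ₜ E) where
  carrier := {g | ∀ x, p (g x) = p x}
  one_mem' _ := rfl
  mul_mem' {g h} hg hh x := (hg (h x)).trans (hh x)
  inv_mem' {g} hg x := by
    have := hg (g⁻¹ x)
    rw [← this]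
    exact congrArg p (g.apply_symm_apply x)

/-- The group of deck transformations. -/
def Deck (p : E → Z) : Type v := deckSubgroup p

instance : Group (Deck p) := inferInstanceAs (Group (deckSubgroup p))

/-- A deck transformation as a continuous map. -/
def Deck.toMap (g : Deck p) : C(E, E) := ⟨g.1, g.1.continuous⟩

lemma Deck.proj_apply (g : Deck p) (x : E) : p (g.toMap x) = p x := g.2 x

@[simp] lemma Deck.mul_toMap_apply (g h : Deck p) (x : E) :
    (g * h).toMap x = g.toMap (h.toMap x) := rfl

lemma Deck.mul_toMap (g h : Deck p) : (g * h).toMap = g.toMap.comp h.toMap := rfl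

lemma Deck.inv_toMap_comp (g : Deck p) : (g⁻¹).toMap.comp g.toMap = ContinuousMap.id E := by
  rw [← Deck.mul_toMap, inv_mul_cancel]
  rfl

lemma Deck.comp_inv_toMap (g : Deck p) : g.toMap.comp (g⁻¹).toMap = ContinuousMap.id E := by
  rw [← Deck.mul_toMap, mul_inv_cancel]
  rfl

variable [TopologicalSpace Z]

/-- Run the contraction backwards: its projection is a homotopy from a constant map to `p`, which
lifts from any constant start in the fibre. Starting at the end of the lift `Γ` from `y` of the
track of `x`, uniqueness forces the lift over `x` to retrace `Γ` and end at `y`. -/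
lemma Contraction.exists_lift_self (H : Contraction E) (hp : IsCoveringMap p) {x y : E}
    (hxy : p x = p y) : ∃ f : C(E, E), (∀ z, p (f z) = p z) ∧ f x = y := by
  let P : C(E, Z) := ⟨p, hp.continuous⟩
  let S : C(unitInterval, unitInterval) := ⟨unitInterval.symm, unitInterval.continuous_symm⟩
  let γ : C(unitInterval, Z) := ⟨fun t => p (H.toMap (t, x)),
    hp.continuous.comp (H.toMap.continuous.comp (Continuous.prodMk_left x))⟩
  have hγ0 : γ 0 = p y := by
    change p (H.toMap (0, x)) = p y
    rw [H.map_zero, hxy]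
  let Γ := hp.liftPath γ y hγ0
  have hΓ : ∀ t, p (Γ t) = p (H.toMap (t, x)) := fun t => congr_fun (hp.liftPath_lifts γ y hγ0) t
  let K : C(unitInterval × E, Z) := P.comp (H.toMap.comp (S.prodMap (ContinuousMap.id E)))
  have hK : ∀ t z, K (t, z) = p (H.toMap (unitInterval.symm t, z)) := fun t z => rfl
  have hK0 : ∀ z, K (0, z) = p (ContinuousMap.const E (Γ 1) z) := by
    intro z
    rw [hK, unitInterval.symm_zero, H.map_one, ContinuousMap.const_apply, hΓ, H.map_one]
  let L := hp.liftHomotopy K (ContinuousMap.const E (Γ 1)) hK0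
  have hL : ∀ t z, p (L (t, z)) = K (t, z) := fun t z =>
    congr_fun (hp.liftHomotopy_lifts K _ hK0) (t, z)
  have hL0 : ∀ z, L (0, z) = Γ 1 := fun z => hp.liftHomotopy_zero K _ hK0 z
  refine ⟨L.comp (ContinuousMap.prodMk (ContinuousMap.const E 1) (ContinuousMap.id E)),
    fun z => ?_, ?_⟩
  · change p (L (1, z)) = p z
    rw [hL, hK, unitInterval.symm_one, H.map_zero]
  · change L (1, x) = y
    have h := hp.eq_of_comp_eq (g₁ := fun t : unitInterval => L (t, x))
      (g₂ := fun t : unitInterval => Γ (unitInterval.symm t))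
      (L.continuous.comp (Continuous.prodMk_left x))
      (Γ.continuous.comp unitInterval.continuous_symm)
      (by
        funext t
        simp only [Function.comp_apply, hL, hK, hΓ]) 0
      (by rw [hL0, unitInterval.symm_zero])
    have h1 := congr_fun h 1
    simp only [unitInterval.symm_one] at h1
    rw [h1]
    exact hp.liftPath_zero γ y hγ0

lemma eq_of_proj_eq [PreconnectedSpace E] (hp : IsCoveringMap p) {f g : C(E, E)}
    (hf : ∀ z, p (f z) = p z) (hg : ∀ z, p (g z) = p z) {x : E} (h : f x = g x) : f = g :=
  DFunLike.coe_injective (hp.eq_of_comp_eq f.continuous g.continuous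
    (funext fun z => (hf z).trans (hg z).symm) x h)

/-- Lifts taking `x` to `y` and `y` to `x` are mutually inverse, because each composite agrees with
the identity at one point. -/
lemma Contraction.exists_deck [PreconnectedSpace E] (H : Contraction E) (hp : IsCoveringMap p)
    {x y : E} (hxy : p x = p y) : ∃ g : Deck p, g.toMap x = y := by
  obtain ⟨f, hf, hfx⟩ := H.exists_lift_self hp hxy
  obtain ⟨f', hf', hfy⟩ := H.exists_lift_self hp hxy.symm
  have h1 : f'.comp f = ContinuousMap.id E :=
    eq_of_proj_eq hp (fun z => (hf' _).trans (hf z)) (fun z => rfl) (x := x) (by simp [hfx, hfy])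
  have h2 : f.comp f' = ContinuousMap.id E :=
    eq_of_proj_eq hp (fun z => (hf _).trans (hf' z)) (fun z => rfl) (x := y) (by simp [hfx, hfy])
  exact ⟨⟨⟨⟨f, f', DFunLike.congr_fun h1, DFunLike.congr_fun h2⟩, f.continuous, f'.continuous⟩, hf⟩,
    hfx⟩

lemma Deck.eq_of_apply_eq [PreconnectedSpace E] (hp : IsCoveringMap p) {g h : Deck p} {x : E}
    (hx : g.toMap x = h.toMap x) : g = h := by
  have := eq_of_proj_eq hp g.proj_apply h.proj_apply hx
  exact Subtype.ext (Homeomorph.ext fun z => DFunLike.congr_fun this z)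

end Deck

/-! ## Straight simplices -/

section Straight

variable {E : Type v} [TopologicalSpace E] {Z : Type v} {p : E → Z}
  (H : Contraction E)

/-- The straight simplex with the vertices `w i • center`. -/
def Contraction.straight : ∀ n : ℕ, (Fin (n + 1) → Deck p) → SingularSimplex E n
  | 0, w => ContinuousMap.const _ ((w 0).toMap H.center)
  | n + 1, w => (w 0).toMap.comp
      (H.cone ((w 0)⁻¹.toMap.comp (Contraction.straight n (Fin.tail w))))

lemma Contraction.straight_succ (n : ℕ) (w : Fin (n + 2) → Deck p) :
    H.straight (n + 1) w = (w 0).toMap.comp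
      (H.cone ((w 0)⁻¹.toMap.comp (H.straight n (Fin.tail w)))) := rfl

lemma face_comp {X Y : Type*} [TopologicalSpace X] [TopologicalSpace Y] (g : C(X, Y))
    {n : ℕ} (σ : SingularSimplex X (n + 1)) (i : Fin (n + 2)) :
    SingularSimplex.face (g.comp σ) i = g.comp (σ.face i) := rfl

lemma Contraction.face_straight (n : ℕ) (w : Fin (n + 2) → Deck p) (i : Fin (n + 2)) :
    (H.straight (n + 1) w).face i = H.straight n (w ∘ i.succAbove) := by
  induction n with
  | zero =>
    refine Fin.cases ?_ (fun k => ?_) i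
    · rw [H.straight_succ, face_comp, H.face_zero_cone,
        ← ContinuousMap.comp_assoc, Deck.comp_inv_toMap]
      rfl
    · have hk : k = 0 := Subsingleton.elim (α := Fin 1) _ _
      subst hk
      rw [H.straight_succ, face_comp]
      change (w 0).toMap.comp (SingularSimplex.face (H.cone _) 1) = _
      rw [H.face_one_cone]
      rfl
  | succ n ih =>
    refine Fin.cases ?_ (fun k => ?_) i
    · rw [H.straight_succ, face_comp, H.face_zero_cone,
        ← ContinuousMap.comp_assoc, Deck.comp_inv_toMap]
      rfl
    · rw [H.straight_succ, face_comp, H.face_succ_cone, face_comp,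
        ih, H.straight_succ]
      have h0 : (w ∘ k.succ.succAbove) 0 = w 0 := by simp
      have h1 : Fin.tail (w ∘ k.succ.succAbove) = Fin.tail w ∘ k.succAbove := by
        funext l
        simp [Fin.tail]
      rw [h0, h1]

/-- Each cone is formed after moving its apex back to the center, so the translation cancels inside
and survives only outside. -/
lemma Contraction.straight_smul (g : Deck p) (n : ℕ) (w : Fin (n + 1) → Deck p) :
    H.straight n (fun i => g * w i) = g.toMap.comp (H.straight n w) := by
  induction n with
  | zero => rfl
  | succ n ih =>
    have h1 : Fin.tail (fun i => g * w i) = fun i => g * Fin.tail w i := rfl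
    rw [H.straight_succ, H.straight_succ, h1, ih, ← ContinuousMap.comp_assoc,
      ← Deck.mul_toMap, mul_inv_rev, inv_mul_cancel_right, Deck.mul_toMap, ContinuousMap.comp_assoc]

/-- The chain map from tuples of deck transformations to straight simplices. -/
def Contraction.straightChain (p : E → Z) (n : ℕ) : TupleChain (Deck p) n →ₗ[ℝ] Chain E n :=
  Finsupp.lmapDomain ℝ ℝ (H.straight n)

@[simp] lemma Contraction.straightChain_single (n : ℕ) (w : Fin (n + 1) → Deck p) (r : ℝ) :
    H.straightChain p n (Finsupp.single w r) = Finsupp.single (H.straight n w) r := by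
  simp [Contraction.straightChain]

lemma Contraction.boundary_straightChain (n : ℕ) (x : TupleChain (Deck p) (n + 1)) :
    boundary E n (H.straightChain p (n + 1) x) = H.straightChain p n (tupleBoundary _ n x) := by
  suffices h : boundary E n ∘ₗ H.straightChain p (n + 1) =
      H.straightChain p n ∘ₗ tupleBoundary _ n from LinearMap.congr_fun h x
  refine Finsupp.lhom_ext' fun w => LinearMap.ext_ring ?_
  simp [boundary_single, tupleBoundary_single, H.face_straight]

lemma Contraction.straightChain_smul (g : Deck p) (n : ℕ) (x : TupleChain (Deck p) n) :
    H.straightChain p n (tupleMap (fun h => g * h) n x) =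
      chainMap g.toMap n (H.straightChain p n x) := by
  suffices h : H.straightChain p n ∘ₗ tupleMap (fun h => g * h) n =
      chainMap g.toMap n ∘ₗ H.straightChain p n from LinearMap.congr_fun h x
  refine Finsupp.lhom_ext' fun w => LinearMap.ext_ring ?_
  simp only [LinearMap.comp_apply, Finsupp.lsingle_apply, tupleMap_single,
    Contraction.straightChain_single, chainMap_single, ← H.straight_smul]
  rfl

lemma Contraction.augmentation_straightChain (n : ℕ) (x : TupleChain (Deck p) n) :
    augmentation _ (H.straightChain p n x) = augmentation _ x := by
  suffices h : augmentation _ ∘ₗ H.straightChain p n = augmentation _ from LinearMap.congr_fun h x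
  refine Finsupp.lhom_ext' fun w => LinearMap.ext_ring ?_
  simp

end Straight

/-! ## Lifting along homotopies -/

section Lifting

variable {E Z : Type*} [TopologicalSpace E] [TopologicalSpace Z] {p : E → Z}

/-- The second conclusion, that stationary points keep their given lift, is what lets lifts over
cells match those already present on the boundary. -/
lemma exists_lift_end (hp : IsCoveringMap p) {A : Type*} [TopologicalSpace A]
    (K : C(unitInterval × A, Z)) (f : C(A, E)) (h0 : ∀ a, K (0, a) = p (f a)) :
    ∃ l : C(A, E), (∀ a, p (l a) = K (1, a)) ∧ ∀ a, (∀ t, K (t, a) = K (0, a)) → l a = f a := by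
  let L := hp.liftHomotopy K f h0
  have hL : ∀ t a, p (L (t, a)) = K (t, a) := fun t a =>
    congr_fun (hp.liftHomotopy_lifts K f h0) (t, a)
  have hL0 : ∀ a, L (0, a) = f a := hp.liftHomotopy_zero K f h0
  refine ⟨L.comp (ContinuousMap.prodMk (ContinuousMap.const A 1) (ContinuousMap.id A)),
    fun a => hL 1 a, fun a ha => ?_⟩
  have := hp.const_of_comp (g := fun t : unitInterval => L (t, a))
    (L.continuous.comp (Continuous.prodMk_left a)) (fun t t' => by simp only [hL, ha]) 1 0
  exact this.trans (hL0 a)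

end Lifting

/-! ## Neighborhoods of the cells of a CW-complex -/

section CW

open Metric

variable {X : Type u} [TopologicalSpace X] [T2Space X] [CWComplex (univ : Set X)]

/-- The characteristic map of a cell. -/
abbrev charMap (n : ℕ) (e : RelCWComplex.cell (univ : Set X) n) : (Fin n → ℝ) → X :=
  RelCWComplex.map (C := (univ : Set X)) n e

omit [T2Space X] in
lemma exists_mem_openCell (x : X) :
    ∃ e : Σ n, RelCWComplex.cell (univ : Set X) n, x ∈ RelCWComplex.openCell e.1 e.2 := by
  have hx : x ∈ (univ : Set X) := mem_univ x
  rw [← CWComplex.iUnion_openCell_eq_complex (C := (univ : Set X))] at hx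
  obtain ⟨n, hn⟩ := mem_iUnion.1 hx
  obtain ⟨e, he⟩ := mem_iUnion.1 hn
  exact ⟨⟨n, e⟩, he⟩

omit [T2Space X] in
lemma openCell_unique {a b : Σ n, RelCWComplex.cell (univ : Set X) n} {x : X}
    (ha : x ∈ RelCWComplex.openCell a.1 a.2) (hb : x ∈ RelCWComplex.openCell b.1 b.2) : a = b := by
  by_contra h
  exact disjoint_left.1 (RelCWComplex.disjoint_openCell_of_ne h) ha hb

/-- The dimension of the open cell that contains a point. -/
def cellDim (x : X) : ℕ := (exists_mem_openCell x).choose.1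

omit [T2Space X] in
lemma cellDim_eq {n : ℕ} {e : RelCWComplex.cell (univ : Set X) n} {x : X}
    (hx : x ∈ RelCWComplex.openCell n e) : cellDim x = n :=
  congrArg Sigma.fst (openCell_unique (b := ⟨n, e⟩) (exists_mem_openCell x).choose_spec hx)

lemma mem_skeletonLT_iff_cellDim {n : ℕ} {x : X} :
    x ∈ (RelCWComplex.skeletonLT (univ : Set X) (n : ℕ∞) : Set X) ↔ cellDim x < n := by
  rw [SetLike.mem_coe, CWComplex.mem_skeletonLT_iff]
  constructor
  · rintro ⟨m, hm, e, he⟩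
    rw [cellDim_eq he]
    exact_mod_cast hm
  · intro h
    obtain ⟨⟨m, e⟩, he⟩ := exists_mem_openCell x
    rw [cellDim_eq he] at h
    exact ⟨m, by exact_mod_cast h, e, he⟩

lemma isClosed_cellDim_lt (n : ℕ) : IsClosed {x : X | cellDim x < n} := by
  have : {x : X | cellDim x < n} = RelCWComplex.skeletonLT (univ : Set X) (n : ℕ∞) :=
    ext fun x => mem_skeletonLT_iff_cellDim.symm
  rw [this]
  exact RelCWComplex.Subcomplex.closed _

lemma cellDim_charMap_lt {n : ℕ} (e : RelCWComplex.cell (univ : Set X) n) {y : Fin n → ℝ}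
    (hy : y ∈ sphere 0 1) : cellDim (charMap n e y) < n :=
  mem_skeletonLT_iff_cellDim.1 (RelCWComplex.cellFrontier_subset_skeletonLT n e ⟨y, hy, rfl⟩)

/-- Gluing over the `n`-cells. Quantifying over `S` after the extension is fixed allows it to be
used for weights, with `S` the whole space, and for lifts, with `S` the set of positive weight. -/
lemma exists_continuousOn_extension [RelCWComplex.Finite (univ : Set X)] {Y : Type*}
    [TopologicalSpace Y] (n : ℕ) (f : X → Y)
    (F : RelCWComplex.cell (univ : Set X) n → (Fin n → ℝ) → Y) :
    ∃ f' : X → Y, (∀ x, cellDim x < n → f' x = f x) ∧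
      (∀ e, ∀ y ∈ ball 0 1, f' (charMap n e y) = F e y) ∧
      ∀ S : Set X, ContinuousOn f ({x | cellDim x < n} ∩ S) →
        (∀ e, ContinuousOn (F e) (closedBall 0 1 ∩ charMap n e ⁻¹' S)) →
        (∀ e, ∀ y ∈ sphere 0 1, charMap n e y ∈ S → F e y = f (charMap n e y)) →
        ContinuousOn f' ({x | cellDim x < n + 1} ∩ S) := by
  classical
  let f' : X → Y := fun x =>
    if h : ∃ e : RelCWComplex.cell (univ : Set X) n, x ∈ RelCWComplex.openCell n e then
      F h.choose ((RelCWComplex.map (C := (univ : Set X)) n h.choose).symm x) else f x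
  have h1 : ∀ x, cellDim x < n → f' x = f x := by
    intro x hx
    refine dif_neg ?_
    rintro ⟨e, he⟩
    rw [cellDim_eq he] at hx
    exact lt_irrefl _ hx
  have h2 : ∀ e, ∀ y ∈ ball (0 : Fin n → ℝ) 1, f' (charMap n e y) = F e y := by
    intro e y hy
    have h : ∃ e' : RelCWComplex.cell (univ : Set X) n,
        charMap n e y ∈ RelCWComplex.openCell n e' := ⟨e, y, hy, rfl⟩
    have he : h.choose = e := by
      have := openCell_unique (a := ⟨n, h.choose⟩) (b := ⟨n, e⟩) h.choose_spec ⟨y, hy, rfl⟩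
      simpa using this
    simp only [f']
    rw [dif_pos h, he, PartialEquiv.left_inv _ (by rwa [RelCWComplex.source_eq])]
  refine ⟨f', h1, h2, fun S hf hF hS => ?_⟩
  rw [continuousOn_iff_isClosed]
  intro C hC
  obtain ⟨u, hu, hu'⟩ := (continuousOn_iff_isClosed.1 hf) C hC
  have hv : ∀ e, ∃ v : Set (Fin n → ℝ), IsClosed v ∧
      F e ⁻¹' C ∩ (closedBall 0 1 ∩ charMap n e ⁻¹' S) = v ∩ (closedBall 0 1 ∩ charMap n e ⁻¹' S) :=
    fun e => (continuousOn_iff_isClosed.1 (hF e)) C hC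
  choose v hv hv' using hv
  have : Finite (RelCWComplex.cell (univ : Set X) n) :=
    RelCWComplex.FiniteType.finite_cell (C := (univ : Set X)) n
  -- Closedness of this set uses that there are finitely many `n`-cells and that the images of the
  -- compact pieces are compact.
  refine ⟨(u ∩ {x | cellDim x < n}) ∪ ⋃ e, charMap n e '' (closedBall 0 1 ∩ v e), ?_, ?_⟩
  · refine (hu.inter (isClosed_cellDim_lt n)).union (isClosed_iUnion_of_finite fun e => ?_)
    refine IsCompact.isClosed (IsCompact.image_of_continuousOn
      ((isCompact_closedBall 0 1).inter_right (hv e)) ?_)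
    exact (RelCWComplex.continuousOn n e).mono inter_subset_left
  · ext x
    simp only [mem_inter_iff, mem_preimage, mem_union, mem_iUnion, mem_image, mem_ofPred_eq]
    refine and_congr_left fun ⟨hx, hxS⟩ => ?_
    have key : ∀ e y, y ∈ closedBall (0 : Fin n → ℝ) 1 → charMap n e y ∈ S →
        (F e y ∈ C ↔ y ∈ v e) := by
      intro e y hy hyS
      have := Set.ext_iff.1 (hv' e) y
      simp only [mem_inter_iff, mem_preimage] at this
      tauto
    have key0 : cellDim x < n → (f x ∈ C ↔ x ∈ u) := by
      intro hxn
      have := Set.ext_iff.1 hu' x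
      simp only [mem_inter_iff, mem_preimage, mem_ofPred_eq] at this
      tauto
    constructor
    · intro hxC
      rcases Nat.lt_succ_iff_lt_or_eq.1 hx with hxn | hxn
      · rw [h1 x hxn] at hxC
        exact Or.inl ⟨(key0 hxn).1 hxC, hxn⟩
      · obtain ⟨⟨m, e⟩, he⟩ := exists_mem_openCell x
        have hm := cellDim_eq he
        simp only at hm
        rw [hxn] at hm
        subst hm
        obtain ⟨y, hy, rfl⟩ := he
        refine Or.inr ⟨e, y, ⟨ball_subset_closedBall hy,
          (key e y (ball_subset_closedBall hy) hxS).1 ?_⟩, rfl⟩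
        rwa [← h2 e y hy]
    · rintro (⟨hxu, hxn⟩ | ⟨e, y, ⟨hy, hyv⟩, rfl⟩)
      · rw [h1 x hxn]
        exact (key0 hxn).2 hxu
      · have hFy := (key e y hy hxS).2 hyv
        rw [← ball_union_sphere] at hy
        rcases hy with hy | hy
        · rwa [h2 e y hy]
        · rwa [h1 _ (cellDim_charMap_lt e hy), ← hS e y hy hxS]

/-- A neighborhood of the union of the `d`-cells within the points in cells of dimension less than
`n`, given as the support of a function, together with a lift of a map on it. -/
structure IsCellNeighborhood {E : Type*} {Z : Type*} [TopologicalSpace E] [TopologicalSpace Z]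
    (p : E → Z) (α : C(X, Z)) (d n : ℕ) (ρ : X → ℝ) (s : X → E) : Prop where
  continuousOn : ContinuousOn ρ {x | cellDim x < n}
  nonneg : ∀ x, cellDim x < n → 0 ≤ ρ x
  le_one : ∀ x, cellDim x < n → ρ x ≤ 1
  eq_zero : ∀ x, cellDim x < n → cellDim x < d → ρ x = 0
  pos : ∀ x, cellDim x < n → cellDim x = d → 0 < ρ x
  continuousOn_lift : ContinuousOn s ({x | cellDim x < n} ∩ {x | 0 < ρ x})
  lift : ∀ x, cellDim x < n → 0 < ρ x → p (s x) = α x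

/-! ### Weights and lifts constructed by induction over skeleta -/

section Neighborhood

variable {E : Type*} {Z : Type*} [TopologicalSpace E] [TopologicalSpace Z] {p : E → Z}
  {α : C(X, Z)}

omit [T2Space X] in
-- The ball contracts radially to its center, so this is homotopy lifting from a constant map.
lemma exists_lift_charMap (hp : IsCoveringMap p) (hs : Function.Surjective p) (n : ℕ)
    (e : RelCWComplex.cell (univ : Set X) n) :
    ∃ l : (Fin n → ℝ) → E, ContinuousOn l (closedBall 0 1) ∧
      ∀ y ∈ closedBall 0 1, p (l y) = α (charMap n e y) := by
  classical
  obtain ⟨e₀, he₀⟩ := hs (α (charMap n e 0))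
  have hmem : ∀ x : unitInterval × closedBall (0 : Fin n → ℝ) 1,
      (x.1 : ℝ) • (x.2 : Fin n → ℝ) ∈ closedBall (0 : Fin n → ℝ) 1 := by
    intro x
    have := x.2.2
    rw [mem_closedBall_zero_iff] at this ⊢
    rw [norm_smul, Real.norm_of_nonneg x.1.2.1]
    exact mul_le_one₀ x.1.2.2 (norm_nonneg _) this
  let K : C(unitInterval × closedBall (0 : Fin n → ℝ) 1, Z) :=
    ⟨fun x => α (charMap n e ((x.1 : ℝ) • (x.2 : Fin n → ℝ))), α.continuous.comp
      ((RelCWComplex.continuousOn (C := (univ : Set X)) n e).comp_continuous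
        (by fun_prop) hmem)⟩
  obtain ⟨l, hl, -⟩ := exists_lift_end hp K (ContinuousMap.const _ e₀) fun a => by
    change α (charMap n e ((0 : ℝ) • _)) = p e₀
    rw [zero_smul, he₀]
  refine ⟨fun y => if h : y ∈ closedBall (0 : Fin n → ℝ) 1 then l ⟨y, h⟩ else e₀, ?_, ?_⟩
  · rw [continuousOn_iff_continuous_domRestrict]
    convert l.continuous using 1
    funext y
    exact dif_pos y.2
  · intro y hy
    refine (congrArg p (dif_pos hy)).trans ((hl _).trans ?_)
    change α (charMap n e ((1 : ℝ) • y)) = _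
    rw [one_smul]

/-- The extension of a function on the boundary of the unit ball to the cone. -/
def radialExtension {n : ℕ} (g : (Fin n → ℝ) → ℝ) (y : Fin n → ℝ) : ℝ := ‖y‖ * g (‖y‖⁻¹ • y)

lemma radialExtension_of_mem_sphere {n : ℕ} (g : (Fin n → ℝ) → ℝ) {y : Fin n → ℝ}
    (hy : y ∈ sphere 0 1) : radialExtension g y = g y := by
  rw [mem_sphere_zero_iff_norm] at hy
  simp [radialExtension, hy]

lemma norm_inv_smul_mem_sphere {n : ℕ} {y : Fin n → ℝ} (hy : y ≠ 0) :
    ‖y‖⁻¹ • y ∈ sphere (0 : Fin n → ℝ) 1 := by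
  rw [mem_sphere_zero_iff_norm, norm_smul, norm_inv, norm_norm, inv_mul_cancel₀ (norm_ne_zero_iff.2 hy)]

/-- At the origin the bounds on `g` squeeze the values by the norm; elsewhere radial projection is
continuous. -/
lemma continuous_radialExtension {n : ℕ} {g : (Fin n → ℝ) → ℝ}
    (hg : ContinuousOn g (sphere 0 1)) (h0 : ∀ y ∈ sphere 0 1, 0 ≤ g y)
    (h1 : ∀ y ∈ sphere 0 1, g y ≤ 1) : Continuous (radialExtension g) := by
  rw [continuous_iff_continuousAt]
  intro y
  by_cases hy : y = 0
  · subst hy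
    rw [ContinuousAt]
    have : radialExtension g 0 = 0 := by simp [radialExtension]
    rw [this]
    refine squeeze_zero_norm (a := fun y => ‖y‖) (fun z => ?_) ?_
    · by_cases hz : z = 0
      · simp [hz, radialExtension]
      · have hz' := norm_inv_smul_mem_sphere hz
        rw [radialExtension, norm_mul, norm_norm, Real.norm_of_nonneg (h0 _ hz')]
        exact mul_le_of_le_one_right (norm_nonneg _) (h1 _ hz')
    · have := (continuous_norm (E := Fin n → ℝ)).tendsto 0
      rwa [norm_zero] at this
  · have hcont : ContinuousOn (radialExtension g) {z | z ≠ 0} := by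
      refine continuous_norm.continuousOn.mul (hg.comp ?_ fun z hz => norm_inv_smul_mem_sphere hz)
      refine ContinuousOn.smul (ContinuousOn.inv₀ continuous_norm.continuousOn
        fun z hz => norm_ne_zero_iff.2 hz) continuousOn_id
    exact hcont.continuousAt (isOpen_ne.mem_nhds hy)

omit [T2Space X] in
-- Move each point from its radial projection back to itself along a straight segment, which stays
-- in the ball by convexity. Points of the sphere do not move, so they keep the prescribed lift.
lemma exists_radial_lift (hp : IsCoveringMap p) (n : ℕ) (e : RelCWComplex.cell (univ : Set X) n)
    {U : Set (Fin n → ℝ)} (hU : U ⊆ closedBall 0 1) (hU0 : ∀ y ∈ U, y ≠ 0) {s : X → E}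
    (hs : ContinuousOn (fun y => s (charMap n e (‖y‖⁻¹ • y))) U)
    (hs' : ∀ y ∈ U, p (s (charMap n e (‖y‖⁻¹ • y))) = α (charMap n e (‖y‖⁻¹ • y))) :
    ∃ l : (Fin n → ℝ) → E, ContinuousOn l U ∧ (∀ y ∈ U, p (l y) = α (charMap n e y)) ∧
      ∀ y ∈ U, y ∈ sphere 0 1 → l y = s (charMap n e y) := by
  classical
  let c : unitInterval × U → (Fin n → ℝ) := fun x =>
    (1 - (x.1 : ℝ)) • (‖(x.2 : Fin n → ℝ)‖⁻¹ • (x.2 : Fin n → ℝ)) + (x.1 : ℝ) • (x.2 : Fin n → ℝ)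
  have hmem : ∀ x, c x ∈ closedBall (0 : Fin n → ℝ) 1 := fun x =>
    convex_closedBall (0 : Fin n → ℝ) 1
      (sphere_subset_closedBall (norm_inv_smul_mem_sphere (hU0 _ x.2.2))) (hU x.2.2)
      (sub_nonneg.2 x.1.2.2) x.1.2.1 (by ring)
  have hc : Continuous c := by
    have : Continuous fun x : unitInterval × U => ‖(x.2 : Fin n → ℝ)‖⁻¹ :=
      Continuous.inv₀ (by fun_prop) fun x => norm_ne_zero_iff.2 (hU0 _ x.2.2)
    fun_prop
  let K : C(unitInterval × U, Z) := ⟨fun x => α (charMap n e (c x)), α.continuous.comp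
      ((RelCWComplex.continuousOn (C := (univ : Set X)) n e).comp_continuous hc hmem)⟩
  obtain ⟨l, hl, hl'⟩ := exists_lift_end hp K
    ⟨fun y : U => s (charMap n e (‖(y : Fin n → ℝ)‖⁻¹ • (y : Fin n → ℝ))),
      continuousOn_iff_continuous_domRestrict.1 hs⟩ fun y => by
    change α (charMap n e (c (0, y))) = p (s _)
    rw [hs' y y.2]
    simp [c]
  refine ⟨fun y => if h : y ∈ U then l ⟨y, h⟩ else s (charMap n e y), ?_, ?_, ?_⟩
  · rw [continuousOn_iff_continuous_domRestrict]
    convert l.continuous using 1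
    funext y
    exact dif_pos y.2
  · intro y hy
    simp only [dif_pos hy, hl]
    change α (charMap n e (c (1, ⟨y, hy⟩))) = _
    simp [c]
  · intro y hy hy1
    rw [mem_sphere_zero_iff_norm] at hy1
    have hcy : ∀ t, c (t, ⟨y, hy⟩) = y := by
      intro t
      simp only [c, hy1, inv_one, one_smul]
      rw [← add_smul, sub_add_cancel, one_smul]
    refine (dif_pos hy).trans ((hl' ⟨y, hy⟩ fun t => ?_).trans ?_)
    · change α (charMap n e (c (t, _))) = α (charMap n e (c (0, _)))
      rw [hcy, hcy]
    · change s (charMap n e (‖y‖⁻¹ • y)) = _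
      rw [hy1, inv_one, one_smul]

variable [RelCWComplex.Finite (univ : Set X)]

/-- On a `d`-cell the weight is `1 - ‖y‖`. It vanishes on the bounding sphere, so lifts on the
various cells need not match anything. -/
lemma IsCellNeighborhood.succ_self (hp : IsCoveringMap p) (hs : Function.Surjective p) {d : ℕ}
    {ρ : X → ℝ} {s : X → E} (h : IsCellNeighborhood p α d d ρ s) :
    ∃ ρ' s', IsCellNeighborhood p α d (d + 1) ρ' s' := by
  obtain ⟨ρ', h1, h2, h3⟩ := exists_continuousOn_extension (X := X) d ρ fun _ y => 1 - ‖y‖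
  choose l hl hl' using fun e => exists_lift_charMap (α := α) hp hs d e
  obtain ⟨s', k1, k2, k3⟩ := exists_continuousOn_extension (X := X) d s l
  have hcases : ∀ x : X, cellDim x < d + 1 → (cellDim x < d ∧ ρ' x = 0) ∨
      (cellDim x = d ∧ ∃ e, ∃ y ∈ ball (0 : Fin d → ℝ) 1, x = charMap d e y ∧ ρ' x = 1 - ‖y‖) := by
    intro x hx
    rcases Nat.lt_succ_iff_lt_or_eq.1 hx with hxn | hxn
    · exact Or.inl ⟨hxn, by rw [h1 x hxn, h.eq_zero x hxn hxn]⟩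
    · obtain ⟨⟨m, e⟩, he⟩ := exists_mem_openCell x
      have hm := cellDim_eq he
      simp only at hm
      rw [hxn] at hm
      subst hm
      obtain ⟨y, hy, rfl⟩ := he
      exact Or.inr ⟨hxn, e, y, hy, rfl, h2 e y hy⟩
  refine ⟨ρ', s', ?_, ?_, ?_, ?_, ?_, ?_, ?_⟩
  · have := h3 univ (by simpa using h.continuousOn) (fun e => by fun_prop) fun e y hy _ => by
      rw [h.eq_zero _ (cellDim_charMap_lt e hy) (cellDim_charMap_lt e hy),
        mem_sphere_zero_iff_norm.1 hy, sub_self]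
    simpa using this
  · intro x hx
    rcases hcases x hx with ⟨-, h0⟩ | ⟨-, e, y, hy, -, h0⟩
    · rw [h0]
    · rw [h0, sub_nonneg]
      exact (mem_ball_zero_iff.1 hy).le
  · intro x hx
    rcases hcases x hx with ⟨-, h0⟩ | ⟨-, e, y, hy, -, h0⟩
    · rw [h0]
      exact zero_le_one
    · rw [h0, sub_le_self_iff]
      exact norm_nonneg y
  · intro x hx hxd
    rcases hcases x hx with ⟨-, h0⟩ | ⟨hxd', -⟩
    · exact h0
    · exact absurd hxd' hxd.ne
  · intro x hx hxd
    rcases hcases x hx with ⟨hxd', -⟩ | ⟨-, e, y, hy, -, h0⟩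
    · exact absurd hxd hxd'.ne
    · rw [h0, sub_pos]
      exact mem_ball_zero_iff.1 hy
  · refine k3 _ ?_ (fun e => (hl e).mono inter_subset_left) fun e y hy hyS => ?_
    · convert continuousOn_empty s
      rw [Set.eq_empty_iff_forall_notMem]
      rintro x ⟨hx, hx0⟩
      rw [mem_ofPred_eq, h1 x hx, h.eq_zero x hx hx] at hx0
      exact lt_irrefl _ hx0
    · have hy' := cellDim_charMap_lt e hy
      rw [mem_ofPred_eq, h1 _ hy', h.eq_zero _ hy' hy'] at hyS
      exact absurd hyS (lt_irrefl _)
  · intro x hx hx0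
    rcases hcases x hx with ⟨-, h0⟩ | ⟨-, e, y, hy, rfl, -⟩
    · exact absurd h0 hx0.ne'
    · rw [k2 e y hy]
      exact hl' e y (ball_subset_closedBall hy)

/-- The weight is extended conically over each cell. It vanishes at the center, so its positive set
avoids the center and projects radially to the positive set on the sphere, from which the lift is
transported. -/
lemma IsCellNeighborhood.succ (hp : IsCoveringMap p) {d n : ℕ} (hdn : d < n)
    {ρ : X → ℝ} {s : X → E} (h : IsCellNeighborhood p α d n ρ s) :
    ∃ ρ' s', IsCellNeighborhood p α d (n + 1) ρ' s' := by
  have hΦ : ∀ e, MapsTo (charMap (X := X) n e) (sphere 0 1) {x | cellDim x < n} :=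
    fun e y hy => cellDim_charMap_lt e hy
  have hΦc : ∀ e, ContinuousOn (charMap (X := X) n e) (sphere 0 1) := fun e =>
    (RelCWComplex.continuousOn n e).mono sphere_subset_closedBall
  set R : RelCWComplex.cell (univ : Set X) n → (Fin n → ℝ) → ℝ := fun e =>
    radialExtension fun y => ρ (charMap n e y) with hR
  have hRc : ∀ e, Continuous (R e) := fun e => continuous_radialExtension
    (h.continuousOn.comp (hΦc e) (hΦ e)) (fun y hy => h.nonneg _ (hΦ e hy))
    fun y hy => h.le_one _ (hΦ e hy)
  obtain ⟨ρ', h1, h2, h3⟩ := exists_continuousOn_extension (X := X) n ρ R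
  have h2' : ∀ e, ∀ y ∈ closedBall (0 : Fin n → ℝ) 1, ρ' (charMap n e y) = R e y := by
    intro e y hy
    rw [← ball_union_sphere] at hy
    rcases hy with hy | hy
    · exact h2 e y hy
    · rw [h1 _ (hΦ e hy)]
      exact (radialExtension_of_mem_sphere (fun y => ρ (charMap n e y)) hy).symm
  have hRpos : ∀ e y, 0 < R e y → y ≠ 0 ∧ 0 < ρ (charMap n e (‖y‖⁻¹ • y)) := by
    intro e y hy
    have hy0 : y ≠ 0 := by
      rintro rfl
      simp [hR, radialExtension] at hy
    exact ⟨hy0, pos_of_mul_pos_right hy (norm_nonneg _)⟩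
  have hlift : ∀ e : RelCWComplex.cell (univ : Set X) n, ∃ l : (Fin n → ℝ) → E,
      ContinuousOn l (closedBall 0 1 ∩ charMap n e ⁻¹' {x | 0 < ρ' x}) ∧
      (∀ y ∈ closedBall 0 1 ∩ charMap n e ⁻¹' {x | 0 < ρ' x}, p (l y) = α (charMap n e y)) ∧
      ∀ y ∈ closedBall 0 1 ∩ charMap n e ⁻¹' {x | 0 < ρ' x}, y ∈ sphere 0 1 →
        l y = s (charMap n e y) := by
    intro e
    have hU : ∀ y ∈ closedBall 0 1 ∩ charMap n e ⁻¹' {x | 0 < ρ' x}, 0 < R e y := by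
      rintro y ⟨hy, hy0⟩
      rwa [mem_preimage, mem_ofPred_eq, h2' e y hy] at hy0
    refine exists_radial_lift hp n e inter_subset_left (fun y hy => (hRpos e y (hU y hy)).1) ?_ ?_
    · refine h.continuousOn_lift.comp ((hΦc e).comp (t := sphere 0 1) ?_ ?_) ?_
      · exact ContinuousOn.smul (ContinuousOn.inv₀ continuous_norm.continuousOn
          fun z hz => norm_ne_zero_iff.2 (hRpos e z (hU z hz)).1) continuousOn_id
      · exact fun y hy => norm_inv_smul_mem_sphere (hRpos e y (hU y hy)).1
      · exact fun y hy => ⟨hΦ e (norm_inv_smul_mem_sphere (hRpos e y (hU y hy)).1),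
          (hRpos e y (hU y hy)).2⟩
    · exact fun y hy => h.lift _ (hΦ e (norm_inv_smul_mem_sphere (hRpos e y (hU y hy)).1))
        (hRpos e y (hU y hy)).2
  choose l hl hl' hl'' using hlift
  obtain ⟨s', k1, k2, k3⟩ := exists_continuousOn_extension (X := X) n s l
  have hcases : ∀ x : X, cellDim x < n + 1 → (cellDim x < n ∧ ρ' x = ρ x) ∨
      (cellDim x = n ∧ ∃ e, ∃ y ∈ ball (0 : Fin n → ℝ) 1, x = charMap n e y ∧ ρ' x = R e y) := by
    intro x hx
    rcases Nat.lt_succ_iff_lt_or_eq.1 hx with hxn | hxn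
    · exact Or.inl ⟨hxn, h1 x hxn⟩
    · obtain ⟨⟨m, e⟩, he⟩ := exists_mem_openCell x
      have hm := cellDim_eq he
      simp only at hm
      rw [hxn] at hm
      subst hm
      obtain ⟨y, hy, rfl⟩ := he
      exact Or.inr ⟨hxn, e, y, hy, rfl, h2 e y hy⟩
  have hRnonneg : ∀ e y, 0 ≤ R e y := by
    intro e y
    by_cases hy : y = 0
    · simp [hR, radialExtension, hy]
    · exact mul_nonneg (norm_nonneg _) (h.nonneg _ (hΦ e (norm_inv_smul_mem_sphere hy)))
  have hRle : ∀ e, ∀ y ∈ ball (0 : Fin n → ℝ) 1, R e y ≤ 1 := by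
    intro e y hy1
    by_cases hy : y = 0
    · simp [hR, radialExtension, hy]
    · exact mul_le_one₀ (mem_ball_zero_iff.1 hy1).le
        (h.nonneg _ (hΦ e (norm_inv_smul_mem_sphere hy)))
        (h.le_one _ (hΦ e (norm_inv_smul_mem_sphere hy)))
  refine ⟨ρ', s', ?_, ?_, ?_, ?_, ?_, ?_, ?_⟩
  · have := h3 univ (by simpa using h.continuousOn) (fun e => (hRc e).continuousOn)
      fun e y hy _ => radialExtension_of_mem_sphere _ hy
    simpa using this
  · intro x hx
    rcases hcases x hx with ⟨hx, h0⟩ | ⟨-, e, y, hy, -, h0⟩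
    · rw [h0]
      exact h.nonneg x hx
    · rw [h0]
      exact hRnonneg e y
  · intro x hx
    rcases hcases x hx with ⟨hx, h0⟩ | ⟨-, e, y, hy, -, h0⟩
    · rw [h0]
      exact h.le_one x hx
    · rw [h0]
      exact hRle e y hy
  · intro x hx hxd
    have hxn := hxd.trans hdn
    rw [h1 x hxn]
    exact h.eq_zero x hxn hxd
  · intro x hx hxd
    have hxn : cellDim x < n := hxd ▸ hdn
    rw [h1 x hxn]
    exact h.pos x hxn hxd
  · refine k3 _ ?_ hl fun e y hy hyS => hl'' e y ⟨sphere_subset_closedBall hy, hyS⟩ hy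
    refine h.continuousOn_lift.mono fun x hx => ⟨hx.1, ?_⟩
    have := hx.2
    rwa [mem_ofPred_eq, h1 x hx.1] at this
  · intro x hx hx0
    rcases hcases x hx with ⟨hxn, h0⟩ | ⟨-, e, y, hy, rfl, -⟩
    · rw [k1 x hxn]
      exact h.lift x hxn (h0 ▸ hx0)
    · rw [k2 e y hy]
      exact hl' e y ⟨ball_subset_closedBall hy, hx0⟩

lemma exists_cellDim_lt (X : Type u) [TopologicalSpace X] [T2Space X] [CWComplex (univ : Set X)]
    [RelCWComplex.Finite (univ : Set X)] : ∃ M, ∀ x : X, cellDim x < M := by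
  have h : ∀ᶠ n in Filter.atTop, IsEmpty (RelCWComplex.cell (univ : Set X) n) :=
    RelCWComplex.FiniteDimensional.eventually_isEmpty_cell
  obtain ⟨M, hM⟩ := Filter.eventually_atTop.1 h
  refine ⟨M, fun x => ?_⟩
  obtain ⟨⟨m, e⟩, he⟩ := exists_mem_openCell x
  rw [cellDim_eq he]
  by_contra hlt
  exact (hM m (not_lt.1 hlt)).false e

/-- Every `d` admits a neighborhood of the union of the open `d`-cells of a finite CW-complex
that lies in the cells of dimension at least `d`, and on which a map lifts to a covering. -/
lemma exists_cellNeighborhood (hp : IsCoveringMap p) (hs : Function.Surjective p) (α : C(X, Z))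
    (d : ℕ) : ∃ (ρ : X → ℝ) (s : X → E), Continuous ρ ∧ (∀ x, cellDim x < d → ρ x = 0) ∧
      (∀ x, cellDim x = d → 0 < ρ x) ∧ (∀ x, 0 ≤ ρ x) ∧ ContinuousOn s {x | 0 < ρ x} ∧
      ∀ x, 0 < ρ x → p (s x) = α x := by
  have key : ∀ k, ∃ ρ s, IsCellNeighborhood p α d (d + 1 + k) ρ s := by
    intro k
    induction k with
    | zero =>
      -- The weight is zero here, so the lift may be an arbitrary set-theoretic choice.
      have h : IsCellNeighborhood p α d d (fun _ => 0) fun x => (hs (α x)).choose :=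
        { continuousOn := continuousOn_const
          nonneg := fun _ _ => le_rfl
          le_one := fun _ _ => zero_le_one
          eq_zero := fun _ _ _ => rfl
          pos := fun x h h' => absurd h' h.ne
          continuousOn_lift := by
            simp
          lift := fun x _ h => absurd h (lt_irrefl _) }
      exact h.succ_self hp hs
    | succ k ih =>
      obtain ⟨ρ, s, h⟩ := ih
      exact h.succ hp ((Nat.lt_succ_self d).trans_le (Nat.le_add_right _ _))
  obtain ⟨M, hM⟩ := exists_cellDim_lt X
  obtain ⟨ρ, s, h⟩ := key M
  have hlt : ∀ x : X, cellDim x < d + 1 + M := fun x => (hM x).trans_le (by omega)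
  have huniv : {x : X | cellDim x < d + 1 + M} = univ := eq_univ_of_forall hlt
  refine ⟨ρ, s, ?_, fun x hx => h.eq_zero x (hlt x) hx, fun x hx => h.pos x (hlt x) hx,
    fun x => h.nonneg x (hlt x), ?_, fun x hx => h.lift x (hlt x) hx⟩
  · rw [← continuousOn_univ, ← huniv]
    exact h.continuousOn
  · have := h.continuousOn_lift
    rwa [huniv, univ_inter] at this

end Neighborhood

end CW

/-! ## Segments in simplices -/

section Segments

variable {ι κ : Type*} [Fintype ι] [Fintype κ]

/-- The point that divides a segment in a simplex in the ratio `t : 1 - t`. -/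
def simplexSegment (t : unitInterval) (x y : stdSimplex ℝ ι) : stdSimplex ℝ ι :=
  ⟨(1 - (t : ℝ)) • x.1 + (t : ℝ) • y.1,
    convex_stdSimplex ℝ ι x.2 y.2 (sub_nonneg.2 t.2.2) t.2.1 (by ring)⟩

lemma simplexSegment_zero (x y : stdSimplex ℝ ι) : simplexSegment 0 x y = x :=
  Subtype.ext (by simp [simplexSegment])

lemma simplexSegment_one (x y : stdSimplex ℝ ι) : simplexSegment 1 x y = y :=
  Subtype.ext (by simp [simplexSegment])

lemma simplexSegment_apply (t : unitInterval) (x y : stdSimplex ℝ ι) (i : ι) :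
    simplexSegment t x y i = (1 - (t : ℝ)) * x i + (t : ℝ) * y i := rfl

lemma continuous_simplexSegment : Continuous
    fun z : unitInterval × stdSimplex ℝ ι × stdSimplex ℝ ι => simplexSegment z.1 z.2.1 z.2.2 := by
  refine Continuous.subtype_mk ?_ _
  fun_prop

lemma map_simplexSegment (f : ι → κ) (t : unitInterval) (x y : stdSimplex ℝ ι) :
    stdSimplex.map f (simplexSegment t x y) =
      simplexSegment t (stdSimplex.map f x) (stdSimplex.map f y) := by
  apply Subtype.ext
  change FunOnFinite.linearMap ℝ ℝ f ((1 - (t : ℝ)) • x.1 + (t : ℝ) • y.1) =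
    (1 - (t : ℝ)) • FunOnFinite.linearMap ℝ ℝ f x.1 + (t : ℝ) • FunOnFinite.linearMap ℝ ℝ f y.1
  rw [map_add, map_smul, map_smul]

lemma dist_simplexSegment_le (t : unitInterval) (x y : stdSimplex ℝ ι) :
    dist (simplexSegment t x y) x ≤ dist x y := by
  rw [Subtype.dist_eq, Subtype.dist_eq, dist_eq_norm, dist_eq_norm']
  have : (simplexSegment t x y).1 - x.1 = (t : ℝ) • (y.1 - x.1) := by
    simp only [simplexSegment]
    module
  rw [this, norm_smul, Real.norm_of_nonneg t.2.1]
  exact mul_le_of_le_one_left (norm_nonneg _) t.2.2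

lemma dist_map_le {f : ι → κ} (hf : Function.Injective f) (x y : stdSimplex ℝ ι) :
    dist (stdSimplex.map f x) (stdSimplex.map f y) ≤ dist x y := by
  rw [Subtype.dist_eq, Subtype.dist_eq]
  refine (dist_pi_le_iff dist_nonneg).2 fun k => ?_
  by_cases hk : k ∈ range f
  · obtain ⟨i, rfl⟩ := hk
    have hx := stdSimplex_map_apply hf x i
    have hy := stdSimplex_map_apply hf y i
    change dist (stdSimplex.map f x (f i)) (stdSimplex.map f y (f i)) ≤ _
    rw [hx, hy]
    exact dist_le_pi_dist x.1 y.1 i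
  · have hx := stdSimplex_map_apply_of_notMem x hk
    have hy := stdSimplex_map_apply_of_notMem y hk
    change dist (stdSimplex.map f x k) (stdSimplex.map f y k) ≤ _
    rw [hx, hy, dist_self]
    exact dist_nonneg

end Segments

/-! ## The pullback of a covering -/

section LiftSpace

variable {X : Type u} [TopologicalSpace X] {E : Type v} [TopologicalSpace E] {Z : Type v}
  [TopologicalSpace Z]

/-- The pullback of a covering `p` along a map `α`. -/
abbrev LiftSpace (p : E → Z) (α : C(X, Z)) : Type (max u v) := {z : X × E // α z.1 = p z.2}

namespace LiftSpace

variable {p : E → Z} {α : C(X, Z)}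

/-- The projection to the base. -/
def fst : C(LiftSpace p α, X) := ⟨fun z => z.1.1, by fun_prop⟩

/-- The projection to the total space of the covering. -/
def snd : C(LiftSpace p α, E) := ⟨fun z => z.1.2, by fun_prop⟩

lemma map_fst (z : LiftSpace p α) : α (fst z) = p (snd z) := z.2

/-- The action of deck transformations on the pullback. -/
def deck (g : Deck p) : C(LiftSpace p α, LiftSpace p α) :=
  ⟨fun z => ⟨(fst z, g.toMap (snd z)), z.2.trans (g.proj_apply _).symm⟩, by fun_prop⟩

lemma exists_lift (hp : IsCoveringMap p) (hs : Function.Surjective p) {n : ℕ}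
    (σ : SingularSimplex X n) : ∃ τ : SingularSimplex (LiftSpace p α) n, fst.comp τ = σ := by
  let v : stdSimplex ℝ (Fin (n + 1)) := stdSimplex.vertex 0
  obtain ⟨e₀, he₀⟩ := hs (α (σ v))
  let K : C(unitInterval × stdSimplex ℝ (Fin (n + 1)), Z) :=
    ⟨fun x => α (σ (simplexSegment x.1 v x.2)), α.continuous.comp (σ.continuous.comp
      (continuous_simplexSegment.comp (by fun_prop : Continuous
        fun x : unitInterval × stdSimplex ℝ (Fin (n + 1)) => (x.1, v, x.2))))⟩
  obtain ⟨l, hl, -⟩ := exists_lift_end hp K (ContinuousMap.const _ e₀) fun a => by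
    change α (σ (simplexSegment 0 v a)) = p e₀
    rw [simplexSegment_zero, he₀]
  have h : ∀ x, α (σ x) = p (l x) := by
    intro x
    rw [hl]
    change α (σ x) = α (σ (simplexSegment 1 v x))
    rw [simplexSegment_one]
  exact ⟨⟨fun x => ⟨(σ x, l x), h x⟩, Continuous.subtype_mk (by fun_prop) _⟩, rfl⟩

/-- A deck transformation matching the lifts at one vertex matches them everywhere by unique
lifting. -/
lemma eq_deck_comp [PreconnectedSpace E] (H : Contraction E) (hp : IsCoveringMap p) {n : ℕ}
    {σ τ : SingularSimplex (LiftSpace p α) n} (h : fst.comp σ = fst.comp τ) :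
    ∃ g : Deck p, τ = (deck g).comp σ := by
  have hfst : ∀ x, fst (σ x) = fst (τ x) := DFunLike.congr_fun h
  let v : stdSimplex ℝ (Fin (n + 1)) := stdSimplex.vertex 0
  obtain ⟨g, hg⟩ := H.exists_deck hp (x := snd (σ v)) (y := snd (τ v))
    ((map_fst (σ v)).symm.trans ((congrArg α (hfst v)).trans (map_fst (τ v))))
  refine ⟨g, ContinuousMap.ext fun x => Subtype.ext (Prod.ext (hfst x).symm ?_)⟩
  have := hp.eq_of_comp_eq (g₁ := fun x => snd (τ x)) (g₂ := fun x => g.toMap (snd (σ x)))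
    (by fun_prop) (by fun_prop) (funext fun x => by
      simp only [Function.comp_apply, g.proj_apply, ← map_fst, hfst]) v hg.symm
  exact congr_fun this x

/-- A lift of singular chains to the pullback. -/
def liftChain (hp : IsCoveringMap p) (hs : Function.Surjective p) (α : C(X, Z)) (n : ℕ) :
    Chain X n →ₗ[ℝ] Chain (LiftSpace p α) n :=
  Finsupp.lmapDomain ℝ ℝ fun σ => (exists_lift (α := α) hp hs σ).choose

lemma liftChain_single (hp : IsCoveringMap p) (hs : Function.Surjective p) (n : ℕ)
    (σ : SingularSimplex X n) : ∃ τ : SingularSimplex (LiftSpace p α) n, fst.comp τ = σ ∧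
      liftChain hp hs α n (Finsupp.single σ 1) = Finsupp.single τ 1 :=
  ⟨_, (exists_lift (α := α) hp hs σ).choose_spec, by simp [liftChain]⟩

lemma chainMap_fst_liftChain (hp : IsCoveringMap p) (hs : Function.Surjective p) (n : ℕ)
    (x : Chain X n) : chainMap fst n (liftChain hp hs α n x) = x := by
  suffices h : chainMap fst n ∘ₗ liftChain hp hs α n = LinearMap.id from LinearMap.congr_fun h x
  refine Finsupp.lhom_ext' fun σ => LinearMap.ext_ring ?_
  obtain ⟨τ, hτ, h⟩ := liftChain_single (α := α) hp hs n σ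
  simp [h, hτ]

/-- Simplices with the same projection differ by a deck transformation. The chosen lift is not a
chain map, but invariant maps cannot distinguish `∂` of a lift from a lift of `∂`. -/
lemma eq_of_chainMap_fst_eq [PreconnectedSpace E] (H : Contraction E) (hp : IsCoveringMap p)
    (hs : Function.Surjective p) {n : ℕ} {M : Type*} [AddCommGroup M] [Module ℝ M]
    (f : Chain (LiftSpace p α) n →ₗ[ℝ] M) (hf : ∀ g x, f (chainMap (deck g) n x) = f x)
    {x y : Chain (LiftSpace p α) n} (h : chainMap fst n x = chainMap fst n y) : f x = f y := by
  have key : ∀ x, f (liftChain hp hs α n (chainMap fst n x)) = f x := by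
    intro x
    suffices h : f ∘ₗ liftChain hp hs α n ∘ₗ chainMap fst n = f from LinearMap.congr_fun h x
    refine Finsupp.lhom_ext' fun σ => LinearMap.ext_ring ?_
    obtain ⟨τ, hτ, h⟩ := liftChain_single (α := α) hp hs n (fst.comp σ)
    obtain ⟨g, rfl⟩ := eq_deck_comp H hp hτ.symm
    simp only [LinearMap.comp_apply, Finsupp.lsingle_apply, chainMap_single, h]
    rw [← chainMap_single, hf]
  rw [← key x, ← key y, h]

end LiftSpace

end LiftSpace

/-! ## Labels -/

/-- A space with a dimension function and, for each `d`, a neighborhood of the set of points of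
dimension `d` on which a given map to the base of a covering lifts. -/
structure LabelData {X : Type u} [TopologicalSpace X] {E : Type v} [TopologicalSpace E] {Z : Type v}
    [TopologicalSpace Z] (p : E → Z) (α : C(X, Z)) where
  dim : X → ℕ
  bound : ℕ
  dim_lt : ∀ x, dim x < bound
  weight : ℕ → X → ℝ
  continuous_weight : ∀ d, Continuous (weight d)
  weight_eq_zero : ∀ d x, dim x < d → weight d x = 0
  weight_pos : ∀ x, 0 < weight (dim x) x
  lift : ℕ → X → E
  continuousOn_lift : ∀ d, ContinuousOn (lift d) {x | 0 < weight d x}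
  proj_lift : ∀ d x, 0 < weight d x → p (lift d x) = α x

namespace LabelData

open LiftSpace

variable {X : Type u} [TopologicalSpace X] {E : Type v} [TopologicalSpace E] {Z : Type v}
  [TopologicalSpace Z] {p : E → Z} {α : C(X, Z)} (L : LabelData p α)

lemma exists_index (x : X) : ∃ d, d < L.bound ∧ ∀ d' < L.bound, L.weight d' x ≤ L.weight d x := by
  obtain ⟨d, hd, h⟩ := Finset.exists_max_image (Finset.range L.bound) (fun d => L.weight d x)
    ⟨L.dim x, Finset.mem_range.2 (L.dim_lt x)⟩
  exact ⟨d, Finset.mem_range.1 hd, fun d' hd' => h d' (Finset.mem_range.2 hd')⟩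

/-- A dimension whose weight is maximal at a point. -/
def index (x : X) : ℕ := (L.exists_index x).choose

lemma index_lt (x : X) : L.index x < L.bound := (L.exists_index x).choose_spec.1

lemma weight_le (x : X) {d : ℕ} (hd : d < L.bound) : L.weight d x ≤ L.weight (L.index x) x :=
  (L.exists_index x).choose_spec.2 d hd

lemma weight_index_pos (x : X) : 0 < L.weight (L.index x) x :=
  (L.weight_pos x).trans_le (L.weight_le x (L.dim_lt x))

/-- Weights of larger dimension vanish at the point. Hence over the `(j - 1)`-skeleton only `j`
indices can occur. -/
lemma index_le_dim (x : X) : L.index x ≤ L.dim x := by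
  by_contra h
  have := L.weight_eq_zero _ _ (not_le.1 h)
  exact (L.weight_index_pos x).ne' this

/-! ### Simplices that are small with respect to the weights -/

/-- On short segments with end points of the same index, the weight of this index is positive. -/
def Fine (δ : ℝ) {n : ℕ} (σ : SingularSimplex X n) : Prop :=
  ∀ x y, dist x y ≤ δ → L.index (σ x) = L.index (σ y) →
    ∀ t, 0 < L.weight (L.index (σ x)) (σ (simplexSegment t x y))

lemma Fine.mono {δ δ' : ℝ} (h : δ ≤ δ') {n : ℕ} {σ : SingularSimplex X n} (hσ : L.Fine δ' σ) :
    L.Fine δ σ := fun x y hxy => hσ x y (hxy.trans h)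

lemma Fine.restrict {δ : ℝ} {n m : ℕ} {σ : SingularSimplex X n} (hσ : L.Fine δ σ)
    {f : Fin (m + 1) → Fin (n + 1)} (hf : Function.Injective f) : L.Fine δ (σ.restrict f) := by
  intro x y hxy hi t
  rw [SingularSimplex.restrict_apply, SingularSimplex.restrict_apply, map_simplexSegment]
  exact hσ _ _ ((dist_map_le hf x y).trans hxy) hi t

/-- The set where a given weight is maximal is compact and that weight is positive on it, so it
stays positive on a thickening. Only finitely many weights matter, so one radius serves all. -/
lemma exists_fine {n : ℕ} (σ : SingularSimplex X n) : ∃ δ > 0, L.Fine δ σ := by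
  let C : ℕ → Set (stdSimplex ℝ (Fin (n + 1))) := fun d =>
    {x | (∀ d' < L.bound, L.weight d' (σ x) ≤ L.weight d (σ x))}
  have hC : ∀ d, IsClosed (C d) := by
    intro d
    have : C d = ⋂ d' : Set.Iio L.bound, {x | L.weight d' (σ x) ≤ L.weight d (σ x)} := by
      ext x
      simp [C]
    rw [this]
    exact isClosed_iInter fun d' => isClosed_le ((L.continuous_weight _).comp σ.continuous)
      ((L.continuous_weight _).comp σ.continuous)
  have key : ∀ d : ℕ, ∃ δ > 0, ∀ x ∈ C d, ∀ y, dist y x ≤ δ → 0 < L.weight d (σ y) := by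
    intro d
    have hopen : IsOpen {x | 0 < L.weight d (σ x)} :=
      isOpen_lt continuous_const ((L.continuous_weight _).comp σ.continuous)
    obtain ⟨δ, hδ, h⟩ := (hC d).isCompact.exists_cthickening_subset_open hopen fun x hx =>
      (L.weight_pos (σ x)).trans_le (hx _ (L.dim_lt _))
    exact ⟨δ, hδ, fun x hx y hxy => h (Metric.mem_cthickening_of_dist_le y x δ _ hx hxy)⟩
  choose δ hδ h using key
  obtain ⟨ε, hε, hle⟩ : ∃ ε > 0, ∀ d < L.bound, ε ≤ δ d := by
    by_cases hb : L.bound = 0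
    · exact ⟨1, one_pos, fun d hd => by omega⟩
    · obtain ⟨d, -, hd⟩ := Finset.exists_min_image (Finset.range L.bound) δ
        ⟨0, Finset.mem_range.2 (Nat.pos_of_ne_zero hb)⟩
      exact ⟨δ d, hδ d, fun d' hd' => hd d' (Finset.mem_range.2 hd')⟩
  refine ⟨ε, hε, fun x y hxy _ t => ?_⟩
  exact h _ x (fun d' hd' => L.weight_le _ hd') _
    (((dist_simplexSegment_le t x y).trans hxy).trans (hle _ (L.index_lt _)))

lemma exists_fine_finset {n : ℕ} (A : Finset (SingularSimplex X n)) :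
    ∃ δ > 0, ∀ σ ∈ A, L.Fine δ σ := by
  classical
  induction A using Finset.induction_on with
  | empty => exact ⟨1, one_pos, by simp⟩
  | insert σ A _ ih =>
    obtain ⟨δ, hδ, h⟩ := ih
    obtain ⟨δ', hδ', h'⟩ := L.exists_fine σ
    refine ⟨min δ δ', lt_min hδ hδ', fun τ hτ => ?_⟩
    rcases Finset.mem_insert.1 hτ with rfl | hτ
    · exact Fine.mono L (min_le_right _ _) h'
    · exact Fine.mono L (min_le_left _ _) (h τ hτ)

/-! ### Simplices that are regular with respect to the dimension -/

/-- Conditions on the dimension function along a simplex which imply that edges and segments to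
the barycenter determine the labels of their ends. -/
structure Regular {n : ℕ} (σ : SingularSimplex X n) : Prop where
  vertex : ∀ i j, L.dim (σ (stdSimplex.vertex i)) = L.dim (σ (stdSimplex.vertex j)) →
    ∀ t, L.dim (σ (simplexSegment t (stdSimplex.vertex i) (stdSimplex.vertex j))) =
      L.dim (σ (stdSimplex.vertex i))
  dim_le : ∀ x, L.dim (σ x) ≤ L.dim (σ stdSimplex.barycenter)
  barycenter : ∀ x, L.dim (σ x) = L.dim (σ stdSimplex.barycenter) →
    ∀ t, L.dim (σ (simplexSegment t x stdSimplex.barycenter)) = L.dim (σ x)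

/-- All faces of a simplex are regular. -/
def HereditarilyRegular {n : ℕ} (σ : SingularSimplex X n) : Prop :=
  ∀ m (f : Fin (m + 1) → Fin (n + 1)), Function.Injective f → L.Regular (σ.restrict f)

lemma HereditarilyRegular.restrict {n m : ℕ} {σ : SingularSimplex X n}
    (h : L.HereditarilyRegular σ) {f : Fin (m + 1) → Fin (n + 1)} (hf : Function.Injective f) :
    L.HereditarilyRegular (σ.restrict f) := fun k g hg => by
  rw [SingularSimplex.restrict_restrict]
  exact h k _ (hf.comp hg)

lemma HereditarilyRegular.regular {n : ℕ} {σ : SingularSimplex X n}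
    (h : L.HereditarilyRegular σ) : L.Regular σ := by
  have := h n id Function.injective_id
  rwa [SingularSimplex.restrict_id] at this

/-! ### The labels of the points of the pullback -/

variable [PreconnectedSpace E] (H : Contraction E) (hp : IsCoveringMap p)

open Classical in
/-- The deck transformation that takes the lift over the neighborhood of the points of dimension
`d` to a given lift. -/
def label (d : ℕ) (z : LiftSpace p α) : Deck p :=
  -- Outside the domain of the lift the value is a default.
  if h : 0 < L.weight d (fst z) then
    (H.exists_deck hp ((L.proj_lift d _ h).trans (map_fst z))).choose else 1

lemma label_spec {d : ℕ} {z : LiftSpace p α} (h : 0 < L.weight d (fst z)) :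
    (L.label H hp d z).toMap (L.lift d (fst z)) = snd z := by
  rw [label, dif_pos h]
  exact (H.exists_deck hp ((L.proj_lift d _ h).trans (map_fst z))).choose_spec

lemma label_deck {d : ℕ} {z : LiftSpace p α} (h : 0 < L.weight d (fst z)) (g : Deck p) :
    L.label H hp d (deck g z) = g * L.label H hp d z := by
  refine Deck.eq_of_apply_eq hp (x := L.lift d (fst z)) ?_
  rw [Deck.mul_toMap_apply, L.label_spec H hp h]
  exact L.label_spec H hp (z := deck g z) h

/-- Along the segment the translated chosen lift and the given lift cover the same path and agree at
the start, hence at the end; deck transformations agreeing at one point coincide. -/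
lemma label_eq {n d : ℕ} (σ : SingularSimplex (LiftSpace p α) n)
    {x y : stdSimplex ℝ (Fin (n + 1))}
    (h : ∀ t, 0 < L.weight d (fst (σ (simplexSegment t x y)))) :
    L.label H hp d (σ x) = L.label H hp d (σ y) := by
  have hx : 0 < L.weight d (fst (σ x)) := by
    have := h 0
    rwa [simplexSegment_zero] at this
  have hy : 0 < L.weight d (fst (σ y)) := by
    have := h 1
    rwa [simplexSegment_one] at this
  set g := L.label H hp d (σ x) with hg
  have hseg : Continuous fun t => simplexSegment t x y :=
    continuous_simplexSegment.comp (by fun_prop : Continuous fun t : unitInterval => (t, x, y))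
  have hlift : Continuous fun t => L.lift d (fst (σ (simplexSegment t x y))) :=
    (L.continuousOn_lift d).comp_continuous (by fun_prop) h
  have := hp.eq_of_comp_eq (g₁ := fun t => g.toMap (L.lift d (fst (σ (simplexSegment t x y)))))
    (g₂ := fun t => snd (σ (simplexSegment t x y))) (by fun_prop) (by fun_prop)
    (funext fun t => by
      simp only [Function.comp_apply, g.proj_apply, L.proj_lift d _ (h t), map_fst]) 0
    (by simp only [simplexSegment_zero, hg, L.label_spec H hp hx])
  have h1 := congr_fun this 1
  simp only [simplexSegment_one] at h1
  refine Deck.eq_of_apply_eq hp (x := L.lift d (fst (σ y))) ?_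
  rw [h1, L.label_spec H hp hy]

/-- The label of a point with respect to its dimension. -/
def cellLabel (z : LiftSpace p α) : ℕ × Deck p :=
  (L.dim (fst z), L.label H hp (L.dim (fst z)) z)

/-- The label of a point with respect to its index. -/
def handleLabel (z : LiftSpace p α) : ℕ × Deck p :=
  (L.index (fst z), L.label H hp (L.index (fst z)) z)

/-- The action of a deck transformation on labels. -/
def shift (g : Deck p) (w : ℕ × Deck p) : ℕ × Deck p := (w.1, g * w.2)

lemma cellLabel_deck (g : Deck p) (z : LiftSpace p α) :
    L.cellLabel H hp (deck g z) = shift g (L.cellLabel H hp z) :=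
  Prod.ext rfl (L.label_deck H hp (z := z) (L.weight_pos _) g)

lemma handleLabel_deck (g : Deck p) (z : LiftSpace p α) :
    L.handleLabel H hp (deck g z) = shift g (L.handleLabel H hp z) :=
  Prod.ext rfl (L.label_deck H hp (z := z) (L.weight_index_pos _) g)

lemma cellLabel_eq {n : ℕ} (σ : SingularSimplex (LiftSpace p α) n)
    {x y : stdSimplex ℝ (Fin (n + 1))}
    (h : ∀ t, L.dim (fst (σ (simplexSegment t x y))) = L.dim (fst (σ x))) :
    L.cellLabel H hp (σ x) = L.cellLabel H hp (σ y) := by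
  have hy : L.dim (fst (σ y)) = L.dim (fst (σ x)) := by
    have := h 1
    rwa [simplexSegment_one] at this
  refine Prod.ext hy.symm ?_
  simp only [cellLabel, hy]
  exact L.label_eq H hp σ fun t => by
    have := L.weight_pos (fst (σ (simplexSegment t x y)))
    rwa [h t] at this

lemma handleLabel_eq_cellLabel {z : LiftSpace p α} (h : L.index (fst z) = L.dim (fst z)) :
    L.handleLabel H hp z = L.cellLabel H hp z := by
  simp only [handleLabel, cellLabel, h]

/-- The tuples of labels of points of a simplex in which labels of the same dimension coincide. -/
def flags {n : ℕ} (σ : SingularSimplex (LiftSpace p α) n) (m : ℕ) :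
    Set (Fin (m + 1) → ℕ × Deck p) :=
  {u | (∀ k, ∃ x, u k = L.cellLabel H hp (σ x) ∨ u k = L.handleLabel H hp (σ x)) ∧
    ∀ k l, (u k).1 = (u l).1 → u k = u l}

/-- Pigeonhole: `m + 1` entries have dimensions among `m` values, so two dimensions coincide, and in
a flag the labels then coincide. -/
lemma alternate_single_eq_zero_of_mem_flags {n : ℕ} {σ : SingularSimplex (LiftSpace p α) n} {m : ℕ}
    (hm : ∀ x, L.dim (fst (σ x)) < m) {u : Fin (m + 1) → ℕ × Deck p}
    (hu : u ∈ L.flags H hp σ m) : alternate _ m (Finsupp.single u 1) = 0 := by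
  have hlt : ∀ k, (u k).1 < m := by
    intro k
    obtain ⟨x, h | h⟩ := hu.1 k
    · rw [h]
      exact hm x
    · rw [h]
      exact (L.index_le_dim _).trans_lt (hm x)
  obtain ⟨k, l, hkl, h⟩ := Fintype.exists_ne_map_eq_of_card_lt
    (fun k : Fin (m + 1) => (⟨(u k).1, hlt k⟩ : Fin m)) (by simp)
  exact alternate_single_eq_zero hkl (hu.2 k l (congrArg Fin.val h))

lemma flags_face_subset {n : ℕ} (σ : SingularSimplex (LiftSpace p α) (n + 1)) (i : Fin (n + 2))
    (m : ℕ) : L.flags H hp (σ.face i) m ⊆ L.flags H hp σ m := fun u hu =>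
  ⟨fun k => by
    obtain ⟨x, hx⟩ := hu.1 k
    exact ⟨_, hx⟩, hu.2⟩

/-- For cell labels regularity does the work and no subdivision is needed. -/
lemma evalChain_cellLabel_mem {n : ℕ} {σ : SingularSimplex (LiftSpace p α) n}
    (hσ : L.Regular (fst.comp σ)) :
    evalChain (L.cellLabel H hp) 0 n (Finsupp.single σ 1) ∈
      Finsupp.supported ℝ ℝ (L.flags H hp σ n) := by
  rw [evalChain_zero_single]
  refine Finsupp.single_mem_supported ℝ 1 ⟨fun k => ⟨_, Or.inl rfl⟩, fun k l h => ?_⟩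
  exact L.cellLabel_eq H hp σ (hσ.vertex k l h)

/-- For handle labels subdivision does the work and no regularity is needed, so this applies to an
arbitrary chain in the skeleton. -/
lemma evalChain_handleLabel_mem {n N : ℕ} {δ : ℝ} {σ : SingularSimplex (LiftSpace p α) n}
    (hσ : L.Fine δ (fst.comp σ)) (hN : ((n : ℝ) / (n + 1)) ^ N ≤ δ) :
    evalChain (L.handleLabel H hp) N n (Finsupp.single σ 1) ∈
      Finsupp.supported ℝ ℝ (L.flags H hp σ n) := by
  rw [evalChain_single]
  refine map_mem_of_mem_supported (simplexChain_mem_supported N n) _ _ fun u hu => ?_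
  rw [tupleMap_single]
  refine Finsupp.single_mem_supported ℝ 1 ⟨fun k => ⟨u k, Or.inr rfl⟩, fun k l h => ?_⟩
  refine Prod.ext h ?_
  change L.label H hp (L.index (fst (σ (u k)))) (σ (u k)) =
    L.label H hp (L.index (fst (σ (u l)))) (σ (u l))
  have h' : L.index (fst (σ (u k))) = L.index (fst (σ (u l))) := h
  rw [← h']
  exact L.label_eq H hp σ (hσ (u k) (u l) ((hu k l).trans hN) h')

/-- The chain homotopy between the two chain maps given by the two kinds of labels. -/
def labelHomotopy (N n : ℕ) :
    Chain (LiftSpace p α) n →ₗ[ℝ] TupleChain (ℕ × Deck p) (n + 1) :=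
  coneHomotopy (fun n σ => tupleCone (L.cellLabel H hp (σ stdSimplex.barycenter)) n)
    (fun n => evalChain (L.cellLabel H hp) 0 n - evalChain (L.handleLabel H hp) N n) n

lemma labelHomotopy_spec (N n : ℕ) (x : Chain (LiftSpace p α) (n + 1)) :
    tupleBoundary _ (n + 1) (L.labelHomotopy H hp N (n + 1) x) +
      L.labelHomotopy H hp N n (boundary _ n x) =
    evalChain (L.cellLabel H hp) 0 (n + 1) x - evalChain (L.handleLabel H hp) N (n + 1) x := by
  refine (coneHomotopy_spec (fun n => tupleBoundary (ℕ × Deck p) n) _ _ ?_ ?_ ?_).2 n x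
  · intro n x
    simp only [LinearMap.sub_apply, map_sub, tupleBoundary_evalChain]
  · intro n σ x hx
    rw [tupleBoundary_tupleCone_succ, hx, map_zero, sub_zero]
  · intro σ
    rw [tupleBoundary_tupleCone_zero, LinearMap.sub_apply, map_sub, augmentation_evalChain_single,
      augmentation_evalChain_single, sub_self, zero_smul, sub_zero]

lemma labelHomotopy_deck (N n : ℕ) (g : Deck p) (x : Chain (LiftSpace p α) n) :
    L.labelHomotopy H hp N n (chainMap (deck g) n x) =
      tupleMap (shift g) (n + 1) (L.labelHomotopy H hp N n x) := by
  refine coneHomotopy_equivariant _ _ (deck g) (fun n => tupleMap (shift g) n) ?_ ?_ n x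
  · intro n x
    simp only [LinearMap.sub_apply, map_sub, evalChain_chainMap (L.cellLabel_deck H hp g),
      evalChain_chainMap (L.handleLabel_deck H hp g)]
  · intro n σ x
    rw [tupleMap_tupleCone]
    exact congrArg (fun a => tupleCone a n (tupleMap (shift g) n x)) (L.cellLabel_deck H hp g _)

/-- Each step cones off with the cell label of the barycenter, a point of maximal dimension; the
flag property survives because entries of that dimension already have that label. Faces inherit both
hypotheses, which drives the induction. -/
lemma labelHomotopy_mem {N : ℕ} {δ : ℝ} {n : ℕ} (hN : ∀ m ≤ n, ((m : ℝ) / (m + 1)) ^ N ≤ δ)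
    (σ : SingularSimplex (LiftSpace p α) n) (hσ : L.HereditarilyRegular (fst.comp σ))
    (hδ : L.Fine δ (fst.comp σ)) :
    L.labelHomotopy H hp N n (Finsupp.single σ 1) ∈
      Finsupp.supported ℝ ℝ (L.flags H hp σ (n + 1)) := by
  have hcone : ∀ n (σ : SingularSimplex (LiftSpace p α) n), L.Regular (fst.comp σ) →
      ∀ x ∈ Finsupp.supported ℝ ℝ (L.flags H hp σ n),
      tupleCone (L.cellLabel H hp (σ stdSimplex.barycenter)) n x ∈
        Finsupp.supported ℝ ℝ (L.flags H hp σ (n + 1)) := by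
    intro n σ hσ x hx
    refine map_mem_of_mem_supported hx _ _ fun u hu => ?_
    rw [tupleCone_single]
    have key : ∀ k, (u k).1 = (L.cellLabel H hp (σ stdSimplex.barycenter)).1 →
        u k = L.cellLabel H hp (σ stdSimplex.barycenter) := by
      intro k hk
      obtain ⟨x, h | h⟩ := hu.1 k
      · rw [h] at hk ⊢
        exact L.cellLabel_eq H hp σ (hσ.barycenter x hk)
      · rw [h] at hk ⊢
        have hk' : L.index (fst (σ x)) = L.dim (fst (σ stdSimplex.barycenter)) := hk
        have h1 : L.dim (fst (σ x)) ≤ L.dim (fst (σ stdSimplex.barycenter)) := hσ.dim_le x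
        have h2 := L.index_le_dim (fst (σ x))
        -- The index is at most the dimension at `x`, which is at most that at the barycenter;
        -- equality of the extremes forces all three equal.
        have h3 : L.dim (fst (σ x)) = L.dim (fst (σ stdSimplex.barycenter)) := by omega
        rw [L.handleLabel_eq_cellLabel H hp (hk'.trans h3.symm)]
        exact L.cellLabel_eq H hp σ (hσ.barycenter x h3)
    refine Finsupp.single_mem_supported ℝ 1 (And.intro (Fin.cases ?_ fun k => ?_)
      (Fin.cases (Fin.cases ?_ fun l => ?_) fun k => Fin.cases ?_ fun l => ?_))
    · exact ⟨_, Or.inl rfl⟩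
    · rw [Fin.cons_succ]
      exact hu.1 k
    · exact fun _ => rfl
    · intro h
      rw [Fin.cons_zero, Fin.cons_succ] at h ⊢
      exact (key l h.symm).symm
    · intro h
      rw [Fin.cons_zero, Fin.cons_succ] at h ⊢
      exact key k h
    · intro h
      rw [Fin.cons_succ, Fin.cons_succ] at h ⊢
      exact hu.2 k l h
  induction n with
  | zero =>
    rw [labelHomotopy, coneHomotopy_zero_single]
    exact hcone 0 σ (HereditarilyRegular.regular L hσ) _ (Submodule.sub_mem _
      (L.evalChain_cellLabel_mem H hp (HereditarilyRegular.regular L hσ))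
      (L.evalChain_handleLabel_mem H hp hδ (hN 0 le_rfl)))
  | succ n ih =>
    rw [labelHomotopy, coneHomotopy_succ_single]
    refine hcone (n + 1) σ (HereditarilyRegular.regular L hσ) _ (Submodule.sub_mem _
      (Submodule.sub_mem _ (L.evalChain_cellLabel_mem H hp (HereditarilyRegular.regular L hσ))
      (L.evalChain_handleLabel_mem H hp hδ (hN _ le_rfl))) ?_)
    rw [boundary_single, one_smul, map_sum]
    refine Submodule.sum_mem _ fun i _ => ?_
    have h1 : Finsupp.single (σ.face i) ((-1 : ℝ) ^ (i : ℕ)) =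
        ((-1 : ℝ) ^ (i : ℕ)) • Finsupp.single (σ.face i) 1 := by simp
    rw [h1, map_smul]
    refine Submodule.smul_mem _ _ (Finsupp.supported_mono (L.flags_face_subset H hp σ i _) ?_)
    exact ih (fun m hm => hN m (hm.trans (Nat.le_succ n))) (σ.face i)
      (HereditarilyRegular.restrict L hσ Fin.succAbove_right_injective)
      (Fine.restrict L hδ Fin.succAbove_right_injective)

end LabelData

/-! ## Straightening -/

section ApexCone

variable {E : Type v} [TopologicalSpace E] {Z : Type v} {p : E → Z} (H : Contraction E)

/-- The cone over a chain with apex the image of the center under a deck transformation. -/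
def Contraction.apexCone (g : Deck p) (n : ℕ) : Chain E n →ₗ[ℝ] Chain E (n + 1) :=
  chainMap g.toMap (n + 1) ∘ₗ H.coneChain n ∘ₗ chainMap g⁻¹.toMap n

lemma chainMap_id (n : ℕ) (x : Chain E n) : chainMap (ContinuousMap.id E) n x = x := by
  suffices h : chainMap (ContinuousMap.id E) n = LinearMap.id from LinearMap.congr_fun h x
  exact Finsupp.lhom_ext fun w r => by simp

lemma chainMap_toMap_inv (g : Deck p) (n : ℕ) (x : Chain E n) :
    chainMap g.toMap n (chainMap g⁻¹.toMap n x) = x := by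
  rw [← chainMap_comp, Deck.comp_inv_toMap, chainMap_id]

lemma augmentation_chainMap {X Y : Type*} [TopologicalSpace X] [TopologicalSpace Y] (f : C(X, Y))
    (n : ℕ) (x : Chain X n) : augmentation _ (chainMap f n x) = augmentation _ x := by
  suffices h : augmentation _ ∘ₗ chainMap f n = augmentation _ from LinearMap.congr_fun h x
  exact Finsupp.lhom_ext fun w r => by simp

lemma Contraction.boundary_apexCone_zero (g : Deck p) {x : Chain E 0} (hx : augmentation _ x = 0) :
    boundary E 0 (H.apexCone g 0 x) = x := by
  simp only [apexCone, LinearMap.comp_apply]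
  rw [boundary_chainMap, boundary_coneChain_zero, augmentation_chainMap, hx, zero_smul, sub_zero,
    chainMap_toMap_inv]

lemma Contraction.boundary_apexCone_succ (g : Deck p) (n : ℕ) {x : Chain E (n + 1)}
    (hx : boundary E n x = 0) : boundary E (n + 1) (H.apexCone g (n + 1) x) = x := by
  simp only [apexCone, LinearMap.comp_apply]
  rw [boundary_chainMap, boundary_coneChain_succ, boundary_chainMap, hx, _root_.map_zero,
    _root_.map_zero, sub_zero, chainMap_toMap_inv]

lemma Contraction.apexCone_mul (g h : Deck p) (n : ℕ) (x : Chain E n) :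
    H.apexCone (g * h) n (chainMap g.toMap n x) =
      chainMap g.toMap (n + 1) (H.apexCone h n x) := by
  simp only [apexCone, LinearMap.comp_apply]
  rw [mul_inv_rev, ← chainMap_comp, ← chainMap_comp, Deck.mul_toMap h⁻¹, Deck.mul_toMap g,
    ContinuousMap.comp_assoc, Deck.inv_toMap_comp, ContinuousMap.comp_id]

/-- The straight chain with given labels of the vertices, made alternating. -/
def Contraction.spread (p : E → Z) (n : ℕ) : TupleChain (ℕ × Deck p) n →ₗ[ℝ] Chain E n :=
  H.straightChain p n ∘ₗ tupleMap Prod.snd n ∘ₗ alternate _ n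

lemma Contraction.boundary_spread (n : ℕ) (x : TupleChain (ℕ × Deck p) (n + 1)) :
    boundary E n (H.spread p (n + 1) x) = H.spread p n (tupleBoundary _ n x) := by
  simp only [spread, LinearMap.comp_apply]
  rw [boundary_straightChain, tupleBoundary_tupleMap, tupleBoundary_alternate]

lemma Contraction.augmentation_spread (x : TupleChain (ℕ × Deck p) 0) :
    augmentation _ (H.spread p 0 x) = augmentation _ x := by
  simp only [spread, LinearMap.comp_apply]
  rw [augmentation_straightChain, augmentation_tupleMap, alternate_zero_apply]

lemma Contraction.spread_shift (g : Deck p) (n : ℕ) (x : TupleChain (ℕ × Deck p) n) :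
    H.spread p n (tupleMap (LabelData.shift g) n x) = chainMap g.toMap n (H.spread p n x) := by
  simp only [spread, LinearMap.comp_apply]
  rw [alternate_tupleMap, ← tupleMap_comp, ← straightChain_smul, ← tupleMap_comp]
  rfl

lemma Contraction.lOneNorm_spread_single_le (n : ℕ) (w : Fin (n + 1) → ℕ × Deck p) :
    lOneNorm (H.spread p n (Finsupp.single w 1)) ≤ 1 := by
  simp only [spread, LinearMap.comp_apply]
  refine (lOneNorm_map_le_of_single_le_one _ (fun s => ?_) _).trans
    ((lOneNorm_map_le_of_single_le_one _ (fun s => ?_) _).trans (lOneNorm_alternate_single_le n w))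
  · rw [straightChain_single, lOneNorm_single, abs_one]
  · rw [tupleMap_single, lOneNorm_single, abs_one]

end ApexCone

/-! ### The straightening homotopy and chains in the lower skeleton -/

namespace LabelData

open LiftSpace

variable {X : Type u} [TopologicalSpace X] {E : Type v} [TopologicalSpace E] {Z : Type v}
  [TopologicalSpace Z] {p : E → Z} {α : C(X, Z)} (L : LabelData p α)
  [PreconnectedSpace E] (H : Contraction E) (hp : IsCoveringMap p)

/-- The chain map that straightens the simplices of the pullback. -/
def straighten (n : ℕ) : Chain (LiftSpace p α) n →ₗ[ℝ] Chain E n :=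
  H.spread p n ∘ₗ evalChain (L.cellLabel H hp) 0 n

lemma boundary_straighten (n : ℕ) (x : Chain (LiftSpace p α) (n + 1)) :
    boundary E n (L.straighten H hp (n + 1) x) = L.straighten H hp n (boundary _ n x) := by
  simp only [straighten, LinearMap.comp_apply]
  rw [H.boundary_spread, tupleBoundary_evalChain]

lemma straighten_deck (g : Deck p) (n : ℕ) (x : Chain (LiftSpace p α) n) :
    L.straighten H hp n (chainMap (deck g) n x) = chainMap g.toMap n (L.straighten H hp n x) := by
  simp only [straighten, LinearMap.comp_apply]
  rw [evalChain_chainMap (L.cellLabel_deck H hp g), H.spread_shift]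

/-- The chain homotopy between the projection and straightening. -/
def straightHomotopy (n : ℕ) : Chain (LiftSpace p α) n →ₗ[ℝ] Chain E (n + 1) :=
  coneHomotopy (fun n σ => H.apexCone (L.cellLabel H hp (σ stdSimplex.barycenter)).2 n)
    (fun n => chainMap snd n - L.straighten H hp n) n

lemma straightHomotopy_spec :
    (∀ x, boundary E 0 (L.straightHomotopy H hp 0 x) =
      chainMap snd 0 x - L.straighten H hp 0 x) ∧
    ∀ n x, boundary E (n + 1) (L.straightHomotopy H hp (n + 1) x) +
      L.straightHomotopy H hp n (boundary _ n x) =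
        chainMap snd (n + 1) x - L.straighten H hp (n + 1) x := by
  refine coneHomotopy_spec (fun n => boundary E n) _ _ ?_ ?_ ?_
  · intro n x
    simp only [LinearMap.sub_apply, map_sub, boundary_chainMap, boundary_straighten]
  · intro n σ x hx
    exact H.boundary_apexCone_succ _ n hx
  · intro σ
    refine H.boundary_apexCone_zero _ ?_
    rw [LinearMap.sub_apply, map_sub, augmentation_chainMap, augmentation_single, straighten,
      LinearMap.comp_apply, H.augmentation_spread, augmentation_evalChain_single, sub_self]

lemma straightHomotopy_deck (g : Deck p) (n : ℕ) (x : Chain (LiftSpace p α) n) :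
    L.straightHomotopy H hp n (chainMap (deck g) n x) =
      chainMap g.toMap (n + 1) (L.straightHomotopy H hp n x) := by
  refine coneHomotopy_equivariant (D := fun n => Chain E n) _ _ (deck g)
    (fun n => chainMap g.toMap n) ?_ ?_ n x
  · intro n x
    rw [LinearMap.sub_apply, LinearMap.sub_apply, map_sub, straighten_deck, ← chainMap_comp,
      ← chainMap_comp]
    rfl
  · intro n σ x
    change H.apexCone (L.cellLabel H hp (deck g (σ stdSimplex.barycenter))).2 n _ = _
    rw [cellLabel_deck]
    exact H.apexCone_mul g _ n x

/-- A covering map as a bundled continuous map. -/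
def projMap : C(E, Z) := ⟨p, hp.continuous⟩

omit [PreconnectedSpace E] in
lemma chainMap_projMap_toMap (g : Deck p) (n : ℕ) (x : Chain E n) :
    chainMap (projMap hp) n (chainMap g.toMap n x) = chainMap (projMap hp) n x := by
  rw [← chainMap_comp]
  congr 2
  ext z
  exact g.proj_apply z

/-- The lifted chain need not be a cycle, but its boundary projects to zero in `X`. The homotopy
term on that boundary becomes invariant once pushed to `Z`, hence vanishes. -/
lemma sub_straighten_mem_boundaries (hs : Function.Surjective p) :
    ∀ (j : ℕ) (x : Chain (LiftSpace p α) j), chainMap fst j x ∈ cycles X j →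
      chainMap α j (chainMap fst j x) - chainMap (projMap hp) j (L.straighten H hp j x) ∈
        boundaries Z j := by
  have hcomm : ∀ (j : ℕ) (x : Chain (LiftSpace p α) j), chainMap α j (chainMap fst j x) =
      chainMap (projMap hp) j (chainMap snd j x) := by
    intro j x
    rw [← chainMap_comp, ← chainMap_comp]
    congr 2
    ext z
    exact map_fst z
  rintro (_ | n) x hx
  · rw [hcomm, ← map_sub, ← (L.straightHomotopy_spec H hp).1, ← boundary_chainMap]
    exact LinearMap.mem_range_self _ _
  · have h0 : (chainMap (projMap hp) (n + 1) ∘ₗ L.straightHomotopy H hp n) (boundary _ n x) =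
        (chainMap (projMap hp) (n + 1) ∘ₗ L.straightHomotopy H hp n) 0 := by
      refine eq_of_chainMap_fst_eq H hp hs _ (fun g x => ?_) ?_
      · rw [LinearMap.comp_apply, straightHomotopy_deck, chainMap_projMap_toMap,
          LinearMap.comp_apply]
      · rw [← boundary_chainMap, map_zero]
        exact hx
    rw [LinearMap.comp_apply, map_zero] at h0
    rw [hcomm, ← map_sub, ← (L.straightHomotopy_spec H hp).2, map_add, h0, add_zero,
      ← boundary_chainMap]
    exact LinearMap.mem_range_self _ _

lemma spread_eq_zero_of_mem_flags {n : ℕ} {σ : SingularSimplex (LiftSpace p α) n} {m : ℕ}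
    (hm : ∀ x, L.dim (fst (σ x)) < m) {x : TupleChain (ℕ × Deck p) m}
    (hx : x ∈ Finsupp.supported ℝ ℝ (L.flags H hp σ m)) : H.spread p m x = 0 := by
  have := map_mem_of_mem_supported hx (H.spread p m) ⊥ fun u hu => by
    rw [Contraction.spread, LinearMap.comp_apply, LinearMap.comp_apply,
      L.alternate_single_eq_zero_of_mem_flags H hp hm hu, map_zero, map_zero]
    exact Submodule.zero_mem _
  simpa using this

/-- Comparing cell labels with handle labels expresses the straightening as a boundary plus two
error terms. Both are carried by flags with `n + 2` entries of dimension at most `n`, so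
antisymmetrization kills them. -/
lemma straighten_liftChain_mem_boundaries (hs : Function.Surjective p) (n : ℕ)
    {a : Chain X (n + 1)} (ha : ∀ σ ∈ a.support, ∀ x, L.dim (σ x) < n + 1)
    (ha' : ∀ σ ∈ (boundary X n a).support, L.HereditarilyRegular σ) :
    chainMap (projMap hp) (n + 1) (L.straighten H hp (n + 1) (liftChain hp hs α (n + 1) a)) ∈
      boundaries Z (n + 1) := by
  classical
  have hb : ∀ σ ∈ (boundary X n a).support, ∀ x, L.dim (σ x) < n + 1 := by
    have : boundary X n a ∈ Finsupp.supported ℝ ℝ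
        {σ : SingularSimplex X n | ∀ x, L.dim (σ x) < n + 1} := by
      refine map_mem_of_mem_supported (x := a)
        (A := {σ : SingularSimplex X (n + 1) | ∀ x, L.dim (σ x) < n + 1})
        (fun σ hσ => ha σ hσ) _ _ fun σ hσ => ?_
      rw [boundary_single, one_smul]
      exact Submodule.sum_mem _ fun i _ => Finsupp.single_mem_supported ℝ _ fun x => hσ _
    exact fun σ hσ => this hσ
  obtain ⟨δ₁, hδ₁, h1⟩ := L.exists_fine_finset a.support
  obtain ⟨δ₂, hδ₂, h2⟩ := L.exists_fine_finset (boundary X n a).support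
  -- The ratio for the top dimension is the worst one, so this `N` also makes all faces fine enough.
  obtain ⟨N, hN⟩ : ∃ N, ((n + 1 : ℝ) / (n + 1 + 1)) ^ N < min δ₁ δ₂ :=
    exists_pow_lt_of_lt_one (lt_min hδ₁ hδ₂) ((div_lt_one (by positivity)).2 (by linarith))
  have hN' : ∀ m : ℕ, m ≤ n + 1 → ((m : ℝ) / (m + 1)) ^ N ≤ min δ₁ δ₂ := by
    intro m hm
    refine le_trans (pow_le_pow_left₀ (by positivity) ?_ N) hN.le
    rw [div_le_div_iff₀ (by positivity) (by positivity)]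
    have : (m : ℝ) ≤ n + 1 := by exact_mod_cast hm
    nlinarith
  set x := liftChain hp hs α (n + 1) a with hx
  have hk : H.spread p (n + 1) (evalChain (L.handleLabel H hp) N (n + 1) x) = 0 := by
    have := map_mem_of_mem_supported (A := {σ | σ ∈ a.support}) (x := a) (fun σ hσ => hσ)
      (H.spread p (n + 1) ∘ₗ evalChain (L.handleLabel H hp) N (n + 1) ∘ₗ
        liftChain hp hs α (n + 1)) ⊥ fun σ hσ => by
      obtain ⟨τ, rfl, h⟩ := liftChain_single (α := α) hp hs (n + 1) σ
      rw [LinearMap.comp_apply, LinearMap.comp_apply, h]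
      refine (Submodule.mem_bot ℝ).2 (L.spread_eq_zero_of_mem_flags H hp (σ := τ) (ha _ hσ) ?_)
      refine L.evalChain_handleLabel_mem H hp (h1 _ hσ) ?_
      exact_mod_cast (hN' (n + 1) le_rfl).trans (min_le_left _ _)
    simpa using this
  have hΛ : chainMap (projMap hp) (n + 1) (H.spread p (n + 1)
      (L.labelHomotopy H hp N n (boundary _ n x))) = 0 := by
    let f := chainMap (projMap hp) (n + 1) ∘ₗ H.spread p (n + 1) ∘ₗ L.labelHomotopy H hp N n
    -- By invariance the boundary of the lift may be replaced by a lift of the boundary, whose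
    -- simplices are known to be regular.
    have hf : f (boundary _ n x) = f (liftChain hp hs α n (boundary X n a)) := by
      refine eq_of_chainMap_fst_eq H hp hs _ (fun g x => ?_) ?_
      · simp only [f, LinearMap.comp_apply]
        rw [labelHomotopy_deck, H.spread_shift, chainMap_projMap_toMap]
      · rw [← boundary_chainMap, hx, chainMap_fst_liftChain, chainMap_fst_liftChain]
    refine hf.trans ?_
    have := map_mem_of_mem_supported (A := {σ | σ ∈ (boundary X n a).support})
      (x := boundary X n a) (fun σ hσ => hσ) (f ∘ₗ liftChain hp hs α n) ⊥ fun σ hσ => by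
      obtain ⟨τ, rfl, h⟩ := liftChain_single (α := α) hp hs n σ
      simp only [f, LinearMap.comp_apply]
      rw [h, L.spread_eq_zero_of_mem_flags H hp (σ := τ) (hb _ hσ)
        (L.labelHomotopy_mem H hp (δ := min δ₁ δ₂) (fun m hm => hN' m (hm.trans (Nat.le_succ n)))
          τ (ha' _ hσ) (Fine.mono L (min_le_right _ _) (h2 _ hσ))), map_zero]
      exact Submodule.zero_mem _
    simpa using this
  have hspec := congrArg (fun y => chainMap (projMap hp) (n + 1) (H.spread p (n + 1) y))
    (L.labelHomotopy_spec H hp N n x)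
  simp only [map_add, map_sub, hk, hΛ, sub_zero, add_zero] at hspec
  rw [straighten, LinearMap.comp_apply, ← hspec, ← H.boundary_spread, ← boundary_chainMap]
  exact LinearMap.mem_range_self _ _

/-- If a cycle is the difference of a chain `c` of regular simplices and a chain of simplices of
smaller dimension, then its image in `Z` is homologous to the straightening of `c`. -/
lemma chainMap_sub_straighten_mem_boundaries (hs : Function.Surjective p) :
    ∀ (j : ℕ) {c a : Chain X j}, c - a ∈ cycles X j →
      (∀ σ ∈ a.support, ∀ x, L.dim (σ x) < j) → (∀ σ ∈ c.support, L.HereditarilyRegular σ) →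
      chainMap α j (c - a) -
        chainMap (projMap hp) j (L.straighten H hp j (liftChain hp hs α j c)) ∈ boundaries Z j := by
  intro j c a hca ha hc
  have h1 := L.sub_straighten_mem_boundaries H hp hs j
    (liftChain hp hs α j c - liftChain hp hs α j a) (by
      rwa [map_sub, chainMap_fst_liftChain, chainMap_fst_liftChain])
  rw [map_sub (chainMap fst j), chainMap_fst_liftChain, chainMap_fst_liftChain,
    map_sub (L.straighten H hp j), map_sub (chainMap (projMap hp) j)] at h1
  have h2 : chainMap (projMap hp) j (L.straighten H hp j (liftChain hp hs α j a)) ∈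
      boundaries Z j := by
    rcases j with _ | n
    -- In degree zero the skeleton is empty, so there is nothing to correct.
    · have : a = 0 := by
        rw [← Finsupp.support_eq_empty, Finset.eq_empty_iff_forall_notMem]
        exact fun σ hσ => absurd (ha σ hσ (stdSimplex.vertex 0)) (Nat.not_lt_zero _)
      rw [this, map_zero, map_zero, map_zero]
      exact Submodule.zero_mem _
    · refine L.straighten_liftChain_mem_boundaries H hp hs n ha ?_
      -- Regularity of the simplices of `∂a` is borrowed from `c`, whatever the simplices of `a`
      -- look like.
      have hb : boundary X n a = boundary X n c := by
        have : boundary X n (c - a) = 0 := hca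
        rw [map_sub, sub_eq_zero] at this
        exact this.symm
      rw [hb]
      have : boundary X n c ∈ Finsupp.supported ℝ ℝ {σ | L.HereditarilyRegular σ} := by
        refine map_mem_of_mem_supported (A := {σ | L.HereditarilyRegular σ})
          (fun σ hσ => hc σ hσ) _ _ fun σ hσ => ?_
        rw [boundary_single, one_smul]
        exact Submodule.sum_mem _ fun i _ => Finsupp.single_mem_supported ℝ _
          (HereditarilyRegular.restrict L hσ Fin.succAbove_right_injective)
      exact fun σ hσ => this hσ
  have := Submodule.sub_mem _ h1 h2
  convert this using 1
  abel

end LabelData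

/-! ## Faces of simplices -/

section Faces

lemma simplexSegment_mem_openFace {n : ℕ} {s : Finset (Fin (n + 1))}
    {x y : stdSimplex ℝ (Fin (n + 1))} (hx : x ∈ closedFace s) (hy : y ∈ openFace s)
    {t : unitInterval} (ht : 0 < (t : ℝ)) : simplexSegment t x y ∈ openFace s := by
  refine ⟨fun i hi => ?_, fun i hi => ?_⟩
  · rw [simplexSegment_apply, hx i hi, hy.1 i hi, mul_zero, mul_zero, add_zero]
  · rw [simplexSegment_apply]
    exact add_pos_of_nonneg_of_pos (mul_nonneg (sub_nonneg.2 t.2.2) (x.2.1 i))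
      (mul_pos ht (hy.2 i hi))

/-- Move from `x` towards an interior point: all later points are interior, and time tends to zero.
-/
lemma mem_closure_of_openFace {n : ℕ} {X : Type*} [TopologicalSpace X] (σ : SingularSimplex X n)
    {s : Finset (Fin (n + 1))} {x y : stdSimplex ℝ (Fin (n + 1))} (hx : x ∈ closedFace s)
    (hy : y ∈ openFace s) {A : Set X} (hA : ∀ z ∈ openFace s, σ z ∈ A) : σ x ∈ closure A := by
  have hc : Continuous fun t : unitInterval => σ (simplexSegment t x y) :=
    σ.continuous.comp (continuous_simplexSegment.comp
      (by fun_prop : Continuous fun t : unitInterval => (t, x, y)))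
  have h0 : (0 : unitInterval) ∈ closure (Ioi 0) := by
    rw [closure_Ioi' ⟨1, zero_lt_one⟩]
    exact self_mem_Ici
  have := (hc.continuousWithinAt (s := Ioi 0)).mem_closure (t := A) h0 fun t ht =>
    hA _ (simplexSegment_mem_openFace hx hy ht)
  rwa [simplexSegment_zero] at this

lemma map_mem_closedFace {n m : ℕ} (f : Fin (m + 1) → Fin (n + 1))
    (x : stdSimplex ℝ (Fin (m + 1))) :
    stdSimplex.map f x ∈ closedFace (Finset.univ.image f) := fun _ hi =>
  stdSimplex_map_apply_of_notMem x fun ⟨k, hk⟩ =>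
    hi (Finset.mem_image.2 ⟨k, Finset.mem_univ k, hk⟩)

lemma map_barycenter_mem_openFace {n m : ℕ} {f : Fin (m + 1) → Fin (n + 1)}
    (hf : Function.Injective f) :
    stdSimplex.map f (stdSimplex.barycenter : stdSimplex ℝ (Fin (m + 1))) ∈
      openFace (Finset.univ.image f) := by
  refine ⟨map_mem_closedFace f _, fun i hi => ?_⟩
  obtain ⟨k, -, rfl⟩ := Finset.mem_image.1 hi
  rw [stdSimplex_map_apply hf]
  change 0 < (stdSimplex.barycenter : stdSimplex ℝ (Fin (m + 1))).val k
  rw [stdSimplex.barycenter_apply]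
  positivity

lemma simplexSegment_vertex_mem_closedFace {n : ℕ} (t : unitInterval) (p q : Fin (n + 1)) :
    simplexSegment t (stdSimplex.vertex p) (stdSimplex.vertex q) ∈ closedFace {p, q} := by
  intro i hi
  simp only [Finset.mem_insert, Finset.mem_singleton, not_or] at hi
  rw [simplexSegment_apply, stdSimplex.vertex_coe, stdSimplex.vertex_coe, Pi.single_eq_of_ne hi.1,
    Pi.single_eq_of_ne hi.2, mul_zero, mul_zero, add_zero]

lemma eq_vertex_of_mem_faceBoundary {n : ℕ} {p q : Fin (n + 1)} (hpq : p ≠ q)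
    {x : stdSimplex ℝ (Fin (n + 1))} (hx : x ∈ faceBoundary {p, q}) :
    x = stdSimplex.vertex p ∨ x = stdSimplex.vertex q := by
  have hsum : x p + x q = 1 := by
    have h1 : ∑ i, x i = 1 := x.2.2
    rwa [← Finset.sum_subset (Finset.subset_univ {p, q}) fun i _ hi => hx.1 i hi,
      Finset.sum_pair hpq] at h1
  have key : ∀ r : Fin (n + 1), x r = 1 → (∀ i, i ≠ r → x i = 0) →
      x = stdSimplex.vertex r := fun r h1 h0 => stdSimplex_ext fun i => by
    rw [stdSimplex.vertex_coe]
    by_cases hi : i = r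
    · rw [hi, h1, Pi.single_eq_same]
    · rw [h0 i hi, Pi.single_eq_of_ne hi]
  have hzero : x p = 0 ∨ x q = 0 := by
    by_contra! h
    refine hx.2 ⟨hx.1, fun i hi => ?_⟩
    rcases Finset.mem_insert.1 hi with rfl | hi
    · exact lt_of_le_of_ne (x.2.1 i) h.1.symm
    · rw [Finset.mem_singleton] at hi
      rw [hi]
      exact lt_of_le_of_ne (x.2.1 q) h.2.symm
  have hout : ∀ i, i ≠ p → i ≠ q → x i = 0 := fun i hp hq => hx.1 i (by simp [hp, hq])
  rcases hzero with h | h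
  · refine Or.inr (key q (by linarith) fun i hi => ?_)
    by_cases hp : i = p
    · rw [hp, h]
    · exact hout i hp hi
  · refine Or.inl (key p (by linarith) fun i hi => ?_)
    by_cases hq : i = q
    · rw [hq, h]
    · exact hout i hi hq

end Faces

/-! ## Simplices that are consistent with the stratification by open cells -/

section CellStratification

variable {X : Type u} [TopologicalSpace X] [T2Space X] [CWComplex (univ : Set X)]

lemma exists_mem_stratum (x : X) : ∃ s, x ∈ (cellStratification X).stratum s :=
  exists_mem_openCell x

lemma cellDim_eq_of_mem_stratum {s : (cellStratification X).Index} {x : X}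
    (hx : x ∈ (cellStratification X).stratum s) : cellDim x = s.1 := cellDim_eq hx

lemma eq_or_dim_lt_of_below {a b : (cellStratification X).Index}
    (h : (cellStratification X).Below b a) : b = a ∨ b.1 < a.1 := by
  induction h with
  | refl => exact Or.inl rfl
  | tail _ h ih =>
    have := dim_lt_of_meets_closure X h.1 h.2
    rcases ih with rfl | ih
    · exact Or.inr this
    · exact Or.inr (this.trans ih)

/-- Directed paths of positive length strictly lower the dimension, so comparable cells of equal
dimension coincide. -/
lemma eq_of_ordered {n : ℕ} {c : Chain X n} (hc : Ordered (cellStratification X) c)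
    {σ : SingularSimplex X n} (hσ : σ ∈ c.support) {x y : stdSimplex ℝ (Fin (n + 1))}
    {a b : (cellStratification X).Index} (hx : σ x ∈ (cellStratification X).stratum a)
    (hy : σ y ∈ (cellStratification X).stratum b) (h : a.1 = b.1) : a = b := by
  rcases hc σ hσ a b ⟨_, ⟨x, rfl⟩, hx⟩ ⟨_, ⟨y, rfl⟩, hy⟩ with h' | h'
  · rcases eq_or_dim_lt_of_below h' with h'' | h''
    · exact h''
    · omega
  · rcases eq_or_dim_lt_of_below h' with h'' | h''
    · exact h''.symm
    · omega

variable {E Z : Type v} [TopologicalSpace E] [TopologicalSpace Z] {p : E → Z} {α : C(X, Z)}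

lemma exists_labelData [RelCWComplex.Finite (univ : Set X)] (hp : IsCoveringMap p)
    (hs : Function.Surjective p) (α : C(X, Z)) : ∃ L : LabelData p α, L.dim = cellDim := by
  obtain ⟨M, hM⟩ := exists_cellDim_lt X
  choose ρ s h1 h2 h3 h4 h5 h6 using exists_cellNeighborhood (X := X) hp hs α
  exact ⟨⟨cellDim, M, hM, ρ, h1, h2, fun x => h3 _ x rfl, s, h5, h6⟩, rfl⟩

/-- The order condition puts vertices of equal dimension into one cell, and internality keeps their
edge there. The cellular condition puts the interior of a face into one cell; the rest of the face
lies in its closure, hence in that cell or in lower dimension. -/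
lemma hereditarilyRegular_of_mem_support {L : LabelData p α} (hL : L.dim = cellDim) {n : ℕ}
    {c : Chain X n} (hcell : Cellular (cellStratification X) c)
    (hord : Ordered (cellStratification X) c) (hint : Internal (cellStratification X) c)
    {σ : SingularSimplex X n} (hσ : σ ∈ c.support) : L.HereditarilyRegular σ := by
  intro m f hf
  obtain ⟨s, hs⟩ := hcell σ hσ (Finset.univ.image f) (Finset.univ_nonempty.image f)
  have hbar := map_barycenter_mem_openFace hf
  have key : ∀ x : stdSimplex ℝ (Fin (m + 1)),
      σ (stdSimplex.map f x) ∈ (cellStratification X).stratum s ∨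
        cellDim (σ (stdSimplex.map f x)) < s.1 := by
    intro x
    obtain ⟨b, hb⟩ := exists_mem_stratum (σ (stdSimplex.map f x))
    by_cases hbs : b = s
    · rw [← hbs]
      exact Or.inl hb
    · rw [cellDim_eq_of_mem_stratum hb]
      exact Or.inr (dim_lt_of_meets_closure X (Ne.symm hbs)
        ⟨_, hb, mem_closure_of_openFace σ (map_mem_closedFace f x) hbar hs⟩)
  have hdim : cellDim (σ (stdSimplex.map f stdSimplex.barycenter)) = s.1 :=
    cellDim_eq_of_mem_stratum (hs _ hbar)
  constructor
  · intro i j h t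
    simp only [hL, SingularSimplex.restrict_apply, map_simplexSegment, stdSimplex.map_vertex]
      at h ⊢
    obtain ⟨a, ha⟩ := exists_mem_stratum (σ (stdSimplex.vertex (f i)))
    obtain ⟨b, hb⟩ := exists_mem_stratum (σ (stdSimplex.vertex (f j)))
    have hab : a = b := eq_of_ordered hord hσ ha hb (by
      rw [← cellDim_eq_of_mem_stratum ha, ← cellDim_eq_of_mem_stratum hb, h])
    subst hab
    rw [cellDim_eq_of_mem_stratum ha]
    refine cellDim_eq_of_mem_stratum (s := a) ?_
    by_cases hij : i = j
    · subst hij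
      have : simplexSegment t (stdSimplex.vertex (f i) : stdSimplex ℝ (Fin (n + 1)))
          (stdSimplex.vertex (f i)) = stdSimplex.vertex (f i) := stdSimplex_ext fun k => by
        rw [simplexSegment_apply]
        ring
      rwa [this]
    · refine hint σ hσ {f i, f j} (Finset.card_pair (hf.ne hij)).ge a (fun x hx => ?_) _
        (simplexSegment_vertex_mem_closedFace t _ _)
      rcases eq_vertex_of_mem_faceBoundary (hf.ne hij) hx with rfl | rfl
      · exact ha
      · exact hb
  · intro x
    rw [hL, SingularSimplex.restrict_apply, SingularSimplex.restrict_apply, hdim]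
    rcases key x with h | h
    · exact (cellDim_eq_of_mem_stratum h).le
    · exact h.le
  · intro x hx t
    rw [hL, SingularSimplex.restrict_apply, SingularSimplex.restrict_apply] at hx ⊢
    rw [hx, map_simplexSegment, hdim]
    rw [hdim] at hx
    refine cellDim_eq_of_mem_stratum (s := s) ?_
    rcases t.2.1.eq_or_lt with ht | ht
    · have : t = 0 := Subtype.ext ht.symm
      rw [this, simplexSegment_zero]
      exact (key x).resolve_right hx.not_lt
    · exact hs _ (simplexSegment_mem_openFace (map_mem_closedFace f x) hbar ht)

variable [PreconnectedSpace E] (H : Contraction E) (hp : IsCoveringMap p)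

open LiftSpace in
-- An essential simplex contributes at most its coefficient. If two vertices share a stratum,
-- regularity of their edge makes the labels equal, and the contribution is zero.
lemma chainNorm_straighten_le (hs : Function.Surjective p) {L : LabelData p α}
    (hL : L.dim = cellDim) {n : ℕ} {c : Chain X n} (hcell : Cellular (cellStratification X) c)
    (hord : Ordered (cellStratification X) c) (hint : Internal (cellStratification X) c) :
    chainNorm (chainMap (LabelData.projMap hp) n
      (L.straighten H hp n (liftChain hp hs α n c))) ≤
        essentialChainNorm (cellStratification X) c := by
  classical
  refine (lOneNorm_map_le (chainMap (LabelData.projMap hp) n ∘ₗ L.straighten H hp n ∘ₗ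
    liftChain hp hs α n) c).trans ?_
  rw [essentialChainNorm, Finset.sum_filter]
  refine Finset.sum_le_sum fun σ hσ => ?_
  obtain ⟨τ, rfl, h⟩ := liftChain_single (α := α) hp hs n σ
  simp only [LinearMap.comp_apply, h]
  rw [LabelData.straighten, LinearMap.comp_apply, evalChain_zero_single]
  split_ifs with hess
  · refine mul_le_of_le_one_right (abs_nonneg _) ((lOneNorm_map_le_of_single_le_one _
      (fun s => ?_) _).trans (H.lOneNorm_spread_single_le n _))
    rw [chainMap_single, lOneNorm_single, abs_one]
  · rw [Essential] at hess
    push Not at hess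
    obtain ⟨i, j, hij, s, hi, hj⟩ := hess
    have hreg := LabelData.HereditarilyRegular.regular L
      (hereditarilyRegular_of_mem_support hL hcell hord hint hσ)
    have hdim : L.dim (fst.comp τ (stdSimplex.vertex i)) =
        L.dim (fst.comp τ (stdSimplex.vertex j)) := by
      rw [hL, cellDim_eq_of_mem_stratum hi, cellDim_eq_of_mem_stratum hj]
    rw [Contraction.spread, LinearMap.comp_apply, LinearMap.comp_apply,
      alternate_single_eq_zero hij (L.cellLabel_eq H hp τ (hreg.vertex i j hdim)), map_zero,
      map_zero, map_zero]
    simp [lOneNorm]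

end CellStratification

/-! ## The comparison of the norms -/

lemma simplicialNorm_le {X : Type u} [TopologicalSpace X] {n : ℕ} {z w : cycles X n}
    (h : (z : Chain X n) - w ∈ boundaries X n) :
    simplicialNorm (Submodule.Quotient.mk z : Homology X n) ≤
      ENNReal.ofReal (chainNorm (w : Chain X n)) :=
  iInf₂_le w ((Submodule.Quotient.eq _).2 (by
    have := Submodule.neg_mem _ h
    rwa [neg_sub] at this))

lemma boundaries_le_cycles (X : Type u) [TopologicalSpace X] :
    ∀ n, boundaries X n ≤ cycles X n
  | 0 => le_top
  | n + 1 => by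
    rintro _ ⟨b, rfl⟩
    exact boundary_boundary n b

lemma sub_mem_relBoundaries {X : Type u} [TopologicalSpace X] {A : Set X} {n : ℕ} {z : cycles X n}
    {c : relCycles A n} (h : Submodule.Quotient.mk c =
      toRel A n (Submodule.Quotient.mk z : Homology X n)) : (c : Chain X n) - z ∈ relBoundaries A n := by
  have h' : (Submodule.Quotient.mk c : RelHomology A n) =
      Submodule.Quotient.mk (Submodule.inclusion (cycles_le_relCycles A n) z) :=
    h.trans (Submodule.mapQ_apply _ _ _ _)
  have h'' := (Submodule.Quotient.eq _).1 h'
  rw [Submodule.submoduleOf, Submodule.mem_comap, map_sub] at h''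
  exact h''

/-- The simplicial norm of the image of `h` is bounded by the norm of any relative cycle that
represents `h` and is consistent with the stratification by open cells. -/
lemma simplicialNorm_mk_chainMap_le {X : Type u} [TopologicalSpace X] [T2Space X]
    [CWComplex (univ : Set X)] [RelCWComplex.Finite (univ : Set X)] {Z : Type v}
    [TopologicalSpace Z] (hZ : HasContractibleUniversalCover Z) (α : C(X, Z)) (j : ℕ)
    (z : cycles X j) {c : Chain X j} (hcz : c - z ∈
      relBoundaries (RelCWComplex.skeletonLT (univ : Set X) (j : ℕ∞) : Set X) j)
    (hcell : Cellular (cellStratification X) c) (hord : Ordered (cellStratification X) c)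
    (hint : Internal (cellStratification X) c) :
    simplicialNorm (Submodule.Quotient.mk ⟨chainMap α j z, chainMap_mem_cycles α j z z.2⟩ :
      Homology Z j) ≤ ENNReal.ofReal (essentialChainNorm (cellStratification X) c) := by
  obtain ⟨E, _, p, _, hp, hs⟩ := hZ
  obtain ⟨H⟩ := nonempty_contraction (E := E)
  obtain ⟨L, hL⟩ := exists_labelData hp hs α
  -- Write `c - z = b + a` with `b` a boundary and `a` in the skeleton; then `c - a = z + b` is a
  -- cycle homologous to `z`.
  obtain ⟨b, hb, a, ha, hba⟩ := Submodule.mem_sup.1 hcz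
  have hca : c - a = z + b := by
    rw [← sub_eq_iff_eq_add.2 hba.symm]
    abel
  have hcyc : c - a ∈ cycles X j := by
    rw [hca]
    exact Submodule.add_mem _ z.2 (boundaries_le_cycles X j hb)
  have hadim : ∀ σ ∈ a.support, ∀ x, L.dim (σ x) < j := fun σ hσ x => by
    rw [hL, ← mem_skeletonLT_iff_cellDim]
    exact ha hσ (mem_range_self x)
  have hmain := L.chainMap_sub_straighten_mem_boundaries H hp hs j hcyc hadim fun σ hσ =>
    hereditarilyRegular_of_mem_support hL hcell hord hint hσ
  set w := chainMap (LabelData.projMap hp) j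
    (L.straighten H hp j (LiftSpace.liftChain hp hs α j c)) with hw
  have hαb : chainMap α j b ∈ boundaries Z j := by
    obtain ⟨y, rfl⟩ := hb
    exact ⟨chainMap α (j + 1) y, boundary_chainMap α j y⟩
  have hzw : chainMap α j (z : Chain X j) - w ∈ boundaries Z j := by
    have := Submodule.sub_mem _ hmain hαb
    rw [hca, map_add] at this
    convert this using 1
    abel
  have hwcyc : w ∈ cycles Z j := by
    have := Submodule.sub_mem _ (chainMap_mem_cycles α j z z.2) (boundaries_le_cycles Z j hzw)
    rwa [sub_sub_cancel] at this
  refine (simplicialNorm_le (z := ⟨chainMap α j z, chainMap_mem_cycles α j z z.2⟩)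
    (w := ⟨w, hwcyc⟩) hzw).trans (ENNReal.ofReal_le_ofReal ?_)
  exact chainNorm_straighten_le H hp hs hL hcell hord hint

theorem simplicialNorm_homologyMap_le {X : Type u} [TopologicalSpace X] [T2Space X]
    [CWComplex (univ : Set X)] [RelCWComplex.Finite (univ : Set X)] {Z : Type v}
    [TopologicalSpace Z] (hZ : HasContractibleUniversalCover Z) (α : C(X, Z)) (j : ℕ)
    (h : Homology X j) :
    simplicialNorm (homologyMap α j h) ≤ essentialNorm (cellStratification X)
      (toRel (RelCWComplex.skeletonLT (univ : Set X) (j : ℕ∞) : Set X) j h) := by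
  obtain ⟨z, rfl⟩ := Submodule.Quotient.mk_surjective _ h
  refine le_iInf fun c => le_iInf fun hc => le_iInf fun hcond => ?_
  exact simplicialNorm_mk_chainMap_le hZ α j z (sub_mem_relBoundaries hc) hcond.1 hcond.2.1
    hcond.2.2.1

end SimplicialNorm
end

theorem mainTheorem5 (X : Type*) [TopologicalSpace X] [T2Space X]
    [Topology.CWComplex (Set.univ : Set X)]
    [Topology.RelCWComplex.Finite (Set.univ : Set X)]
    (Z : Type*) [TopologicalSpace Z] (hZ : SimplicialNorm.HasContractibleUniversalCover Z)
    (α : C(X, Z)) (j : ℕ) (h : SimplicialNorm.Homology X j) :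
    SimplicialNorm.simplicialNorm (SimplicialNorm.homologyMap α j h) ≤
      SimplicialNorm.essentialNorm (SimplicialNorm.cellStratification X)
        (SimplicialNorm.toRel
          (Topology.RelCWComplex.skeletonLT (Set.univ : Set X) (j : ℕ∞) : Set X) j h) :=
  SimplicialNorm.simplicialNorm_homologyMap_le hZ α j h
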